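/- **Setup.** Consider the $\{5,4\}$ tiling of the hyperbolic plane by pentagons, and a finite patch $\Lambda$ of it grown outward from a central pentagon (with a tile it contains all neighbours of that tile that are closer to the centre). Put on every tile of $\Lambda$ the tensor $|b\rangle\mapsto|\bar b\rangle_5$ of the five-qubit code, whose basis states $|\bar 0\rangle_5,|\bar 1\rangle_5$ are Majorana dimer states with dimers from node $k$ to node $k+5$ $(k=1,\dots,5$; nodes and parities as defined below$)$; all parities are positive for $|\bar0\rangle_5$, and the dimers $\{1,6\},\{3,8\},\{5,10\}$ are flipped for $|\bar1\rangle_5$. Contract along the common edges of tiles, with a factor $\sqrt2$ per contraction. This gives the encoding $V$ from one bulk qubit per tile to one boundary qubit per open edge. Enumerate the boundary qubits in cyclic order from a pivot; let $A$ consist of the first $m$ of them, and $A^c$ of the others. Assume complementary recovery: there is a set $a$ of bulk qubits, with complement $a^c$, such that $\mathcal B(\mathcal H_a)$ is recoverable from $A$ and $\mathcal B(\mathcal H_{a^c})$ from $A^c$, where recoverable means that there is a faithful unital $*$-homomorphism $\iota$ into the operators on $A$ (resp. $A^c$) with $\iota(O)V=VO$. The RT edges are the edges of the network that separate $a\cup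 A$ from $a^c\cup A^c$ (bonds between a tile of $a$ and a tile of $a^c$, open legs in $A^c$ at tiles of $a$, open legs in $A$ at tiles of $a^c$). Write $|\overline{ij}\rangle=V|i\rangle_a|j\rangle_{a^c}$ for computational basis states $i,j$. A node is one of the two Majorana modes $\gamma_{2k-1}=Z_1\cdots Z_{k-1}X_k$, $\gamma_{2k}=Z_1\cdots Z_{k-1}Y_k$ of the $k$-th qubit, counted from the pivot; a state $\psi$ has a dimer of parity $p=\pm1$ from node $k$ to node $l$ if $(\gamma_k+\mathrm i p\gamma_l)\psi=0$; the dimer swap of $k\ne l$ is $P_{k,l}=\mathcal P_{\rm tot}(\gamma_k-\gamma_l)/\sqrt2$ with $\mathcal P_{\rm tot}=\prod Z$, and exchanges the nodes $k$ and $l$. For $A^c$ the pivot is moved to the first qubit of $A^c$. **Lemma 1.** The qubits of $A$ can be divided into logical qubits, one for each bulk qubit of $a$, auxiliary qubits, and RT qubits, one for each RT edge; likewise those of $A^c$ into logical qubits, one for each bulk qubit of $a^c$, auxiliary qubits, and RT qubits, one for each RT edge. There are unitaries $\tilde U_A$ on $\mathcal H_A$ and $\tilde U_{A^c}$ on $\mathcal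 H_{A^c}$ such that for all basis states $i,j$: 1. $\tilde U_A|\overline{ij}\rangle=|i\rangle|\chi_a\rangle|\chi_{\gamma,j}\rangle$, where $|i\rangle$ is the state of the logical qubits of $A$, $|\chi_a\rangle=|0\cdots0\rangle$ that of the auxiliary qubits of $A$, and $|\chi_{\gamma,j}\rangle$ is a state of the RT qubits of $A$ and of $A^c$ that depends only on $j$. 2. $\tilde U_{A^c}|\overline{ij}\rangle=|j\rangle|\chi_{a^c}\rangle|\chi_{\gamma,i}\rangle$, with the same properties after exchanging $(A,a,i)$ and $(A^c,a^c,j)$. 3. $\tilde U_{A^c}\tilde U_A|\overline{ij}\rangle=|i\rangle|j\rangle|\chi_a\rangle|\chi_{a^c}\rangle|\chi_\gamma\rangle$, where $|\chi_\gamma\rangle$ does not depend on $i,j$ and is the product over the RT edges $r$ of the Bell pairs $(|00\rangle+|11\rangle)/\sqrt2$ of the RT qubit of $A$ and the RT qubit of $A^c$ for $r$. 4. $\tilde U_A=\bigl(\sum_i|i\rangle\langle i|\,\mathcal X_i\bigr)\mathcal S_A$, where $\mathcal S_A$ is a product of an even number of dimer swaps between nodes of $A$, each $\mathcal X_i$ is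 a Pauli string on $A$ times a phase, and $|i\rangle\langle i|$ acts on the logical qubits of $A$; likewise for $\tilde U_{A^c}$. 5. The two nodes that $\mathcal S_A$ moves onto a logical (auxiliary) qubit of $A$ are, for all $i,j$, joined by a dimer of $|\overline{ij}\rangle$ whose parity depends only on $i$; the collection of the parities of the logical dimers determines $i$. Likewise for $A^c$, with $j$ in place of $i$. For every RT edge, the two nodes that $\mathcal S_A$ moves onto its RT qubit in $A$ are joined, for all $i,j$, by dimers of $|\overline{ij}\rangle$ to the two nodes that $\mathcal S_{A^c}$ moves onto its RT qubit in $A^c$ (the first node of one qubit belonging to the second node of the other). -/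

import Mathlib

open Complex Matrix

noncomputable section

namespace HaPPY

/-! ### The hyperbolic tiling with Schläfli symbol {5,4}

The tiles are the elements of the reflection group of the right-angled hyperbolic pentagon. The five
edges of every tile are labelled cyclically by `Fin 5` (addition is modulo 5), and the tile across
edge `i` of the tile `w` is `w * s i`, glued along its own edge `i`. -/

/-- Coxeter matrix of the right-angled pentagon: reflections in neighbouring sides commute, the
other pairs of distinct reflections generate an infinite dihedral group (entry `0`). -/
def pentagonMatrix : CoxeterMatrix (Fin 5) where
  M := Matrix.of fun i j => if i = j then 1 else if j = i + 1 ∨ i = j + 1 then 2 else 0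
  isSymm := by
    ext i j
    simp only [Matrix.transpose_apply, Matrix.of_apply]
    revert i j
    decide
  diagonal := by
    simp
  off_diagonal := by
    simp only [Matrix.of_apply]
    decide

/-- Tiles (pentagons) of the tiling. -/
abbrev Tile : Type := pentagonMatrix.Group

instance : DecidableEq Tile := Classical.decEq _

/-- The tile across edge `i` of `w`. -/
def nbr (w : Tile) (i : Fin 5) : Tile := w * pentagonMatrix.simple i

/-- Distance of a tile from the central tile `1`, counted in edges crossed. -/
def depth (w : Tile) : ℕ := pentagonMatrix.toCoxeterSystem.length w

/-- A finite patch grown outward from the central tile: with a tile it contains the neighbours of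
that tile that are closer to the centre. Every layer by layer growth (adding all tiles sharing an
edge, or all tiles sharing a vertex, with the previous patch, or any part of such a layer that
respects the growth order) gives such patches. -/
def IsPatch (Λ : Finset Tile) : Prop :=
  1 ∈ Λ ∧ ∀ w ∈ Λ, ∀ i, depth (nbr w i) < depth w → nbr w i ∈ Λ

/-- The physical legs: edges of tiles of the patch whose other side is not in the patch. -/
def openLegs (Λ : Finset Tile) : Finset (Tile × Fin 5) :=
  (Λ ×ˢ Finset.univ).filter fun p => nbr p.1 p.2 ∉ Λ

/-- The contracted legs; every contracted edge (bond) appears twice, once from either side. -/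
def bondLegs (Λ : Finset Tile) : Finset (Tile × Fin 5) :=
  (Λ ×ˢ Finset.univ).filter fun p => nbr p.1 p.2 ∈ Λ

/-- The open leg that follows the open leg `p` on a counterclockwise walk along the boundary of
the patch. Around a tile the labels increase counterclockwise if the tile is an even number of
reflections away from the centre, clockwise otherwise. The walk turns around the vertex at the end
of `p`, where (at most) four tiles meet. -/
def nextLeg (Λ : Finset Tile) (p : Tile × Fin 5) : Tile × Fin 5 :=
  let j : Fin 5 := if Even (depth p.1) then p.2 + 1 else p.2 - 1
  if nbr p.1 j ∉ Λ then (p.1, j)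
  else if nbr (nbr p.1 j) p.2 ∉ Λ then (nbr p.1 j, p.2)
  else (nbr (nbr p.1 j) p.2, j)

/-! ### Systems of qubits

The Hilbert space of qubits labelled by `ι` is the space of functions `(ι → ZMod 2) → ℂ`
(amplitudes in the computational basis); operators are matrices. -/

section Qubits

variable {ι : Type} [Fintype ι] [DecidableEq ι]

/-- The Pauli string `∏ₖ Xₖ ^ u k Zₖ ^ v k`. -/
def pauli (u v : ι → ZMod 2) : Matrix (ι → ZMod 2) (ι → ZMod 2) ℂ :=
  Matrix.of fun x y => if x = y + u then (-1) ^ (∑ k, v k * y k).val else 0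

/-- A Pauli string up to a phase. -/
def IsPauli (M : Matrix (ι → ZMod 2) (ι → ZMod 2) ℂ) : Prop :=
  ∃ (c : ℂ) (u v : ι → ZMod 2), ‖c‖ = 1 ∧ M = c • pauli u v

/-- The operator `U ⊗ 1` that acts by `U` on the qubits in `A` and trivially on the others. -/
def localOp (A : Finset ι) (U : Matrix (↥A → ZMod 2) (↥A → ZMod 2) ℂ) :
    Matrix (ι → ZMod 2) (ι → ZMod 2) ℂ :=
  Matrix.of fun x y =>
    if ∀ l, l ∉ A → x l = y l then U (fun l => x l) (fun l => y l) else 0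

/-- A configuration of all qubits from one of the qubits in `s` and one of the others. -/
def glue (s : Finset ι) (x : ↥s → ZMod 2) (y : ↥sᶜ → ZMod 2) : ι → ZMod 2 :=
  fun l => if h : l ∈ s then x ⟨l, h⟩ else y ⟨l, Finset.mem_compl.2 h⟩

/-- Amplitude at `x` of the basis state `|i⟩` of the qubits at the positions `q v`. -/
def ketAt {α : Type} [Fintype α] (q : α → ι) (i : α → ZMod 2) (x : ι → ZMod 2) : ℂ :=
  if ∀ v, x (q v) = i v then 1 else 0

/-- The projector `|i⟩⟨i| ⊗ 1` for the qubits at the positions `q v`. -/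
def projAt {α : Type} [Fintype α] (q : α → ι) (i : α → ZMod 2) :
    Matrix (ι → ZMod 2) (ι → ZMod 2) ℂ :=
  Matrix.diagonal (ketAt q i)

/-- Amplitudes of the Bell pair `(|00⟩ + |11⟩) / √2`. -/
def bell (s t : ZMod 2) : ℂ := if s = t then ((Real.sqrt 2 : ℝ) : ℂ)⁻¹ else 0

/-! ### Majorana dimers

A node `(l, c)` is the first (`c = 0`) or second (`c = 1`) Majorana mode of the qubit `l`. An
ordering `ord` of the qubits, starting at the pivot, fixes the Jordan-Wigner transformation. -/

/-- The Majorana operators `Z ⋯ Z X` and `Z ⋯ Z Y` (note `Y = i X Z`). -/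
def majorana {N : ℕ} (ord : Fin N ≃ ι) (k : ι × ZMod 2) :
    Matrix (ι → ZMod 2) (ι → ZMod 2) ℂ :=
  (if k.2 = 0 then (1 : ℂ) else I) •
    pauli (Pi.single k.1 1)
      (fun l => if ord.symm l < ord.symm k.1 ∨ (l = k.1 ∧ k.2 = 1) then 1 else 0)

/-- `ψ` has a dimer from node `k` to node `l` of parity `(-1) ^ p`. -/
def HasDimer {N : ℕ} (ord : Fin N ≃ ι) (ψ : (ι → ZMod 2) → ℂ) (k l : ι × ZMod 2)
    (p : ZMod 2) : Prop :=
  (majorana ord k + (I * (-1) ^ p.val) • majorana ord l) *ᵥ ψ = 0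

/-- The dimer swap operator `P_tot (γ_k - γ_l) / √2`, where `P_tot = ∏ Z` is the total parity. -/
def dimerSwap {N : ℕ} (ord : Fin N ≃ ι) (k l : ι × ZMod 2) :
    Matrix (ι → ZMod 2) (ι → ZMod 2) ℂ :=
  ((Real.sqrt 2 : ℝ) : ℂ)⁻¹ • (pauli 0 (fun _ => 1) * (majorana ord k - majorana ord l))

/-- A product of dimer swaps. -/
def swapProd {N : ℕ} (ord : Fin N ≃ ι) (S : List ((ι × ZMod 2) × (ι × ZMod 2))) :
    Matrix (ι → ZMod 2) (ι → ZMod 2) ℂ :=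
  (S.map fun p => dimerSwap ord p.1 p.2).prod

/-- The permutation of the nodes that a product of dimer swaps induces on dimers. -/
def nodePerm (S : List ((ι × ZMod 2) × (ι × ZMod 2))) : Equiv.Perm (ι × ZMod 2) :=
  (S.map fun p => Equiv.swap p.1 p.2).prod

/-- The unitary `U` on the qubits in `A` is composed of an even number of dimer swaps `S` between
nodes in `A`, followed by Pauli flips controlled by the logical information: if the qubits of `A`
at the positions `q v` are in the state `|i⟩` in the end, the Pauli string `X i` on `A` has been
applied. -/
def IsSwapFlip {N : ℕ} (ord : Fin N ≃ ι) (A : Finset ι) {α : Type} [Fintype α] [DecidableEq α]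
    (q : α → ↥A) (S : List ((ι × ZMod 2) × (ι × ZMod 2)))
    (U : Matrix (↥A → ZMod 2) (↥A → ZMod 2) ℂ) : Prop :=
  Even S.length ∧ (∀ p ∈ S, p.1 ≠ p.2 ∧ p.1.1 ∈ A ∧ p.2.1 ∈ A) ∧
  ∃ X : (α → ZMod 2) → Matrix (↥A → ZMod 2) (↥A → ZMod 2) ℂ, (∀ i, IsPauli (X i)) ∧
    localOp A U = localOp A (∑ i, projAt q i * X i) * swapProd ord S

/-! ### Complementary recovery -/

/-- The algebra of the bulk qubits in `a` is recoverable from the boundary qubits in `A`: there is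
a faithful unital *-homomorphism `f` such that `(f O ⊗ 1) V = V (O ⊗ 1)` for all `O`. -/
def Recoverable {β : Type} [Fintype β] [DecidableEq β]
    (V : Matrix (ι → ZMod 2) (β → ZMod 2) ℂ) (a : Finset β) (A : Finset ι) : Prop :=
  ∃ f : Matrix (↥a → ZMod 2) (↥a → ZMod 2) ℂ →⋆ₐ[ℂ] Matrix (↥A → ZMod 2) (↥A → ZMod 2) ℂ,
    Function.Injective f ∧ ∀ O, localOp A (f O) * V = V * localOp a O

/-- Complementary recovery: `a` is recoverable from `A`, and the other bulk qubits, whose operators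
form the commutant, are recoverable from the other boundary qubits. -/
def ComplementaryRecovery {β : Type} [Fintype β] [DecidableEq β]
    (V : Matrix (ι → ZMod 2) (β → ZMod 2) ℂ) (a : Finset β) (A : Finset ι) : Prop :=
  Recoverable V a A ∧ Recoverable V aᶜ Aᶜ

end Qubits

/-! ### The code -/

/-- Up to normalization, the amplitudes of the logical basis states `|b̄⟩₅` of the five-qubit code:
the sum of the entries of `x` has to be `b`, and the sign is `(-1) ^ (b + ∑ x i x (i + 1))`. -/
def codewordSign (b : ZMod 2) (x : Fin 5 → ZMod 2) : ℤ :=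
  if ∑ i, x i = b then (-1) ^ (b + ∑ i, x i * x (i + 1)).val else 0

/-- The logical basis states `|b̄⟩₅` of the five-qubit code. -/
def codeword (b : ZMod 2) (x : Fin 5 → ZMod 2) : ℂ := (codewordSign b x : ℂ) / 4

/-- The encoding isometry of the tensor network on the patch: a five-qubit code tensor on every
tile, all bonds contracted, with a factor `√2` for every bond. The sum runs over the values of all
legs of all tiles that agree on the two sides of every bond and with `x` on the open legs. -/
def encoding (Λ : Finset Tile) :
    Matrix (↥(openLegs Λ) → ZMod 2) (↥Λ → ZMod 2) ℂ :=
  Matrix.of fun x b =>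
    ((Real.sqrt 2 : ℝ) : ℂ) ^ ((bondLegs Λ).card / 2) *
      ∑ y : ↥Λ → Fin 5 → ZMod 2,
        if (∀ (w w' : ↥Λ) (i : Fin 5), nbr w i = w' → y w i = y w' i) ∧
            (∀ l : ↥(openLegs Λ), ∀ w : ↥Λ, (w : Tile) = l.1.1 → y w l.1.2 = x l)
        then ∏ w, codeword (b w) (y w) else 0

/-- The edges of the network cut by the Ryu-Takayanagi surface between the wedge `a` of `A` and
the wedge of the complement: the bonds between a tile in `a` and a tile not in `a` (represented by
their leg at the tile in `a`), and the open legs that separate a tile in `a` from the complement of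
`A` or a tile not in `a` from `A`. -/
def rtEdges (Λ : Finset Tile) (a : Finset ↥Λ) (A : Finset ↥(openLegs Λ)) :
    Finset (Tile × Fin 5) :=
  let a' := a.map (Function.Embedding.subtype _)
  let A' := A.map (Function.Embedding.subtype _)
  ((bondLegs Λ).filter fun p => p.1 ∈ a' ∧ nbr p.1 p.2 ∉ a') ∪
    ((openLegs Λ).filter fun p => (p.1 ∈ a' ∧ p ∉ A') ∨ (p.1 ∉ a' ∧ p ∈ A'))

/-- The first `m` elements of an enumeration. -/
def initialSegment {ι : Type} [Fintype ι] {N : ℕ} (e : Fin N ≃ ι) (m : ℕ) : Finset ι :=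
  Finset.univ.filter fun l => (e.symm l : ℕ) < m

/-! ### The codewords are dimer states -/

theorem pauli_mulVec {ι : Type} [Fintype ι] [DecidableEq ι] (u v : ι → ZMod 2)
    (ψ : (ι → ZMod 2) → ℂ) (x : ι → ZMod 2) :
    (pauli u v *ᵥ ψ) x = (-1) ^ (∑ k, v k * (x + u) k).val * ψ (x + u) := by
  have h2 : u + u = 0 := by
    ext k
    exact CharTwo.add_self_eq_zero (u k)
  have h : ∀ y : ι → ZMod 2, (x = y + u) ↔ (y = x + u) := fun y =>
    ⟨fun h => by rw [h, add_assoc, h2, add_zero], fun h => by rw [h, add_assoc, h2, add_zero]⟩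
  simp [Matrix.mulVec, dotProduct, pauli, h]

theorem codewordSign_odd : ∀ (b : ZMod 2) (k : Fin 5), k ∈ ({0, 1, 2} : Finset (Fin 5)) →
    ∀ x : Fin 5 → ZMod 2,
      (-1) ^ (∑ l, (if (Equiv.refl (Fin 5)).symm l <
          (Equiv.refl (Fin 5)).symm k ∨ (l = k ∧ (0 : ZMod 2) = 1)
          then (1 : ZMod 2) else 0) * (x + Pi.single k 1 : Fin 5 → ZMod 2) l).val *
          codewordSign b (x + Pi.single k 1) =
      (-1) ^ b.val * ((-1) ^ (∑ l, (if (Equiv.refl (Fin 5)).symm l <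
          (Equiv.refl (Fin 5)).symm (k + 2) ∨ (l = k + 2 ∧ (1 : ZMod 2) = 1)
          then (1 : ZMod 2) else 0) * (x + Pi.single (k + 2) 1 : Fin 5 → ZMod 2) l).val *
          codewordSign b (x + Pi.single (k + 2) 1)) := by
  decide +kernel

theorem codewordSign_even : ∀ (b : ZMod 2) (k : Fin 5), k ∈ ({0, 1} : Finset (Fin 5)) →
    ∀ x : Fin 5 → ZMod 2,
      (-1) ^ (∑ l, (if (Equiv.refl (Fin 5)).symm l <
          (Equiv.refl (Fin 5)).symm k ∨ (l = k ∧ (1 : ZMod 2) = 1)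
          then (1 : ZMod 2) else 0) * (x + Pi.single k 1 : Fin 5 → ZMod 2) l).val *
          codewordSign b (x + Pi.single k 1) =
      -((-1) ^ (∑ l, (if (Equiv.refl (Fin 5)).symm l <
          (Equiv.refl (Fin 5)).symm (k + 3) ∨ (l = k + 3 ∧ (0 : ZMod 2) = 1)
          then (1 : ZMod 2) else 0) * (x + Pi.single (k + 3) 1 : Fin 5 → ZMod 2) l).val *
          codewordSign b (x + Pi.single (k + 3) 1)) := by
  decide +kernel

/-- The dimers `1 → 6`, `3 → 8`, `5 → 10` of `|b̄⟩₅` (nodes numbered `1, …, 10` along the five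
legs); their parity is `(-1) ^ b`. -/
theorem codeword_dimer_odd (b : ZMod 2) (k : Fin 5) (hk : k ∈ ({0, 1, 2} : Finset (Fin 5))) :
    HasDimer (Equiv.refl (Fin 5)) (codeword b) (k, 0) (k + 2, 1) b := by
  rw [HasDimer]
  funext x
  have h := congrArg (Int.cast : ℤ → ℂ) (codewordSign_odd b k hk x)
  simp only [Int.cast_mul, Int.cast_pow, Int.cast_neg, Int.cast_one] at h
  simp only [majorana, Matrix.add_mulVec, Matrix.smul_mulVec, Pi.add_apply,
    Pi.smul_apply, pauli_mulVec, smul_eq_mul, codeword, Pi.zero_apply, if_true, one_ne_zero,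
    if_false]
  have aux : ∀ r s t u v : ℂ, r * s = t * (u * v) →
      1 * (r * (s / 4)) + I * t * (I * (u * (v / 4))) = 0 := by
    intro r s t u v h
    linear_combination (1 / 4) * h + (1 / 4) * t * u * v * I_mul_I
  exact aux _ _ _ _ _ h

/-- The dimers `2 → 7`, `4 → 9` of `|b̄⟩₅`; their parity is positive. -/
theorem codeword_dimer_even (b : ZMod 2) (k : Fin 5) (hk : k ∈ ({0, 1} : Finset (Fin 5))) :
    HasDimer (Equiv.refl (Fin 5)) (codeword b) (k, 1) (k + 3, 0) 0 := by
  rw [HasDimer]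
  funext x
  have h := congrArg (Int.cast : ℤ → ℂ) (codewordSign_even b k hk x)
  simp only [Int.cast_mul, Int.cast_pow, Int.cast_neg, Int.cast_one] at h
  simp only [majorana, Matrix.add_mulVec, Matrix.smul_mulVec, Pi.add_apply,
    Pi.smul_apply, pauli_mulVec, smul_eq_mul, codeword, Pi.zero_apply, if_true, one_ne_zero,
    if_false, ZMod.val_zero, pow_zero]
  linear_combination (I / 4) * h

theorem codeword_norm (b : ZMod 2) : ∑ x, ‖codeword b x‖ ^ 2 = 1 := by
  have h : ∀ b : ZMod 2, ∑ x, codewordSign b x ^ 2 = 16 := by decide +kernel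
  have h' := congrArg (Int.cast : ℤ → ℝ) (h b)
  push_cast at h'
  simp only [codeword, norm_div, Complex.norm_intCast, div_pow, sq_abs, ← Finset.sum_div, h']
  norm_num

end HaPPY

end

open HaPPY

namespace HaPPY

noncomputable section

/-! ### Geometry of the pentagon reflection group -/

/-! The tensor of a tile joins the first node of leg `k` to the second node of leg `k + 2`, so a
dimer of the contracted network enters and leaves each tile through the two edges next to one edge
`i`. It follows the strip of tiles along the geodesic line through `i`. In the reflection group of
the pentagon this strip is a coset of the subgroup generated by the two reflections adjacent to `i`.
Signs of root heights tell which steps lead to the centre. They show that a strip meets the patch in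
one connected piece, and that the line is crossed only from the strip.

A strip carries an operator: Z on every leg of the tiles beyond the line, X and Z factors on the
tiles of the strip, the identity elsewhere. These tile operators agree on bonds, so their product
passes to the boundary (`strip_mulVec_encoding`). There it has X at the two ends of the strip and Z
on the legs behind it. The boundary walk enters these legs at one end and leaves them at the other,
so up to a phase and possibly the total parity the operator is a product of two Majorana operators.
This gives the dimers, with parities affine in the bulk configuration (`exists_hasDimer`).

Recovery is used first for the geometry. If all legs behind a strip at a tile `w` lie in `A`, the
strip operator acts on `A` and sees the qubit of `w`, which therefore is not recoverable from the
complement (`notMem_of_legBehind`). The tiles and legs are thus coloured consistently (`Colouring`).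
Both colour classes of legs are intervals, so each direction of colour change occurs at most once on
the boundary. Two strips of a tile along lines `i` and `i + 2` share at most one leg and so do not
both contain a given change. As the 5-cycle is not bipartite, some strip at every tile is of one
colour. A summation by parts over the network then shows that the dimers leading from `A` to the
complement, and likewise those leading back, are as many as the RT edges (`card_cut`).

Next, an even number of swaps in each half puts every dimer inside a half onto one qubit, and the
dimers between the halves onto pairs of qubits nested around the cut (`exists_frame`). Nesting turns
the Jordan-Wigner string between two linked qubits into a product of ZZ operators of inner links,
whose values are known. So the state has, up to signs, the stabilizers of zeros and Bell pairs, and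
it is that model state up to a Pauli string and a phase (`exists_pauli_mulVec_eq_of_dimers`).

Recovery is used a second time to see that the parities of the inner dimers of `A` depend on `i`
only and determine it: otherwise an operator on the complement could change a qubit of `a`
(`eq_of_lam_left`). Independent parities are chosen as logical qubits. Pauli strings controlled by
them remove the dependence on `i` in one half and on `j` in the other. The remaining phases factor
into a function of `i` and one of `j` (`phase_mul`) and are absorbed in the strings
(`exists_circuits`). The statements for a single half follow by undoing one unitary. -/

/-- The reflection in the edge `i` of the central tile. -/
abbrev gen (i : Fin 5) : Tile := pentagonMatrix.simple i

theorem nbr_eq (w : Tile) (i : Fin 5) : nbr w i = w * gen i := rfl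

@[simp] theorem gen_mul_gen (i : Fin 5) : gen i * gen i = 1 :=
  pentagonMatrix.toCoxeterSystem.simple_mul_simple_self i

@[simp] theorem gen_inv (i : Fin 5) : (gen i)⁻¹ = gen i :=
  pentagonMatrix.toCoxeterSystem.inv_simple i

@[simp] theorem mul_gen_cancel (w : Tile) (i : Fin 5) : w * gen i * gen i = w := by
  rw [mul_assoc, gen_mul_gen, mul_one]

@[simp] theorem gen_mul_cancel (w : Tile) (i : Fin 5) : gen i * (gen i * w) = w := by
  rw [← mul_assoc, gen_mul_gen, one_mul]

@[simp] theorem nbr_nbr (w : Tile) (i : Fin 5) : nbr (nbr w i) i = w := mul_gen_cancel w i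

/-- Labels of neighbouring edges of a tile. -/
abbrev Adj (i j : Fin 5) : Prop := j = i + 1 ∨ i = j + 1

theorem adj_of_side : ∀ {i k : Fin 5}, k = i - 1 ∨ k = i + 1 → Adj k i := by decide

theorem side_of_adj : ∀ {i k : Fin 5}, Adj i k → k = i - 1 ∨ k = i + 1 := by decide

theorem gen_comm {i j : Fin 5} (h : Adj i j) : gen i * gen j = gen j * gen i := by
  have hij : i ≠ j := by rintro rfl; revert h; revert i; decide
  have h2 : pentagonMatrix.M i j = 2 := by
    simp only [pentagonMatrix, Matrix.of_apply, if_neg hij, if_pos h]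
  have := pentagonMatrix.toCoxeterSystem.simple_mul_simple_pow i j
  rw [h2, pow_two] at this
  have h3 : gen i * gen j * (gen i * gen j) = 1 := this
  calc gen i * gen j = (gen i * gen j)⁻¹ := (inv_eq_of_mul_eq_one_right h3).symm
    _ = gen j * gen i := by rw [_root_.mul_inv_rev, gen_inv, gen_inv]

/-- A map on the generators that respects the relations of the pentagon group extends to it. -/
theorem exists_hom {G : Type*} [Monoid G] (f : Fin 5 → G) (h1 : ∀ i, f i * f i = 1)
    (h2 : ∀ i, f i * f (i + 1) * (f i * f (i + 1)) = 1) :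
    ∃ φ : Tile →* G, ∀ i, φ (gen i) = f i := by
  have hf : pentagonMatrix.IsLiftable f := by
    intro i j
    by_cases hij : i = j
    · subst hij
      have : pentagonMatrix.M i i = 1 := pentagonMatrix.diagonal i
      rw [this, pow_one, h1]
    by_cases h : Adj i j
    · have : pentagonMatrix.M i j = 2 := by
        simp only [pentagonMatrix, Matrix.of_apply, if_neg hij, if_pos h]
      rw [this, pow_two]
      rcases h with rfl | rfl
      · exact h2 i
      · calc f (j + 1) * f j * (f (j + 1) * f j)
            = f j * f j * (f (j + 1) * f j * (f (j + 1) * f j)) := by rw [h1, one_mul]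
          _ = f j * (f j * f (j + 1) * (f j * f (j + 1))) * f j := by simp only [mul_assoc]
          _ = 1 := by rw [h2, mul_one, h1]
    · have : pentagonMatrix.M i j = 0 := by
        simp only [pentagonMatrix, Matrix.of_apply, if_neg hij, if_neg h]
      rw [this, pow_zero]
  exact ⟨pentagonMatrix.toCoxeterSystem.lift ⟨f, hf⟩,
    fun i => pentagonMatrix.toCoxeterSystem.lift_apply_simple hf i⟩

/-- Parity of the number of letters `k` in a word for a tile. -/
theorem exists_letterParity (k : Fin 5) :
    ∃ φ : Tile →* Multiplicative (ZMod 2),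
      ∀ i, φ (gen i) = Multiplicative.ofAdd (if i = k then 1 else 0) := by
  apply exists_hom
  · revert k; decide
  · revert k; decide

theorem gen_injective : Function.Injective gen := by
  intro i j h
  obtain ⟨φ, hφ⟩ := exists_letterParity i
  have := congrArg φ h
  rw [hφ, hφ, if_pos rfl] at this
  by_contra hne
  rw [if_neg (Ne.symm hne)] at this
  exact absurd this (by decide)

/-- The action of the generators on heights of roots. -/
def reflHeight (j : Fin 5) (c : Fin 5 → ℤ) (i : Fin 5) : ℤ :=
  if i = j then -c j else if Adj i j then c i else c i + 2 * c j

theorem reflHeight_self (j : Fin 5) (c : Fin 5 → ℤ) : reflHeight j (reflHeight j c) = c := by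
  ext i
  simp only [reflHeight, if_true]
  split_ifs <;> simp_all

/-- The action of the generators on heights of roots, as permutations. -/
def reflHeightPerm (j : Fin 5) : Equiv.Perm (Fin 5 → ℤ) :=
  ⟨reflHeight j, reflHeight j, reflHeight_self j, reflHeight_self j⟩

theorem reflHeight_comm (j : Fin 5) (c : Fin 5 → ℤ) :
    reflHeight j (reflHeight (j + 1) c) = reflHeight (j + 1) (reflHeight j c) := by
  ext i
  fin_cases j <;> fin_cases i <;> simp +decide [reflHeight] <;> try ring

theorem exists_heightAction :
    ∃ φ : Tile →* Equiv.Perm (Fin 5 → ℤ), ∀ i, φ (gen i) = reflHeightPerm i := by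
  apply exists_hom
  · intro i; ext1 c; exact reflHeight_self i c
  · intro i; ext1 c
    change reflHeight i (reflHeight (i + 1) (reflHeight i (reflHeight (i + 1) c))) = c
    rw [reflHeight_comm, reflHeight_self, reflHeight_self]

/-- The heights of the simple roots as seen from a tile: `height w i` is negative iff the edge `i`
of `w` leads towards the centre. -/
def height (w : Tile) : Fin 5 → ℤ := exists_heightAction.choose w⁻¹ 1

theorem height_one : height 1 = 1 := by
  simp [height]

theorem height_mul_gen (w : Tile) (j : Fin 5) : height (w * gen j) = reflHeight j (height w) := by
  rw [height, _root_.mul_inv_rev, gen_inv, map_mul, exists_heightAction.choose_spec j]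
  rfl

theorem height_mul_gen_self (w : Tile) (j : Fin 5) : height (w * gen j) j = -height w j := by
  simp [height_mul_gen, reflHeight]

theorem height_mul_gen_adj (w : Tile) {i j : Fin 5} (h : Adj i j) :
    height (w * gen j) i = height w i := by
  have : i ≠ j := by rintro rfl; revert h; revert i; decide
  rw [height_mul_gen, reflHeight, if_neg this, if_pos h]

theorem height_mul_gen_of_not_adj (w : Tile) {i j : Fin 5} (h : ¬ Adj i j) (hij : i ≠ j) :
    height (w * gen j) i = height w i + 2 * height w j := by
  rw [height_mul_gen, reflHeight, if_neg hij, if_neg h]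

/-- Tiles reached by a path of given length that always leads away from the centre. -/
inductive UpPath : ℕ → Tile → Prop
  | one : UpPath 0 1
  | step {n : ℕ} {w : Tile} (j : Fin 5) : UpPath n w → 0 < height w j → UpPath (n + 1) (w * gen j)

/-- The inequalities satisfied by the heights at every tile. -/
def HeightOK (c : Fin 5 → ℤ) : Prop :=
  (∀ i, c i ≠ 0) ∧ ∀ i j, i ≠ j → ¬ Adj i j → 0 < c i + c j

/-- Reflecting in a positive height only raises the heights of the non-adjacent edges, by twice the
height that is negated. That negated height is thereby compensated: `-c j + (c k + 2 * c j) = c k +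
c j`. -/
theorem HeightOK.refl {c : Fin 5 → ℤ} (h : HeightOK c) {j : Fin 5} (hj : 0 < c j) :
    HeightOK (reflHeight j c) := by
  obtain ⟨h0, h1⟩ := h
  refine ⟨fun i => ?_, fun i k hik hadj => ?_⟩
  · unfold reflHeight
    split_ifs with h2 h3
    · have := h0 j; omega
    · exact h0 i
    · have := h1 i j h2 h3; omega
  · have key := h1 i k hik hadj
    unfold reflHeight
    split_ifs with h2 h3 h4 h5 h6 h7 h8
    · exact absurd (h2.trans h3.symm) hik
    · exact absurd (by subst h2; rcases h4 with h | h; exacts [.inr h, .inl h]) hadj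
    · subst h2; omega
    · subst h6; exact absurd h5 hadj
    · exact key
    · omega
    · subst h8; have := h1 i k h2 h5; omega
    · omega
    · omega

theorem UpPath.heightOK {n : ℕ} {w : Tile} (h : UpPath n w) : HeightOK (height w) := by
  induction h with
  | one => rw [height_one, HeightOK]; exact ⟨fun i => one_ne_zero, fun i j _ _ => by norm_num⟩
  | step j _ hj ih => rw [height_mul_gen]; exact ih.refl hj

/-- If the last step crossed another edge `k`, then both `j` and `k` have negative height now. They
are adjacent, since non-adjacent heights have positive sum. The reflections commute, and the step
down can be taken before the last step. -/
theorem UpPath.down {n : ℕ} {w : Tile} (h : UpPath n w) (j : Fin 5) (hj : height w j < 0) :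
    ∃ m, n = m + 1 ∧ UpPath m (w * gen j) := by
  induction h generalizing j with
  | one => rw [height_one] at hj; exact absurd hj (by norm_num)
  | @step n w k hw hk ih =>
    by_cases hjk : j = k
    · subst hjk; exact ⟨n, rfl, by rwa [mul_gen_cancel]⟩
    have hok := (UpPath.step k hw hk).heightOK
    have hadj : Adj j k := by
      by_contra hna
      have := hok.2 j k hjk hna
      rw [height_mul_gen_self] at this
      omega
    rw [height_mul_gen_adj w hadj] at hj
    obtain ⟨m, rfl, hm⟩ := ih j hj
    refine ⟨m + 1, rfl, ?_⟩
    rw [mul_assoc, gen_comm hadj.symm, ← mul_assoc]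
    refine .step k hm ?_
    rwa [height_mul_gen_adj w hadj.symm]

theorem exists_upPath (w : Tile) : ∃ n, UpPath n w := by
  refine pentagonMatrix.toCoxeterSystem.simple_induction_right
    (p := fun w => ∃ n, UpPath n w) w ⟨0, .one⟩ ?_
  rintro w i ⟨n, hn⟩
  rcases lt_or_gt_of_ne (hn.heightOK.1 i) with h | h
  · obtain ⟨m, -, hm⟩ := hn.down i h; exact ⟨m, hm⟩
  · exact ⟨n + 1, .step i hn h⟩

theorem heightOK (w : Tile) : HeightOK (height w) := (exists_upPath w).choose_spec.heightOK

theorem height_ne_zero (w : Tile) (i : Fin 5) : height w i ≠ 0 := (heightOK w).1 i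

theorem UpPath.depth_le {n : ℕ} {w : Tile} (h : UpPath n w) : depth w ≤ n := by
  induction h with
  | one => exact (pentagonMatrix.toCoxeterSystem.length_one).le
  | @step n w j _ _ ih =>
    refine (pentagonMatrix.toCoxeterSystem.length_mul_le _ _).trans ?_
    have : pentagonMatrix.toCoxeterSystem.length (gen j) = 1 :=
      pentagonMatrix.toCoxeterSystem.length_simple j
    unfold depth at ih
    omega

/-- Each letter of a reduced word lengthens or shortens an ascending path by one, so the path is no
longer than the word. `UpPath.depth_le` is the other inequality. -/
theorem upPath_depth (w : Tile) : UpPath (depth w) w := by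
  obtain ⟨l, hl, hw⟩ := pentagonMatrix.toCoxeterSystem.exists_isReduced w
  have key : ∀ l : List (Fin 5), ∃ n ≤ l.length,
      UpPath n (pentagonMatrix.toCoxeterSystem.wordProd l) := by
    intro l
    induction l using List.reverseRecOn with
    | nil => exact ⟨0, le_rfl, by simpa using UpPath.one⟩
    | append_singleton l k ih =>
      obtain ⟨n, hn, hp⟩ := ih
      rw [CoxeterSystem.wordProd_append, CoxeterSystem.wordProd_singleton, List.length_append,
        List.length_singleton]
      rcases lt_or_gt_of_ne (hp.heightOK.1 k) with h | h
      · obtain ⟨m, rfl, hm⟩ := hp.down k h; exact ⟨m, by omega, hm⟩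
      · exact ⟨n + 1, by omega, .step k hp h⟩
  obtain ⟨n, hn, hp⟩ := key l
  rw [← hw] at hp
  have h1 := hp.depth_le
  have h2 : depth w = l.length := by rw [depth, hw]; exact hl
  have : n = depth w := by omega
  rwa [← this]

/-- A negative height lets an ascending path of minimal length be shortened by `UpPath.down`. The
converse is the same statement at the neighbour, where the height has the opposite sign. -/
theorem depth_nbr_lt_iff (w : Tile) (i : Fin 5) : depth (nbr w i) < depth w ↔ height w i < 0 := by
  have key : ∀ v : Tile, height v i < 0 → depth (v * gen i) < depth v := by
    intro v hv
    obtain ⟨m, hm, hp⟩ := (upPath_depth v).down i hv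
    have := hp.depth_le
    omega
  refine ⟨fun h => ?_, key w⟩
  by_contra hn
  have hpos : 0 < height w i := lt_of_le_of_ne (not_lt.1 hn) (height_ne_zero w i).symm
  have := key (w * gen i) (by rw [height_mul_gen_self]; omega)
  rw [mul_gen_cancel] at this
  exact absurd h this.not_gt

theorem depth_nbr (w : Tile) (i : Fin 5) :
    depth (nbr w i) = depth w + 1 ∨ depth (nbr w i) + 1 = depth w :=
  pentagonMatrix.toCoxeterSystem.length_mul_simple w i

theorem depth_nbr_of_neg {w : Tile} {i : Fin 5} (h : height w i < 0) :
    depth (nbr w i) + 1 = depth w := by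
  have h1 := (depth_nbr_lt_iff w i).2 h
  rcases depth_nbr w i with h2 | h2 <;> omega

theorem depth_nbr_of_pos {w : Tile} {i : Fin 5} (h : 0 < height w i) :
    depth (nbr w i) = depth w + 1 := by
  have h1 : ¬ depth (nbr w i) < depth w := fun h' => by
    have := (depth_nbr_lt_iff w i).1 h'; omega
  rcases depth_nbr w i with h2 | h2 <;> omega

theorem even_depth_nbr (w : Tile) (i : Fin 5) : Even (depth (nbr w i)) ↔ ¬ Even (depth w) := by
  rcases depth_nbr w i with h | h
  · rw [h, Nat.even_add_one]
  · rw [← h, Nat.even_add_one, not_not]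

/-- Consequently at most two edges of a tile lead towards the centre, and they share a vertex. -/
theorem adj_of_height_neg {w : Tile} {i j : Fin 5} (hij : i ≠ j) (hi : height w i < 0)
    (hj : height w j < 0) : Adj i j := by
  by_contra h
  have := (heightOK w).2 i j hij h
  omega

/-! ### Walls and strips -/

/-- The strip of tiles along the line of edge `i` of a tile `w` consists of the tiles `w * d` with
`d` in this group. -/
def stripGroup (i : Fin 5) : Subgroup Tile := Subgroup.closure {gen (i - 1), gen (i + 1)}

theorem gen_mem_stripGroup {i k : Fin 5} (h : k = i - 1 ∨ k = i + 1) : gen k ∈ stripGroup i :=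
  Subgroup.subset_closure (by rcases h with rfl | rfl <;> simp)

theorem stripGroup_induction {i : Fin 5} {p : Tile → Prop} (one : p 1)
    (mul : ∀ d ∈ stripGroup i, ∀ k, k = i - 1 ∨ k = i + 1 → p d → p (d * gen k))
    {d : Tile} (hd : d ∈ stripGroup i) : p d := by
  induction hd using Subgroup.closure_induction_right with
  | one => exact one
  | mul_right x hx y hy ih =>
    rcases hy with rfl | rfl
    · exact mul x hx _ (.inl rfl) ih
    · exact mul x hx _ (.inr rfl) ih
  | mul_inv_cancel x hx y hy ih =>
    rcases hy with rfl | rfl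
    · rw [gen_inv]; exact mul x hx _ (.inl rfl) ih
    · rw [gen_inv]; exact mul x hx _ (.inr rfl) ih

theorem stripGroup_comm {i : Fin 5} {d : Tile} (hd : d ∈ stripGroup i) :
    d * gen i = gen i * d := by
  refine stripGroup_induction (p := fun d => d * gen i = gen i * d) (by simp) ?_ hd
  intro d _ k hk ih
  have : Adj k i := adj_of_side hk
  rw [mul_assoc, gen_comm this, ← mul_assoc, ih, mul_assoc]

/-- Letter parities vanish on strip groups. -/
theorem gen_notMem_stripGroup {i k : Fin 5} (h1 : k ≠ i - 1) (h2 : k ≠ i + 1) :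
    gen k ∉ stripGroup i := by
  obtain ⟨φ, hφ⟩ := exists_letterParity k
  intro h
  have : ∀ d ∈ stripGroup i, φ d = 1 := fun d hd =>
    stripGroup_induction (p := fun d => φ d = 1) (map_one φ) (by
      intro d _ l hl ih
      rw [map_mul, ih, hφ, if_neg (by rcases hl with rfl | rfl <;> exact Ne.symm ‹_›)]
      rfl) hd
  have := this _ h
  rw [hφ, if_pos rfl] at this
  exact absurd this (by decide)

/-- Killing all generators except `gen (i - 1)` and `gen (i + 1)` respects the relations, because
these two labels are not adjacent. The resulting retraction fixes the first strip group, and it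
sends the second to the group of order two generated by the shared letter. -/
theorem eq_of_mem_stripGroup_inter {i : Fin 5} {d : Tile} (h1 : d ∈ stripGroup i)
    (h2 : d ∈ stripGroup (i + 2)) : d = 1 ∨ d = gen (i + 1) := by
  obtain ⟨ρ, hρ⟩ := exists_hom (G := Tile)
    (fun l => if l = i - 1 ∨ l = i + 1 then gen l else 1)
    (by intro l; split_ifs <;> simp)
    (by
      intro l
      have : ∀ i l : Fin 5, ¬((l = i - 1 ∨ l = i + 1) ∧ (l + 1 = i - 1 ∨ l + 1 = i + 1)) := by
        decide
      specialize this i l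
      by_cases ha : (l = i - 1 ∨ l = i + 1)
      · have hb : ¬(l + 1 = i - 1 ∨ l + 1 = i + 1) := fun hb => this ⟨ha, hb⟩
        simp only [if_pos ha, if_neg hb, mul_one, gen_mul_gen]
      · simp only [if_neg ha, one_mul]
        split_ifs <;> simp)
  have e1 : ρ d = d := stripGroup_induction (p := fun d => ρ d = d) (map_one ρ)
    (by intro d _ k hk ih; rw [map_mul, ih, hρ, if_pos hk]) h1
  have e2 : ρ d = 1 ∨ ρ d = gen (i + 1) :=
    stripGroup_induction (p := fun d => ρ d = 1 ∨ ρ d = gen (i + 1)) (.inl (map_one ρ))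
    (by
      intro d _ k hk ih
      rw [map_mul, hρ]
      have hk' : ∀ i k : Fin 5, k = i + 2 - 1 ∨ k = i + 2 + 1 →
          k = i + 1 ∨ ¬ (k = i - 1 ∨ k = i + 1) := by decide
      specialize hk' i k hk
      rcases hk' with rfl | hk'
      · rw [if_pos (.inr rfl)]
        rcases ih with h | h <;> simp [h]
      · rw [if_neg hk', mul_one]; exact ih) h2
  rwa [e1] at e2

/-- The tile `y` lies beyond the line of the edge `i` of `w`. -/
def Behind (w : Tile) (i : Fin 5) (y : Tile) : Prop := height (y⁻¹ * w) i < 0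

/-- The tile `y` lies in the strip along the line of the edge `i` of `w`, on the side of `w`. -/
def InStrip (w : Tile) (i : Fin 5) (y : Tile) : Prop := w⁻¹ * y ∈ stripGroup i

theorem depth_gen_mul (j : Fin 5) (w : Tile) :
    depth (gen j * w) = depth w + 1 ∨ depth (gen j * w) + 1 = depth w :=
  pentagonMatrix.toCoxeterSystem.length_simple_mul w j

theorem depth_one : depth 1 = 0 := pentagonMatrix.toCoxeterSystem.length_one

/-- A form of the exchange condition. A last letter `k` of `u` is also a descent of `gen j * u`, as
is `i`, so `k` is adjacent to `i`. Removing it does not change the height of `i`. In the end only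
the identity is left, and all removed letters lie in the strip group. -/
theorem mem_stripGroup_of_cross (i j : Fin 5) : ∀ (n : ℕ) (u : Tile), depth u = n →
    0 < height u i → depth (gen j * u) = n + 1 → height (gen j * u) i < 0 →
    j = i ∧ u ∈ stripGroup i := by
  intro n
  induction n with
  | zero =>
    intro u hu h1 h2 h3
    have hu1 : u = 1 := pentagonMatrix.toCoxeterSystem.length_eq_zero_iff.1 hu
    subst hu1
    refine ⟨?_, one_mem _⟩
    have h4 := depth_nbr_of_neg h3
    have h5 : depth (gen j * 1 * gen i) = 0 := by rw [← nbr_eq]; omega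
    have h6 : gen j * 1 * gen i = 1 := pentagonMatrix.toCoxeterSystem.length_eq_zero_iff.1 h5
    rw [mul_one] at h6
    exact gen_injective (by rw [eq_inv_of_mul_eq_one_left h6, gen_inv])
  | succ n ih =>
    intro u hu h1 h2 h3
    have hu1 : u ≠ 1 := by rintro rfl; rw [depth_one] at hu; omega
    obtain ⟨k, hk⟩ := pentagonMatrix.toCoxeterSystem.exists_rightDescent_of_ne_one hu1
    have hk' : height u k < 0 := (depth_nbr_lt_iff u k).1 hk
    have hd := depth_nbr_of_neg hk'
    rw [nbr_eq] at hd
    have hki : k ≠ i := by rintro rfl; omega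
    have hzk : height (gen j * u) k < 0 := by
      rw [← depth_nbr_lt_iff, nbr_eq, mul_assoc]
      rcases depth_gen_mul j (u * gen k) with h | h <;> omega
    have hadj : Adj i k := adj_of_height_neg hki.symm h3 hzk
    have h4 := depth_nbr_of_neg hzk
    rw [nbr_eq, mul_assoc] at h4
    obtain ⟨rfl, h5⟩ := ih (u * gen k) (by omega) (by rwa [height_mul_gen_adj u hadj])
      (by omega) (by rwa [← mul_assoc, height_mul_gen_adj _ hadj])
    refine ⟨rfl, ?_⟩
    have h6 := side_of_adj hadj
    have := mul_mem h5 (gen_mem_stripGroup h6)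
    rwa [mul_gen_cancel] at this

/-- Crossing the edge `j` of `y` multiplies `y⁻¹ * w` by `gen j` on the left. If this changes the
sign of the root of `i`, then `mem_stripGroup_of_cross` applies to the tile on the near side. -/
theorem Behind.cross {w y : Tile} {i j : Fin 5} (h1 : Behind w i y) (h2 : ¬ Behind w i (nbr y j)) :
    j = i ∧ InStrip w i (nbr y i) := by
  unfold Behind at h1 h2
  have e : (nbr y j)⁻¹ * w = gen j * (y⁻¹ * w) := by
    rw [nbr_eq, _root_.mul_inv_rev, gen_inv, mul_assoc]
  rw [e] at h2
  set z := y⁻¹ * w with hz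
  have hpos : 0 < height (gen j * z) i := lt_of_le_of_ne (not_lt.1 h2) (height_ne_zero _ i).symm
  have h3 := depth_nbr_of_neg h1
  have h4 := depth_nbr_of_pos hpos
  rw [nbr_eq] at h3 h4
  rw [mul_assoc] at h4
  have h5 := depth_gen_mul j z
  have h6 := depth_gen_mul j (z * gen i)
  have e2 : gen j * (gen j * z) = z := gen_mul_cancel z j
  obtain ⟨rfl, h7⟩ := mem_stripGroup_of_cross i j _ (gen j * z) rfl hpos
    (by rw [e2]; omega) (by rwa [e2])
  refine ⟨rfl, ?_⟩
  rw [← e] at h7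
  have := inv_mem h7
  rwa [_root_.mul_inv_rev, inv_inv] at this

theorem InStrip.refl (w : Tile) (i : Fin 5) : InStrip w i w := by
  rw [InStrip, inv_mul_cancel]; exact one_mem _

theorem InStrip.symm {w y : Tile} {i : Fin 5} (h : InStrip w i y) : InStrip y i w := by
  have := inv_mem h
  rwa [_root_.mul_inv_rev, inv_inv] at this

theorem InStrip.trans {w y z : Tile} {i : Fin 5} (h : InStrip w i y) (h' : InStrip y i z) :
    InStrip w i z := by
  have := mul_mem h h'
  rwa [mul_assoc, mul_inv_cancel_left] at this

theorem height_of_mem_stripGroup {i : Fin 5} {d : Tile} (hd : d ∈ stripGroup i) :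
    height d i = 1 := by
  refine stripGroup_induction (p := fun d => height d i = 1) (by rw [height_one]; rfl) ?_ hd
  intro d _ k hk ih
  have : Adj i k := (adj_of_side hk).symm
  rw [height_mul_gen_adj d this, ih]

theorem InStrip.not_behind {w y : Tile} {i : Fin 5} (h : InStrip w i y) : ¬ Behind w i y := by
  rw [Behind, height_of_mem_stripGroup h.symm]
  norm_num

theorem InStrip.nbr_side {w y : Tile} {i k : Fin 5} (h : InStrip w i y)
    (hk : k = i - 1 ∨ k = i + 1) : InStrip w i (nbr y k) := by
  have := mul_mem h (gen_mem_stripGroup hk)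
  rwa [mul_assoc] at this

theorem InStrip.nbr_behind {w y : Tile} {i : Fin 5} (h : InStrip w i y) :
    Behind w i (nbr y i) := by
  have h' := h.symm
  unfold InStrip at h'
  rw [Behind, nbr_eq, _root_.mul_inv_rev, gen_inv, mul_assoc, ← stripGroup_comm h',
    height_mul_gen_self, height_of_mem_stripGroup h']
  norm_num

theorem InStrip.nbr_not_behind {w y : Tile} {i k : Fin 5} (h : InStrip w i y) (hk : k ≠ i) :
    ¬ Behind w i (nbr y k) := fun h' =>
  hk (h'.cross (by rw [nbr_nbr]; exact h.not_behind)).1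

theorem InStrip.nbr_not_inStrip {w y : Tile} {i k : Fin 5} (h : InStrip w i y)
    (h1 : k ≠ i - 1) (h2 : k ≠ i + 1) : ¬ InStrip w i (nbr y k) := fun h' => by
  have := h.symm.trans h'
  rw [InStrip, nbr_eq, inv_mul_cancel_left] at this
  exact gen_notMem_stripGroup h1 h2 this

/-- Going on from a strip along the labels of the strip, one does not cross a line with another
label. -/
theorem not_behind_of_inStrip {w y : Tile} {i l : Fin 5} (h : InStrip w i y)
    (h1 : l ≠ i - 1) (h2 : l ≠ i + 1) : ¬ Behind w l y := by
  have key : ∀ d ∈ stripGroup i, ¬ Behind w l (w * d) := fun d hd =>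
    stripGroup_induction (p := fun d => ¬ Behind w l (w * d))
      (by rw [mul_one]; exact (InStrip.refl w l).not_behind)
      (by
        intro d _ k hk ih hb
        rw [← mul_assoc, ← nbr_eq] at hb
        have := (hb.cross (j := k) (by rwa [nbr_nbr])).1
        subst this
        rcases hk with rfl | rfl <;> contradiction) hd
  have := key _ h
  rwa [mul_inv_cancel_left] at this

/-- Alternating products that end with `k`. -/
def altProd (k k' : Fin 5) : ℕ → Tile
  | 0 => 1
  | n + 1 => altProd k' k n * gen k
termination_by n => n

theorem altProd_zero (k k' : Fin 5) : altProd k k' 0 = 1 := by rw [altProd]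

theorem altProd_succ (k k' : Fin 5) (n : ℕ) :
    altProd k k' (n + 1) = altProd k' k n * gen k := by rw [altProd]

theorem exists_altProd {i : Fin 5} {d : Tile} (hd : d ∈ stripGroup i) :
    ∃ n, d = altProd (i + 1) (i - 1) n ∨ d = altProd (i - 1) (i + 1) n := by
  refine stripGroup_induction (p := fun d => ∃ n, d = altProd (i + 1) (i - 1) n ∨
    d = altProd (i - 1) (i + 1) n) ⟨0, .inl (altProd_zero _ _).symm⟩ ?_ hd
  intro d _ k hk ih
  obtain ⟨n, rfl | rfl⟩ := ih <;> rcases hk with rfl | rfl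
  · exact ⟨n + 1, .inr (altProd_succ _ _ _).symm⟩
  · rcases n with _ | n
    · exact ⟨1, .inl (by rw [altProd_succ, altProd_zero, altProd_zero])⟩
    · exact ⟨n, .inr (by rw [altProd_succ, mul_gen_cancel])⟩
  · rcases n with _ | n
    · exact ⟨1, .inr (by rw [altProd_succ, altProd_zero, altProd_zero])⟩
    · exact ⟨n, .inl (by rw [altProd_succ, mul_gen_cancel])⟩
  · exact ⟨n + 1, .inl (altProd_succ _ _ _).symm⟩

/-- An alternating walk that starts upwards keeps climbing: the edge back has negative height, so
the other, non-adjacent edge of the strip has positive height. Hence a strip has only one tile from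
which both of its directions lead up. -/
theorem height_mul_altProd {m : Tile} {k k' : Fin 5} (hk : k ≠ k') (hadj : ¬ Adj k k')
    (h : 0 < height m k) (h' : 0 < height m k') (n : ℕ) :
    height (m * altProd k k' (n + 1)) k < 0 ∧ 0 < height (m * altProd k k' (n + 1)) k' := by
  have hadj' : ¬ Adj k' k := fun h => hadj h.symm
  induction n generalizing k k' with
  | zero =>
    rw [altProd_succ, altProd_zero, one_mul, height_mul_gen_self,
      height_mul_gen_of_not_adj m hadj' hk.symm]
    constructor <;> omega
  | succ n ih =>
    obtain ⟨h1, h2⟩ := ih hk.symm hadj' h' h hadj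
    rw [altProd_succ, ← mul_assoc, height_mul_gen_self,
      height_mul_gen_of_not_adj _ hadj' hk.symm]
    have := (heightOK (m * altProd k' k (n + 1))).2 k k' hk hadj
    constructor <;> omega

end

end HaPPY

namespace HaPPY

noncomputable section

/-! ### Dimers as strips through the patch -/

theorem mem_openLegs {Λ : Finset Tile} {p : Tile × Fin 5} :
    p ∈ openLegs Λ ↔ p.1 ∈ Λ ∧ nbr p.1 p.2 ∉ Λ := by
  simp [openLegs]

theorem mem_bondLegs {Λ : Finset Tile} {p : Tile × Fin 5} :
    p ∈ bondLegs Λ ↔ p.1 ∈ Λ ∧ nbr p.1 p.2 ∈ Λ := by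
  simp [bondLegs]

theorem IsPatch.mem_of_height_neg {Λ : Finset Tile} (hΛ : IsPatch Λ) {w : Tile} (hw : w ∈ Λ)
    {i : Fin 5} (h : height w i < 0) : nbr w i ∈ Λ :=
  hΛ.2 w hw i ((depth_nbr_lt_iff w i).2 h)

/-- `k` and `k'` are the two labels next to `i`. -/
def Opp (i k k' : Fin 5) : Prop := (k = i - 1 ∧ k' = i + 1) ∨ (k = i + 1 ∧ k' = i - 1)

instance (i k k' : Fin 5) : Decidable (Opp i k k') := inferInstanceAs (Decidable (_ ∨ _))

theorem Opp.symm {i k k' : Fin 5} (h : Opp i k k') : Opp i k' k := by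
  revert h; revert i k k'; decide

theorem Opp.side {i k k' : Fin 5} (h : Opp i k k') : k = i - 1 ∨ k = i + 1 := by
  rcases h with h | h
  exacts [.inl h.1, .inr h.1]

theorem Opp.not_adj : ∀ {i k k' : Fin 5}, Opp i k k' → ¬ Adj k k' := by decide

theorem Opp.ne : ∀ {i k k' : Fin 5}, Opp i k k' → k ≠ k' := by decide

/-- Leaving the tile `w` of the patch through the edge `k`, then through `k'`, `k`, … in turn, one
leaves the patch through the given leg. -/
inductive Ray (Λ : Finset Tile) : Tile → Fin 5 → Fin 5 → Tile × Fin 5 → Prop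
  | finish {w : Tile} {k k' : Fin 5} : w ∈ Λ → nbr w k ∉ Λ → Ray Λ w k k' (w, k)
  | step {w : Tile} {k k' : Fin 5} {p : Tile × Fin 5} :
      w ∈ Λ → nbr w k ∈ Λ → Ray Λ (nbr w k) k' k p → Ray Λ w k k' p

theorem Ray.unique {Λ : Finset Tile} {w : Tile} {k k' : Fin 5} {p q : Tile × Fin 5}
    (hp : Ray Λ w k k' p) (hq : Ray Λ w k k' q) : p = q := by
  induction hp with
  | finish _ h =>
    cases hq with
    | finish _ _ => rfl
    | step _ h' _ => exact absurd h' h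
  | step _ h _ ih =>
    cases hq with
    | finish _ h' => exact absurd h h'
    | step _ _ h' => exact ih h'

theorem Ray.mem_openLegs {Λ : Finset Tile} {w : Tile} {k k' : Fin 5} {p : Tile × Fin 5}
    (h : Ray Λ w k k' p) : p ∈ openLegs Λ := by
  induction h with
  | finish h1 h2 => exact HaPPY.mem_openLegs.2 ⟨h1, h2⟩
  | step _ _ _ ih => exact ih

theorem Ray.altProd {Λ : Finset Tile} {w : Tile} {k k' : Fin 5} {p : Tile × Fin 5}
    (h : Ray Λ w k k' p) : p = (w, k) ∨ ∃ n, p.1⁻¹ * w = altProd k k' (n + 1) := by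
  induction h with
  | finish _ _ => exact .inl rfl
  | @step w k k' p _ _ _ ih =>
    right
    rcases ih with rfl | ⟨n, hn⟩
    · refine ⟨0, ?_⟩
      rw [altProd_succ, altProd_zero, one_mul, nbr_eq, _root_.mul_inv_rev, gen_inv, mul_assoc,
        inv_mul_cancel, mul_one]
    · refine ⟨n + 1, ?_⟩
      rw [altProd_succ, ← hn, nbr_eq, mul_assoc, mul_gen_cancel]

/-- A ray that climbs once climbs for ever, so it leaves the patch before exceeding the largest
depth. `n` bounds the remaining climb. -/
theorem exists_ray_of_pos {Λ : Finset Tile} {i : Fin 5} : ∀ (n : ℕ) {w : Tile} {k k' : Fin 5},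
    Opp i k k' → w ∈ Λ → 0 < height w k → Λ.sup depth ≤ depth w + n → ∃ p, Ray Λ w k k' p := by
  intro n
  induction n with
  | zero =>
    intro w k k' ho hw hk hn
    refine ⟨_, .finish hw fun h => ?_⟩
    have := Finset.le_sup (f := depth) h
    have := depth_nbr_of_pos hk
    omega
  | succ n ih =>
    intro w k k' ho hw hk hn
    by_cases h : nbr w k ∈ Λ
    · have h1 := (heightOK (nbr w k)).2 k k' ho.ne ho.not_adj
      rw [nbr_eq, height_mul_gen_self, ← nbr_eq] at h1
      have h2 := depth_nbr_of_pos hk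
      obtain ⟨p, hp⟩ := ih ho.symm h (by omega) (by omega)
      exact ⟨p, .step hw h hp⟩
    · exact ⟨_, .finish hw h⟩

/-- Steps towards the centre stay in the patch and are finitely many; afterwards `exists_ray_of_pos`
takes over. -/
theorem exists_ray {Λ : Finset Tile} (hΛ : IsPatch Λ) {i : Fin 5} :
    ∀ (n : ℕ) {w : Tile} {k k' : Fin 5}, Opp i k k' → w ∈ Λ → depth w = n →
    ∃ p, Ray Λ w k k' p := by
  intro n
  induction n using Nat.strong_induction_on with
  | _ n ih =>
    intro w k k' ho hw hn
    rcases lt_or_gt_of_ne (height_ne_zero w k) with h | h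
    · have h1 := hΛ.mem_of_height_neg hw h
      have h2 := depth_nbr_of_neg h
      obtain ⟨p, hp⟩ := ih (depth (nbr w k)) (by omega) ho.symm h1 rfl
      exact ⟨p, .step hw h1 hp⟩
    · exact exists_ray_of_pos (Λ.sup depth) ho hw h (by omega)

open Classical in
/-- The open leg at the end of a ray. -/
def rayEnd (Λ : Finset Tile) (w : Tile) (k k' : Fin 5) : Tile × Fin 5 :=
  -- The default is never met at a tile of a patch with the two labels next to an edge, where a ray
  -- exists.
  if h : ∃ p, Ray Λ w k k' p then h.choose else (w, k)

section Patch

variable {Λ : Finset Tile} (hΛ : IsPatch Λ)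

include hΛ

theorem ray_rayEnd {w : Tile} (hw : w ∈ Λ) {i k k' : Fin 5} (ho : Opp i k k') :
    Ray Λ w k k' (rayEnd Λ w k k') := by
  have h := exists_ray hΛ _ ho hw rfl
  rw [rayEnd, dif_pos h]
  exact h.choose_spec

theorem rayEnd_stop {w : Tile} (hw : w ∈ Λ) {i k k' : Fin 5} (ho : Opp i k k')
    (h : nbr w k ∉ Λ) : rayEnd Λ w k k' = (w, k) :=
  (ray_rayEnd hΛ hw ho).unique (.finish hw h)

theorem rayEnd_step {w : Tile} (hw : w ∈ Λ) {i k k' : Fin 5} (ho : Opp i k k')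
    (h : nbr w k ∈ Λ) : rayEnd Λ (nbr w k) k' k = rayEnd Λ w k k' :=
  ((ray_rayEnd hΛ hw ho).unique (.step hw h (ray_rayEnd hΛ h ho.symm))).symm

/-- A function on the tiles that does not change along the strip is constant on its intersection
with the patch. -/
theorem eq_of_inStrip {α : Type*} {i : Fin 5} (F : Tile → α)
    (hF : ∀ y ∈ Λ, ∀ k, k = i - 1 ∨ k = i + 1 → nbr y k ∈ Λ → F (nbr y k) = F y)
    {w y : Tile} (hw : w ∈ Λ) (hy : y ∈ Λ) (h : InStrip w i y) : F y = F w := by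
  -- Slide down inside the strip, and hence inside the patch, to a tile from which both directions
  -- of the strip lead up.
  have low : ∀ (n : ℕ) (y : Tile), depth y = n → y ∈ Λ → ∃ m, InStrip y i m ∧ F m = F y ∧
      ∀ k, k = i - 1 ∨ k = i + 1 → 0 < height m k := by
    intro n
    induction n using Nat.strong_induction_on with
    | _ n ih =>
      intro y hn hy
      by_cases hd : ∀ k, k = i - 1 ∨ k = i + 1 → 0 < height y k
      · exact ⟨y, .refl y i, rfl, hd⟩
      · push Not at hd
        obtain ⟨k, hk, hneg⟩ := hd
        have hneg : height y k < 0 := lt_of_le_of_ne hneg (height_ne_zero y k)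
        have h1 := hΛ.mem_of_height_neg hy hneg
        have h2 := depth_nbr_of_neg hneg
        obtain ⟨m, hm1, hm2, hm3⟩ := ih _ (by omega) (nbr y k) rfl h1
        exact ⟨m, ((InStrip.refl y i).nbr_side hk).trans hm1, hm2.trans (hF y hy k hk h1), hm3⟩
  obtain ⟨m, hm1, hm2, hm3⟩ := low _ y rfl hy
  obtain ⟨m', hm1', hm2', hm3'⟩ := low _ w rfl hw
  have hs : InStrip m i m' := hm1.symm.trans (h.symm.trans hm1')
  have ho : Opp i (i + 1) (i - 1) := .inr ⟨rfl, rfl⟩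
  obtain ⟨n, hn⟩ := exists_altProd hs
  -- Two different lowest tiles would be joined by a non-empty alternating product, at whose end one
  -- direction leads down.
  have : m' = m := by
    rcases n with _ | n
    · rw [altProd_zero, altProd_zero, or_self, inv_mul_eq_one] at hn
      exact hn.symm
    · exfalso
      rcases hn with hn | hn
      · have h1 := (height_mul_altProd ho.ne ho.not_adj (hm3 _ (.inr rfl)) (hm3 _ (.inl rfl)) n).1
        rw [← hn, mul_inv_cancel_left] at h1
        exact absurd (hm3' _ (.inr rfl)) h1.not_gt
      · have h1 := (height_mul_altProd ho.symm.ne ho.symm.not_adj (hm3 _ (.inl rfl))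
          (hm3 _ (.inr rfl)) n).1
        rw [← hn, mul_inv_cancel_left] at h1
        exact absurd (hm3' _ (.inl rfl)) h1.not_gt
  rw [← hm2, ← hm2', this]

omit hΛ

/-- The step from the label of an edge to that of the next edge counterclockwise. -/
def turn (w : Tile) : Fin 5 := if Even (depth w) then 1 else -1

theorem turn_eq (w : Tile) : turn w = 1 ∨ turn w = -1 := by
  unfold turn; split_ifs <;> simp

theorem turn_nbr (w : Tile) (k : Fin 5) : turn (nbr w k) = -turn w := by
  unfold turn
  by_cases h : Even (depth w)
  · rw [if_pos h, if_neg (fun h' => (even_depth_nbr w k).1 h' h)]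
  · rw [if_neg h, if_pos ((even_depth_nbr w k).2 h)]; decide

theorem opp_turn (w : Tile) (i : Fin 5) : Opp i (i + turn w) (i - turn w) := by
  rcases turn_eq w with h | h <;> rw [h] <;> revert i <;> decide

/-- The open leg at the clockwise end of the strip, seen from the line of the strip. -/
def stripStart (Λ : Finset Tile) (w : Tile) (i : Fin 5) : Tile × Fin 5 :=
  rayEnd Λ w (i - turn w) (i + turn w)

/-- The open leg at the counterclockwise end of the strip, seen from the line of the strip. -/
def stripEnd (Λ : Finset Tile) (w : Tile) (i : Fin 5) : Tile × Fin 5 :=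
  rayEnd Λ w (i + turn w) (i - turn w)

theorem side_turn (w : Tile) {i k : Fin 5} (h : k = i - 1 ∨ k = i + 1) :
    k = i + turn w ∨ k = i - turn w := by
  rcases turn_eq w with h' | h' <;> rw [h'] <;> revert h <;> revert i k <;> decide

include hΛ

/-- Across an edge the orientation is reversed, and along a ray the two labels are exchanged. The
two changes compensate each other, so both ends of the strip keep their roles. -/
theorem strip_nbr {y : Tile} {i k : Fin 5} (hy : y ∈ Λ) (hk : k = i - 1 ∨ k = i + 1)
    (h : nbr y k ∈ Λ) : stripStart Λ (nbr y k) i = stripStart Λ y i ∧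
      stripEnd Λ (nbr y k) i = stripEnd Λ y i := by
  have key : ∀ k k', Opp i k k' → nbr y k ∈ Λ → rayEnd Λ (nbr y k) k' k = rayEnd Λ y k k' ∧
      rayEnd Λ (nbr y k) k k' = rayEnd Λ y k' k := by
    intro k k' ho h
    refine ⟨rayEnd_step hΛ hy ho h, ?_⟩
    have := rayEnd_step hΛ h ho (by rwa [nbr_nbr])
    rw [nbr_nbr] at this
    exact this.symm
  unfold stripStart stripEnd
  rw [turn_nbr, sub_neg_eq_add, ← sub_eq_add_neg]
  rcases side_turn y hk with rfl | rfl
  · exact (key _ _ (opp_turn y i) h).symm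
  · exact key _ _ (opp_turn y i).symm h

theorem stripStart_eq {w y : Tile} {i : Fin 5} (hw : w ∈ Λ) (hy : y ∈ Λ) (h : InStrip w i y) :
    stripStart Λ y i = stripStart Λ w i :=
  eq_of_inStrip hΛ (fun y => stripStart Λ y i) (fun _ hy _ hk h => (strip_nbr hΛ hy hk h).1) hw hy h

theorem stripEnd_eq {w y : Tile} {i : Fin 5} (hw : w ∈ Λ) (hy : y ∈ Λ) (h : InStrip w i y) :
    stripEnd Λ y i = stripEnd Λ w i :=
  eq_of_inStrip hΛ (fun y => stripEnd Λ y i) (fun _ hy _ hk h => (strip_nbr hΛ hy hk h).2) hw hy h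

omit hΛ

theorem opp_labels : ∀ {i k k' d : Fin 5}, (d = 1 ∨ d = -1) → Opp i k k' →
    (k = i - d → k' = i - -d) ∧ (k = i + d → k' = i + -d) := by decide

theorem Ray.spec {w : Tile} {i k k' : Fin 5} {p : Tile × Fin 5} (h : Ray Λ w k k' p)
    (ho : Opp i k k') : InStrip w i p.1 ∧ ((k = i - turn w → p.2 + turn p.1 = i) ∧
      (k = i + turn w → p.2 - turn p.1 = i)) := by
  induction h with
  | @finish w k k' _ _ =>
    refine ⟨.refl _ _, fun h => ?_, fun h => ?_⟩ <;> simp only [h, sub_add_cancel,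
      add_sub_cancel_right]
  | @step w k k' p _ _ _ ih =>
    obtain ⟨h1, h2, h3⟩ := ih ho.symm
    refine ⟨((InStrip.refl w i).nbr_side ho.side).trans h1, fun h => h2 ?_, fun h => h3 ?_⟩
    · rw [turn_nbr]; exact (opp_labels (turn_eq w) ho).1 h
    · rw [turn_nbr]; exact (opp_labels (turn_eq w) ho).2 h

include hΛ

theorem stripStart_spec {w : Tile} (hw : w ∈ Λ) (i : Fin 5) : stripStart Λ w i ∈ openLegs Λ ∧
    InStrip w i (stripStart Λ w i).1 ∧ (stripStart Λ w i).2 + turn (stripStart Λ w i).1 = i := by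
  have h := ray_rayEnd hΛ hw (opp_turn w i).symm
  exact ⟨h.mem_openLegs, (h.spec (opp_turn w i).symm).1, (h.spec (opp_turn w i).symm).2.1 rfl⟩

theorem stripEnd_spec {w : Tile} (hw : w ∈ Λ) (i : Fin 5) : stripEnd Λ w i ∈ openLegs Λ ∧
    InStrip w i (stripEnd Λ w i).1 ∧ (stripEnd Λ w i).2 - turn (stripEnd Λ w i).1 = i := by
  have h := ray_rayEnd hΛ hw (opp_turn w i)
  exact ⟨h.mem_openLegs, (h.spec (opp_turn w i)).1, (h.spec (opp_turn w i)).2.2 rfl⟩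

/-- From the tile of such an open leg the ray stops at once, and the ends of a strip are the same
seen from all of its tiles in the patch. The label and the orientation of the tile tell the start
from the end. -/
theorem eq_stripStart_iff {w : Tile} (hw : w ∈ Λ) {i : Fin 5} {p : Tile × Fin 5}
    (hp : p ∈ openLegs Λ) : p = stripStart Λ w i ↔ InStrip w i p.1 ∧ p.2 + turn p.1 = i := by
  constructor
  · rintro rfl; exact (stripStart_spec hΛ hw i).2
  · rintro ⟨h1, h2⟩
    have hp' := mem_openLegs.1 hp
    have e : i - turn p.1 = p.2 := by rw [← h2, add_sub_cancel_right]
    rw [← stripStart_eq hΛ hw hp'.1 h1, stripStart,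
      rayEnd_stop hΛ hp'.1 (opp_turn _ i).symm (by rw [e]; exact hp'.2), e]

theorem eq_stripEnd_iff {w : Tile} (hw : w ∈ Λ) {i : Fin 5} {p : Tile × Fin 5}
    (hp : p ∈ openLegs Λ) : p = stripEnd Λ w i ↔ InStrip w i p.1 ∧ p.2 - turn p.1 = i := by
  constructor
  · rintro rfl; exact (stripEnd_spec hΛ hw i).2
  · rintro ⟨h1, h2⟩
    have hp' := mem_openLegs.1 hp
    have e : i + turn p.1 = p.2 := by rw [← h2, sub_add_cancel]
    rw [← stripEnd_eq hΛ hw hp'.1 h1, stripEnd,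
      rayEnd_stop hΛ hp'.1 (opp_turn _ i) (by rw [e]; exact hp'.2), e]

/-- The pairing of the open legs: the dimer that starts at the first node of `p` ends at the second
node of `mate p`. -/
def mate : Equiv.Perm ↥(openLegs Λ) where
  toFun p := ⟨stripEnd Λ p.1.1 (p.1.2 + turn p.1.1),
    (stripEnd_spec hΛ (mem_openLegs.1 p.2).1 _).1⟩
  invFun p := ⟨stripStart Λ p.1.1 (p.1.2 - turn p.1.1),
    (stripStart_spec hΛ (mem_openLegs.1 p.2).1 _).1⟩
  left_inv p := by
    have hp := (mem_openLegs.1 p.2).1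
    have h := stripEnd_spec hΛ hp (p.1.2 + turn p.1.1)
    refine Subtype.ext ?_
    simp only [h.2.2]
    rw [stripStart_eq hΛ hp (mem_openLegs.1 h.1).1 h.2.1]
    exact ((eq_stripStart_iff hΛ hp p.2).2 ⟨.refl _ _, rfl⟩).symm
  right_inv p := by
    have hp := (mem_openLegs.1 p.2).1
    have h := stripStart_spec hΛ hp (p.1.2 - turn p.1.1)
    refine Subtype.ext ?_
    simp only [h.2.2]
    rw [stripEnd_eq hΛ hp (mem_openLegs.1 h.1).1 h.2.1]
    exact ((eq_stripEnd_iff hΛ hp p.2).2 ⟨.refl _ _, rfl⟩).symm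

omit hΛ

/-! ### The boundary walk -/

/-- The legs at or beyond the strip along the edge `i` of `w`. -/
def LegBehind (w : Tile) (i : Fin 5) (p : Tile × Fin 5) : Prop :=
  Behind w i p.1 ∨ (InStrip w i p.1 ∧ (p.2 = i ∨ p.2 = i - 1 ∨ p.2 = i + 1))

open Classical in
/-- Position of a tile relative to a strip: beyond its line, in it, or on its other side. -/
def region (w : Tile) (i : Fin 5) (y : Tile) : Fin 3 :=
  if Behind w i y then 0 else if InStrip w i y then 1 else 2

theorem region_eq_zero {w y : Tile} {i : Fin 5} : region w i y = 0 ↔ Behind w i y := by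
  unfold region; split_ifs <;> simp_all

theorem region_eq_one {w y : Tile} {i : Fin 5} : region w i y = 1 ↔ InStrip w i y := by
  unfold region
  split_ifs with h h'
  · simp only [zero_ne_one, false_iff]; exact fun h' => h'.not_behind h
  · simp [h']
  · simp [h']

/-- How the region may change in a step across the edge `k`. -/
def RegionStep (i k : Fin 5) (c c' : Fin 3) : Prop :=
  (c = 0 ∧ (c' = 0 ∨ k = i ∧ c' = 1)) ∨ (c = 1 ∧ c' = if k = i then 0 else
    if k = i - 1 ∨ k = i + 1 then 1 else 2) ∨
  (c = 2 ∧ (c' = 2 ∨ k ≠ i ∧ k ≠ i - 1 ∧ k ≠ i + 1 ∧ c' = 1))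

instance (i k : Fin 5) (c c' : Fin 3) : Decidable (RegionStep i k c c') :=
  inferInstanceAs (Decidable (_ ∨ _))

/-- All the geometry that the finite checks below need: the line is crossed only through the edges
`i` of tiles of the strip, and the strip meets its other side only through edges other than `i`, `i
- 1`, `i + 1`. -/
theorem regionStep_nbr (w : Tile) (i : Fin 5) (y : Tile) (k : Fin 5) :
    RegionStep i k (region w i y) (region w i (nbr y k)) := by
  by_cases h : Behind w i y
  · refine .inl ⟨region_eq_zero.2 h, ?_⟩
    by_cases h' : Behind w i (nbr y k)
    · exact .inl (region_eq_zero.2 h')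
    · obtain ⟨rfl, h2⟩ := h.cross h'
      exact .inr ⟨rfl, region_eq_one.2 h2⟩
  by_cases h1 : InStrip w i y
  · refine .inr (.inl ⟨region_eq_one.2 h1, ?_⟩)
    split_ifs with h2 h3
    · subst h2; exact region_eq_zero.2 h1.nbr_behind
    · exact region_eq_one.2 (h1.nbr_side h3)
    · rw [region, if_neg (h1.nbr_not_behind h2),
        if_neg (h1.nbr_not_inStrip (fun h => h3 (.inl h)) (fun h => h3 (.inr h)))]
  · refine .inr (.inr ⟨by rw [region, if_neg h, if_neg h1], ?_⟩)
    by_cases h2 : Behind w i (nbr y k)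
    · obtain ⟨rfl, h3⟩ := h2.cross (j := k) (by rwa [nbr_nbr])
      rw [nbr_nbr] at h3
      exact absurd h3 h1
    by_cases h3 : InStrip w i (nbr y k)
    · have h4 : nbr (nbr y k) k = y := nbr_nbr y k
      refine .inr ⟨?_, ?_, ?_, region_eq_one.2 h3⟩
      · rintro rfl; exact h (h4 ▸ h3.nbr_behind)
      · intro hk; exact h1 (h4 ▸ h3.nbr_side (.inl hk))
      · intro hk; exact h1 (h4 ▸ h3.nbr_side (.inr hk))
    · exact .inl (by rw [region, if_neg h2, if_neg h3])

/-- `LegBehind` in terms of the region of the tile. -/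
def LegIn (i : Fin 5) (c : Fin 3) (l : Fin 5) : Prop :=
  c = 0 ∨ (c = 1 ∧ (l = i ∨ l = i - 1 ∨ l = i + 1))

instance (i : Fin 5) (c : Fin 3) (l : Fin 5) : Decidable (LegIn i c l) :=
  inferInstanceAs (Decidable (_ ∨ _))

theorem legIn_iff {w : Tile} {i : Fin 5} {p : Tile × Fin 5} :
    LegIn i (region w i p.1) p.2 ↔ LegBehind w i p := by
  rw [LegIn, region_eq_zero, region_eq_one, LegBehind]

/-- A step of the boundary walk enters the legs behind a strip exactly at its start, and leaves them
exactly at its end. -/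
def WalkStep (i : Fin 5) (c : Fin 3) (l d : Fin 5) (c' : Fin 3) (l' d' : Fin 5) : Prop :=
  (if LegIn i c' l' then (1 : ZMod 2) else 0) + (if LegIn i c l then 1 else 0) =
    (if c' = 1 ∧ l' + d' = i then 1 else 0) + if c = 1 ∧ l - d = i then 1 else 0

instance (i : Fin 5) (c : Fin 3) (l d : Fin 5) (c' : Fin 3) (l' d' : Fin 5) :
    Decidable (WalkStep i c l d c' l' d') := inferInstanceAs (Decidable (_ = _))

/-- The three conclusions are the three ways in which `nextLeg` can go on: at the same tile, at the
next tile around the vertex, or at the one after it. -/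
theorem walkStep_cases : ∀ (i l d : Fin 5) (c₀ c₁ c₂ : Fin 3), (d = 1 ∨ d = -1) →
    RegionStep i (l + d) c₀ c₁ → RegionStep i l c₁ c₂ →
    WalkStep i c₀ l d c₀ (l + d) d ∧ WalkStep i c₀ l d c₁ l (-d) ∧
      WalkStep i c₀ l d c₂ (l + d) d := by
  decide +kernel

theorem nextLeg_eq (p : Tile × Fin 5) : nextLeg Λ p =
    if nbr p.1 (p.2 + turn p.1) ∉ Λ then (p.1, p.2 + turn p.1)
    else if nbr (nbr p.1 (p.2 + turn p.1)) p.2 ∉ Λ then (nbr p.1 (p.2 + turn p.1), p.2)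
    else (nbr (nbr p.1 (p.2 + turn p.1)) p.2, p.2 + turn p.1) := by
  have : (if Even (depth p.1) then p.2 + 1 else p.2 - 1) = p.2 + turn p.1 := by
    unfold turn; split_ifs
    · rfl
    · rw [sub_eq_add_neg]
  simp only [nextLeg, this]

theorem walkStep_nextLeg (w : Tile) (i : Fin 5) (p : Tile × Fin 5) :
    WalkStep i (region w i p.1) p.2 (turn p.1) (region w i (nextLeg Λ p).1) (nextLeg Λ p).2
      (turn (nextLeg Λ p).1) := by
  have h := walkStep_cases i p.2 (turn p.1) _ _ _ (turn_eq _) (regionStep_nbr w i p.1 _)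
    (regionStep_nbr w i (nbr p.1 (p.2 + turn p.1)) p.2)
  rw [nextLeg_eq]
  by_cases h1 : nbr p.1 (p.2 + turn p.1) ∈ Λ
  · rw [if_neg (not_not.2 h1)]
    by_cases h2 : nbr (nbr p.1 (p.2 + turn p.1)) p.2 ∈ Λ
    · rw [if_neg (not_not.2 h2)]
      simp only [turn_nbr, neg_neg]
      exact h.2.2
    · rw [if_pos h2]
      simp only [turn_nbr]
      exact h.2.1
  · rw [if_pos h1]
    exact h.1

open Classical in
/-- Indicator function of a proposition. -/
def ind (P : Prop) : ZMod 2 := if P then 1 else 0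

/-- The discrete derivative of the set of legs behind a strip. Modulo 2 it determines this set up to
complement, which is enough for `exists_interval`. -/
theorem ind_nextLeg {w : Tile} (hw : w ∈ Λ) (hΛ : IsPatch Λ) (i : Fin 5) {p : Tile × Fin 5}
    (hp : p ∈ openLegs Λ) (hp' : nextLeg Λ p ∈ openLegs Λ) :
    ind (LegBehind w i (nextLeg Λ p)) + ind (LegBehind w i p) =
      ind (nextLeg Λ p = stripStart Λ w i) + ind (p = stripEnd Λ w i) := by
  have h := walkStep_nextLeg (Λ := Λ) w i p
  unfold WalkStep at h
  simp only [ind]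
  convert h using 3
  · exact legIn_iff.symm
  · exact legIn_iff.symm
  · rw [region_eq_one]; exact eq_stripStart_iff hΛ hw hp'
  · rw [region_eq_one]; exact eq_stripEnd_iff hΛ hw hp

end Patch

end

end HaPPY

namespace HaPPY

noncomputable section

/-! ### Intervals of the boundary -/

theorem ind_eq_one {P : Prop} : ind P = 1 ↔ P := by
  unfold ind; split_ifs with h <;> simp [h]

theorem ind_of {P : Prop} (h : P) : ind P = 1 := ind_eq_one.2 h

theorem ind_of_not {P : Prop} (h : ¬ P) : ind P = 0 := by
  unfold ind; rw [if_neg h]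

theorem finRotate_closed {N : ℕ} {S : Fin N → Prop} (h : ∀ k, S k → S (finRotate N k)) {k₀ : Fin N}
    (h₀ : S k₀) (k : Fin N) : S k := by
  rcases N with _ | n
  · exact k₀.elim0
  have key : ∀ j : Fin (n + 1), S (k₀ + j) := by
    intro j
    induction j using Fin.induction with
    | zero => rwa [add_zero]
    | succ j ih =>
      have := h _ ih
      rwa [finRotate_apply, add_assoc, Fin.coeSucc_eq_succ] at this
  have := key (k - k₀)
  rwa [add_sub_cancel] at this

/-- A function on a cycle that only jumps at the start `p` and after the end `q` of an interval is
the indicator function of the interval, or of its complement. -/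
theorem exists_interval {N : ℕ} (f : Fin N → ZMod 2) (p q : Fin N)
    (h : ∀ k, f (finRotate N k) + f k = ind (finRotate N k = p) + ind (k = q)) :
    ∃ c, ∀ k, f k = c + (ind (k < p) + ind (k ≤ q)) := by
  rcases N with _ | n
  · exact p.elim0
  refine ⟨f 0 + (ind (0 < p) + ind (0 ≤ q)), fun k => ?_⟩
  have two : ∀ a : ZMod 2, a + a = 0 := CharTwo.add_self_eq_zero
  induction k using Fin.induction with
  | zero => rw [add_assoc, two, add_zero]
  | succ k ih =>
    have h1 := h k.castSucc
    rw [finRotate_apply, Fin.coeSucc_eq_succ, ih] at h1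
    have h2 : ind (k.castSucc < p) = ind (k.succ = p) + ind (k.succ < p) := by
      by_cases ha : k.succ = p
      · have h3 : ¬ k.succ < p := ha ▸ lt_irrefl _
        have h4 : k.castSucc < p := ha ▸ Fin.castSucc_lt_succ
        rw [ind_of ha, ind_of_not h3, ind_of h4, add_zero]
      · rw [ind_of_not ha, zero_add]
        congr 1
        rw [Fin.lt_def, Fin.lt_def]
        rw [Fin.ext_iff] at ha
        simp only [Fin.val_castSucc, Fin.val_succ] at ha ⊢
        exact propext ⟨fun h => by omega, fun h => by omega⟩
    have h3 : ind (k.castSucc ≤ q) = ind (k.castSucc = q) + ind (k.succ ≤ q) := by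
      by_cases ha : k.castSucc = q
      · have h3 : ¬ k.succ ≤ q := not_le.2 (ha ▸ Fin.castSucc_lt_succ)
        rw [ind_of ha, ind_of_not h3, ind_of ha.le, add_zero]
      · rw [ind_of_not ha, zero_add]
        congr 1
        rw [Fin.le_def, Fin.le_def]
        rw [Fin.ext_iff] at ha
        simp only [Fin.val_castSucc, Fin.val_succ] at ha ⊢
        exact propext ⟨fun h => by omega, fun h => by omega⟩
    rw [h2, h3] at h1
    have two' : (2 : ZMod 2) = 0 := rfl
    linear_combination h1 - (f 0 + ind (0 < p) + ind (0 ≤ q) + ind (k.succ < p) +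
      ind (k.succ ≤ q)) * two'

/-- As `p` and `q` belong to `I`, the set is the interval from `p` to `q` and not its complement.
Membership is therefore inherited by every step except those into `p` and out of `q`. -/
theorem iff_of_walk {N : ℕ} {I : Fin N → Prop} {p q : Fin N}
    (h : ∀ k, ind (I (finRotate N k)) + ind (I k) = ind (finRotate N k = p) + ind (k = q))
    (hp : I p) (hq : I q) {k : Fin N} :
    (finRotate N k ≠ p → I (finRotate N k) → k ≠ q ∧ I k) ∧
      (k ≠ q → I k → finRotate N k ≠ p ∧ I (finRotate N k)) := by
  have h1 := h k
  constructor
  · intro ha hb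
    rw [ind_of hb, ind_of_not ha, zero_add] at h1
    by_cases hk : k = q
    · subst hk; rw [ind_of hq, ind_of rfl] at h1; exact absurd h1 (by decide)
    · refine ⟨hk, ?_⟩
      by_contra hn
      rw [ind_of_not hn, ind_of_not hk] at h1
      exact absurd h1 (by decide)
  · intro ha hb
    rw [ind_of hb, ind_of_not ha, add_zero] at h1
    by_cases hk : finRotate N k = p
    · rw [hk, ind_of hp, ind_of rfl] at h1; exact absurd h1 (by decide)
    · refine ⟨hk, ?_⟩
      by_contra hn
      rw [ind_of_not hn, ind_of_not hk] at h1
      exact absurd h1 (by decide)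

/-- The walk can enter `I` only at `p`, where `C` holds. If no step inside `I` left `C`, it would
never be in `I` outside `C`, although it visits all points. -/
theorem exists_step_of_start {N : ℕ} {I : Fin N → Prop} {p q : Fin N}
    (h : ∀ k, ind (I (finRotate N k)) + ind (I k) = ind (finRotate N k = p) + ind (k = q))
    (hp : I p) (hq : I q) {C : Fin N → Prop} (hC : C p) {z : Fin N} (hz : I z) (hCz : ¬ C z) :
    ∃ k, I k ∧ I (finRotate N k) ∧ C k ∧ ¬ C (finRotate N k) := by
  by_contra hne
  push Not at hne
  have := finRotate_closed (S := fun k => ¬ (I k ∧ ¬ C k)) (fun k hk hk' => by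
    have h1 : finRotate N k ≠ p := by rintro h; exact hk'.2 (h ▸ hC)
    have h2 := (iff_of_walk h hp hq).1 h1 hk'.1
    by_cases hc : C k
    · exact hk'.2 (hne k h2.2 hk'.1 hc)
    · exact hk ⟨h2.2, hc⟩) (k₀ := p) (fun h => h.2 hC) z
  exact this ⟨hz, hCz⟩

theorem exists_step_of_end {N : ℕ} {I : Fin N → Prop} {p q : Fin N}
    (h : ∀ k, ind (I (finRotate N k)) + ind (I k) = ind (finRotate N k = p) + ind (k = q))
    (hp : I p) (hq : I q) {C : Fin N → Prop} (hC : C q) {z : Fin N} (hz : I z) (hCz : ¬ C z) :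
    ∃ k, I k ∧ I (finRotate N k) ∧ ¬ C k ∧ C (finRotate N k) := by
  by_contra hne
  push Not at hne
  have := finRotate_closed (S := fun k => I k ∧ ¬ C k) (fun k hk => by
    have h1 : k ≠ q := by rintro h; exact hk.2 (h ▸ hC)
    have h2 := (iff_of_walk h hp hq).2 h1 hk.1
    exact ⟨h2.2, hne k hk.1 h2.2 hk.2⟩) (k₀ := z) ⟨hz, hCz⟩ q
  exact this.2 hC

theorem finRotate_leave {N m : ℕ} {k : Fin N} (h1 : (k : ℕ) < m) (h2 : ¬ (finRotate N k : ℕ) < m) :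
    (k : ℕ) + 1 = m := by
  rcases N with _ | n
  · exact k.elim0
  by_cases hk : (k : ℕ) < n
  · rw [coe_finRotate_of_ne_last (by rintro rfl; simp at hk)] at h2; omega
  · have : k = Fin.last n := Fin.ext (by have := k.2; rw [Fin.val_last]; omega)
    subst this
    rw [finRotate_last, Fin.val_zero] at h2
    omega

theorem finRotate_enter {N m : ℕ} {k : Fin N} (h1 : ¬ (k : ℕ) < m) (h2 : (finRotate N k : ℕ) < m) :
    (k : ℕ) + 1 = N := by
  rcases N with _ | n
  · exact k.elim0
  by_cases hk : (k : ℕ) < n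
  · rw [coe_finRotate_of_ne_last (by rintro rfl; simp at hk)] at h2; omega
  · have := k.2; omega

/-! ### Strips that share a tile -/

theorem height_mul_strip {i : Fin 5} {d : Tile} (hd : d ∈ stripGroup i) (u : Tile) :
    height (u * d) i = height u i := by
  refine stripGroup_induction (p := fun d => height (u * d) i = height u i) (by rw [mul_one]) ?_ hd
  intro d _ k hk ih
  rw [← mul_assoc, height_mul_gen_adj _ (adj_of_side hk).symm, ih]

theorem InStrip.behind_iff {w w' y : Tile} {i : Fin 5} (h : InStrip w i w') :
    Behind w' i y ↔ Behind w i y := by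
  have : y⁻¹ * w' = y⁻¹ * w * (w⁻¹ * w') := by group
  rw [Behind, this, height_mul_strip h, Behind]

theorem InStrip.inStrip_iff {w w' y : Tile} {i : Fin 5} (h : InStrip w i w') :
    InStrip w' i y ↔ InStrip w i y :=
  ⟨fun h' => h.trans h', fun h' => h.symm.trans h'⟩

theorem InStrip.legBehind_iff {w w' : Tile} {i : Fin 5} {p : Tile × Fin 5} (h : InStrip w i w') :
    LegBehind w' i p ↔ LegBehind w i p := by
  rw [LegBehind, LegBehind, h.behind_iff, h.inStrip_iff]

/-- Two strips of a tile along lines that do not meet share at most one open leg. -/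
theorem legBehind_inter {Λ : Finset Tile} {w : Tile} {i : Fin 5} {p : Tile × Fin 5}
    (hp : p ∈ openLegs Λ) (h1 : LegBehind w i p) (h2 : LegBehind w (i + 2) p) :
    p = if nbr w (i + 1) ∈ Λ then (nbr w (i + 1), i + 1) else (w, i + 1) := by
  have hp' := mem_openLegs.1 hp
  have lab : ∀ i : Fin 5, i + 2 ≠ i - 1 ∧ i + 2 ≠ i + 1 ∧ i ≠ i + 2 - 1 ∧ i ≠ i + 2 + 1 ∧
      i ≠ i + 2 ∧ ¬ Adj i (i + 2) := by decide
  obtain ⟨l1, l2, l3, l4, l5, l6⟩ := lab i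
  rcases h1 with h1 | ⟨h1, k1⟩
  · rcases h2 with h2 | ⟨h2, _⟩
    · exact absurd (adj_of_height_neg l5 h1 h2) l6
    · exact absurd h1 (not_behind_of_inStrip h2 l3 l4)
  · rcases h2 with h2 | ⟨h2, k2⟩
    · exact absurd h2 (not_behind_of_inStrip h1 l1 l2)
    · have hl : p.2 = i + 1 := by
        have : ∀ i l : Fin 5, (l = i ∨ l = i - 1 ∨ l = i + 1) →
          (l = i + 2 ∨ l = i + 2 - 1 ∨ l = i + 2 + 1) → l = i + 1 := by decide
        exact this i p.2 k1 k2
      rcases eq_of_mem_stripGroup_inter h1 h2 with h | h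
      · have e : p.1 = w := (inv_mul_eq_one.1 h).symm
        have : nbr w (i + 1) ∉ Λ := by rw [← e, ← hl]; exact hp'.2
        rw [if_neg this, ← e, ← hl]
      · have e : p.1 = nbr w (i + 1) := inv_mul_eq_iff_eq_mul.1 h
        have : nbr w (i + 1) ∈ Λ := by rw [← e]; exact hp'.1
        rw [if_pos this, ← e, ← hl]

/-- The end lies in the strip of `i`, and also behind the edge `k` through which the ray leaves:
either the ray stops at this edge, or the height of `k` has turned negative along the alternating
product and stays so. -/
theorem legBehind_rayEnd {Λ : Finset Tile} (hΛ : IsPatch Λ) {w : Tile} (hw : w ∈ Λ)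
    {i k k' : Fin 5} (ho : Opp i k k') :
    LegBehind w i (rayEnd Λ w k k') ∧ LegBehind w k (rayEnd Λ w k k') := by
  have h := ray_rayEnd hΛ hw ho
  obtain ⟨h1, h2, h3⟩ := h.spec ho
  have lab : ∀ i l d : Fin 5, (d = 1 ∨ d = -1) → (l + d = i ∨ l - d = i) →
    l = i ∨ l = i - 1 ∨ l = i + 1 := by decide
  refine ⟨.inr ⟨h1, lab i _ (turn (rayEnd Λ w k k').1) (turn_eq _) ?_⟩, ?_⟩
  · rcases side_turn w ho.side with h4 | h4
    · exact .inr (h3 h4)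
    · exact .inl (h2 h4)
  · rcases h.altProd with h4 | ⟨n, hn⟩
    · rw [h4]; exact .inr ⟨.refl _ _, .inl rfl⟩
    · left
      rw [Behind, hn]
      have := (height_mul_altProd (m := 1) ho.ne ho.not_adj (by rw [height_one]; exact one_pos)
        (by rw [height_one]; exact one_pos) n).1
      rwa [one_mul] at this

end

end HaPPY

namespace HaPPY

noncomputable section

/-! ### Two-coloured boundaries -/

/-- A colouring of legs and tiles where both colour classes of legs are intervals of the boundary,
and a tile has the colour of any interval behind one of its strips that is of one colour. -/
structure Colouring (Λ : Finset Tile) (L : Tile × Fin 5 → Prop) (T : Tile → Prop) : Prop where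
  next_mem : ∀ p ∈ openLegs Λ, nextLeg Λ p ∈ openLegs Λ
  start : ∀ w ∈ Λ, ∀ i, ∀ C : Tile × Fin 5 → Prop, C (stripStart Λ w i) → ∀ z ∈ openLegs Λ,
    LegBehind w i z → ¬ C z → ∃ p ∈ openLegs Λ, LegBehind w i p ∧ LegBehind w i (nextLeg Λ p) ∧
      C p ∧ ¬ C (nextLeg Λ p)
  finish : ∀ w ∈ Λ, ∀ i, ∀ C : Tile × Fin 5 → Prop, C (stripEnd Λ w i) → ∀ z ∈ openLegs Λ,
    LegBehind w i z → ¬ C z → ∃ p ∈ openLegs Λ, LegBehind w i p ∧ LegBehind w i (nextLeg Λ p) ∧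
      ¬ C p ∧ C (nextLeg Λ p)
  up : ∀ p ∈ openLegs Λ, ∀ q ∈ openLegs Λ, L p → ¬ L (nextLeg Λ p) → L q → ¬ L (nextLeg Λ q) → p = q
  down : ∀ p ∈ openLegs Λ, ∀ q ∈ openLegs Λ, ¬ L p → L (nextLeg Λ p) → ¬ L q → L (nextLeg Λ q) →
    p = q
  inside : ∀ w ∈ Λ, ∀ i, (∀ p ∈ openLegs Λ, LegBehind w i p → L p) → T w
  outside : ∀ w ∈ Λ, ∀ i, (∀ p ∈ openLegs Λ, LegBehind w i p → ¬ L p) → ¬ T w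

namespace Colouring

variable {Λ : Finset Tile} {L : Tile × Fin 5 → Prop} {T : Tile → Prop}

theorem compl (h : Colouring Λ L T) : Colouring Λ (fun p => ¬ L p) (fun w => ¬ T w) where
  next_mem := h.next_mem
  start := h.start
  finish := h.finish
  up p hp q hq h1 h2 h3 h4 := h.down p hp q hq h1 (not_not.1 h2) h3 (not_not.1 h4)
  down p hp q hq h1 h2 h3 h4 := h.up p hp q hq (not_not.1 h1) h2 (not_not.1 h3) h4
  inside := h.outside
  outside w hw i h' := not_not.2 (h.inside w hw i fun p hp hb => not_not.1 (h' p hp hb))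

/-- Walking along the boundary behind a strip, the colour changes from true to false. -/
def Up (Λ : Finset Tile) (L : Tile × Fin 5 → Prop) (w : Tile) (i : Fin 5) : Prop :=
  ∃ p ∈ openLegs Λ, LegBehind w i p ∧ LegBehind w i (nextLeg Λ p) ∧ L p ∧ ¬ L (nextLeg Λ p)

/-- Walking along the boundary behind a strip, the colour changes from false to true. -/
def Down (Λ : Finset Tile) (L : Tile × Fin 5 → Prop) (w : Tile) (i : Fin 5) : Prop :=
  ∃ p ∈ openLegs Λ, LegBehind w i p ∧ LegBehind w i (nextLeg Λ p) ∧ ¬ L p ∧ L (nextLeg Λ p)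

/-- The boundary has only one change of this kind. Both of its legs would lie behind both strips,
which share at most one leg, yet the two legs have different colours. -/
theorem not_up_up (h : Colouring Λ L T) (w : Tile) (i : Fin 5) :
    ¬ (Up Λ L w i ∧ Up Λ L w (i + 2)) := by
  rintro ⟨⟨p, hp, h1, h2, h3, h4⟩, q, hq, h1', h2', h3', h4'⟩
  obtain rfl := h.up p hp q hq h3 h4 h3' h4'
  have := (legBehind_inter hp h1 h1').trans (legBehind_inter (h.next_mem p hp) h2 h2').symm
  exact h4 (this ▸ h3)

theorem not_down_down (h : Colouring Λ L T) (w : Tile) (i : Fin 5) :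
    ¬ (Down Λ L w i ∧ Down Λ L w (i + 2)) := by
  rintro ⟨⟨p, hp, h1, h2, h3, h4⟩, q, hq, h1', h2', h3', h4'⟩
  obtain rfl := h.down p hp q hq h3 h4 h3' h4'
  have := (legBehind_inter hp h1 h1').trans (legBehind_inter (h.next_mem p hp) h2 h2').symm
  exact h3 (this ▸ h4)

/-- The legs behind a strip are not all of one colour. -/
def Mixed (Λ : Finset Tile) (L : Tile × Fin 5 → Prop) (w : Tile) (i : Fin 5) : Prop :=
  (∃ p ∈ openLegs Λ, LegBehind w i p ∧ L p) ∧ ∃ p ∈ openLegs Λ, LegBehind w i p ∧ ¬ L p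

theorem up_of_start (h : Colouring Λ L T) {w : Tile} (hw : w ∈ Λ) {i : Fin 5}
    (hm : Mixed Λ L w i) (hs : L (stripStart Λ w i)) : Up Λ L w i := by
  obtain ⟨-, z, hz, h1, h2⟩ := hm
  exact h.start w hw i L hs z hz h1 h2

theorem down_of_finish (h : Colouring Λ L T) {w : Tile} (hw : w ∈ Λ) {i : Fin 5}
    (hm : Mixed Λ L w i) (hs : L (stripEnd Λ w i)) : Down Λ L w i := by
  obtain ⟨-, z, hz, h1, h2⟩ := hm
  exact h.finish w hw i L hs z hz h1 h2

theorem down_of_start (h : Colouring Λ L T) {w : Tile} (hw : w ∈ Λ) {i : Fin 5}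
    (hm : Mixed Λ L w i) (hs : ¬ L (stripStart Λ w i)) : Down Λ L w i := by
  obtain ⟨⟨z, hz, h1, h2⟩, -⟩ := hm
  obtain ⟨p, hp, hp1, hp2, hp3, hp4⟩ := h.start w hw i (fun p => ¬ L p) hs z hz h1 (not_not.2 h2)
  exact ⟨p, hp, hp1, hp2, hp3, not_not.1 hp4⟩

theorem up_of_finish (h : Colouring Λ L T) {w : Tile} (hw : w ∈ Λ) {i : Fin 5}
    (hm : Mixed Λ L w i) (hs : ¬ L (stripEnd Λ w i)) : Up Λ L w i := by
  obtain ⟨⟨z, hz, h1, h2⟩, -⟩ := hm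
  obtain ⟨p, hp, hp1, hp2, hp3, hp4⟩ := h.finish w hw i (fun p => ¬ L p) hs z hz h1 (not_not.2 h2)
  exact ⟨p, hp, hp1, hp2, not_not.1 hp3, hp4⟩

/-- At every tile, the legs behind one of the five strips are of one colour. -/
theorem exists_not_mixed (h : Colouring Λ L T) {w : Tile} (hw : w ∈ Λ) : ∃ i, ¬ Mixed Λ L w i := by
  by_contra hne
  push Not at hne
  have hud : ∀ i, Up Λ L w i ∨ Down Λ L w i := fun i => by
    by_cases hs : L (stripStart Λ w i)
    · exact .inl (h.up_of_start hw (hne i) hs)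
    · exact .inr (h.down_of_start hw (hne i) hs)
  -- The pairs `i`, `i + 2` form a 5-cycle, and an odd cycle is not covered by two independent sets.
  have key : ∀ u d : Fin 5 → Bool, (∀ i, ¬ (u i = true ∧ u (i + 2) = true)) →
      (∀ i, ¬ (d i = true ∧ d (i + 2) = true)) → ¬ ∀ i, u i = true ∨ d i = true := by
    decide +kernel
  classical
  refine key (fun i => decide (Up Λ L w i)) (fun i => decide (Down Λ L w i)) ?_ ?_ ?_
  · intro i; simpa using h.not_up_up w i
  · intro i; simpa using h.not_down_down w i
  · intro i; simpa using hud i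

/-- A strip of one colour exists by `exists_not_mixed`, and the axiom `outside` excludes the wrong
colour. -/
theorem all_or_all (h : Colouring Λ L T) {w : Tile} (hw : w ∈ Λ) (hT : T w) :
    ∃ i, ∀ p ∈ openLegs Λ, LegBehind w i p → L p := by
  obtain ⟨i, hi⟩ := h.exists_not_mixed hw
  rw [Mixed, not_and_or] at hi
  push Not at hi
  rcases hi with hi | hi
  · exact absurd hT (h.outside w hw i hi)
  · exact ⟨i, hi⟩

/-- The dimer along a strip of one colour stays in one half. It provides the local qubit with which
the number of swaps is made even. -/
theorem exists_mate (h : Colouring Λ L T) (hΛ : IsPatch Λ) {w : Tile} (hw : w ∈ Λ) :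
    ∃ p, L p.1 ↔ L (mate hΛ p).1 := by
  obtain ⟨i, hi⟩ := h.exists_not_mixed hw
  have hs := stripStart_spec hΛ hw i
  have he := stripEnd_spec hΛ hw i
  refine ⟨⟨_, hs.1⟩, ?_⟩
  have e : (mate hΛ ⟨stripStart Λ w i, hs.1⟩).1 = stripEnd Λ w i := by
    simp only [mate, Equiv.coe_fn_mk, hs.2.2]
    exact stripEnd_eq hΛ hw (mem_openLegs.1 hs.1).1 hs.2.1
  rw [e]
  have b1 := (legBehind_rayEnd hΛ hw (opp_turn w i).symm).1
  have b2 := (legBehind_rayEnd hΛ hw (opp_turn w i)).1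
  rw [Mixed, not_and_or] at hi
  push Not at hi
  rcases hi with hi | hi
  · exact iff_of_false (hi _ hs.1 b1) (hi _ he.1 b2)
  · exact iff_of_true (hi _ hs.1 b1) (hi _ he.1 b2)

theorem not_inside (h : Colouring Λ L T) {w : Tile} (hw : w ∈ Λ) (hT : ¬ T w) (i : Fin 5) :
    ∃ p ∈ openLegs Λ, LegBehind w i p ∧ ¬ L p := by
  by_contra hne
  push Not at hne
  exact hT (h.inside w hw i hne)

theorem not_outside (h : Colouring Λ L T) {w : Tile} (hw : w ∈ Λ) (hT : T w) (i : Fin 5) :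
    ∃ p ∈ openLegs Λ, LegBehind w i p ∧ L p := by
  by_contra hne
  push Not at hne
  exact h.outside w hw i hne hT

/-- If the strips next to the edge `k` of `w` are mixed, and not both of them turn their backs on
`w`, then they both end in the colour of `w` on the side of `w`. -/
theorem ends_of_mixed (h : Colouring Λ L T) {w : Tile} (hw : w ∈ Λ) {k : Fin 5}
    (m1 : Mixed Λ L w (k + turn w)) (m2 : Mixed Λ L w (k - turn w))
    (hb : ¬ (L (stripStart Λ w (k + turn w)) ∧ ¬ L (stripEnd Λ w (k + turn w)) ∧
      ¬ L (stripStart Λ w (k - turn w)) ∧ L (stripEnd Λ w (k - turn w)))) :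
    ¬ L (stripStart Λ w (k + turn w)) ∧ L (stripEnd Λ w (k + turn w)) ∧
      L (stripStart Λ w (k - turn w)) ∧ ¬ L (stripEnd Λ w (k - turn w)) := by
  have lab : ∀ k : Fin 5, k - 1 + 2 = k + 1 ∧ k + -1 + 2 = k - -1 := by decide
  have nu : ¬ (Up Λ L w (k + turn w) ∧ Up Λ L w (k - turn w)) := by
    rcases turn_eq w with ht | ht <;> rw [ht]
    · have := h.not_up_up w (k - 1)
      rw [(lab k).1] at this
      exact fun h => this h.symm
    · have := h.not_up_up w (k + -1)
      rwa [(lab k).2] at this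
  have nd : ¬ (Down Λ L w (k + turn w) ∧ Down Λ L w (k - turn w)) := by
    rcases turn_eq w with ht | ht <;> rw [ht]
    · have := h.not_down_down w (k - 1)
      rw [(lab k).1] at this
      exact fun h => this h.symm
    · have := h.not_down_down w (k + -1)
      rwa [(lab k).2] at this
  by_cases hs : L (stripStart Λ w (k + turn w))
  · refine absurd ⟨hs, ?_⟩ hb
    have v1 : ¬ Up Λ L w (k - turn w) := fun h' => nu ⟨h.up_of_start hw m1 hs, h'⟩
    have v2 : ¬ L (stripStart Λ w (k - turn w)) := fun h' => v1 (h.up_of_start hw m2 h')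
    have v3 := h.down_of_start hw m2 v2
    exact ⟨fun h' => nd ⟨h.down_of_finish hw m1 h', v3⟩, v2,
      by_contra fun h' => v1 (h.up_of_finish hw m2 h')⟩
  · have v1 : ¬ Down Λ L w (k - turn w) := fun h' => nd ⟨h.down_of_start hw m1 hs, h'⟩
    have v2 : L (stripStart Λ w (k - turn w)) := by_contra fun h' => v1 (h.down_of_start hw m2 h')
    have v3 := h.up_of_start hw m2 v2
    exact ⟨hs, by_contra fun h' => nu ⟨h.up_of_finish hw m1 h', v3⟩, v2,
      fun h' => v1 (h.down_of_finish hw m2 h')⟩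

/-- The two strips across the edge `k` belong to tiles of both colours, or end at `k` itself, so
they are mixed and `ends_of_mixed` applies. What has to be excluded is that both strips turn their
backs on `w`, with ends coloured the wrong way round. -/
theorem rayEnd_colour_aux (h : Colouring Λ L T) (hΛ : IsPatch Λ) {w : Tile} (hw : w ∈ Λ)
    (hT : T w) {k : Fin 5} (hx : if nbr w k ∈ Λ then ¬ T (nbr w k) else ¬ L (w, k)) :
    ¬ L (stripStart Λ w (k + turn w)) ∧ L (stripEnd Λ w (k + turn w)) ∧
      L (stripStart Λ w (k - turn w)) ∧ ¬ L (stripEnd Λ w (k - turn w)) := by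
  have s1 : stripStart Λ w (k + turn w) = rayEnd Λ w k (k + turn w + turn w) := by
    rw [stripStart, add_sub_cancel_right]
  have s2 : stripEnd Λ w (k - turn w) = rayEnd Λ w k (k - turn w - turn w) := by
    rw [stripEnd, sub_add_cancel]
  have s3 : stripEnd Λ w (k + turn w) = rayEnd Λ w (k + turn w + turn w) k := by
    rw [stripEnd, add_sub_cancel_right]
  have s4 : stripStart Λ w (k - turn w) = rayEnd Λ w (k - turn w - turn w) k := by
    rw [stripStart, sub_add_cancel]
  have o1 : Opp (k + turn w) k (k + turn w + turn w) := by
    have := (opp_turn w (k + turn w)).symm; rwa [add_sub_cancel_right] at this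
  have o2 : Opp (k - turn w) k (k - turn w - turn w) := by
    have := opp_turn w (k - turn w); rwa [sub_add_cancel] at this
  by_cases hk : nbr w k ∈ Λ
  · rw [if_pos hk] at hx
    have i1 : InStrip w (k + turn w) (nbr w k) := (InStrip.refl w _).nbr_side o1.side
    have i2 : InStrip w (k - turn w) (nbr w k) := (InStrip.refl w _).nbr_side o2.side
    have m1 : Mixed Λ L w (k + turn w) := by
      refine ⟨h.not_outside hw hT _, ?_⟩
      obtain ⟨p, hp, h1, h2⟩ := h.not_inside hk hx (k + turn w)
      exact ⟨p, hp, i1.legBehind_iff.1 h1, h2⟩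
    have m2 : Mixed Λ L w (k - turn w) := by
      refine ⟨h.not_outside hw hT _, ?_⟩
      obtain ⟨p, hp, h1, h2⟩ := h.not_inside hk hx (k - turn w)
      exact ⟨p, hp, i2.legBehind_iff.1 h1, h2⟩
    refine h.ends_of_mixed hw m1 m2 ?_
    rintro ⟨b1, b2, b3, b4⟩
    obtain ⟨i, hi⟩ := h.all_or_all hw hT
    obtain ⟨j, hj⟩ := h.compl.all_or_all hk hx
    have cases : ∀ i k t : Fin 5, (t = 1 ∨ t = -1) → i = k ∨ i = k + t ∨ i = k - t ∨ i = k + t + t ∨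
      i = k - t - t := by decide
    have r1 := legBehind_rayEnd hΛ hw o1
    have r2 := legBehind_rayEnd hΛ hw o2
    have r3 := legBehind_rayEnd hΛ hw o1.symm
    have r4 := legBehind_rayEnd hΛ hw o2.symm
    have q1 := (legBehind_rayEnd hΛ hk o1.symm).2
    have q2 := (legBehind_rayEnd hΛ hk o2.symm).2
    rw [rayEnd_step hΛ hw o1 hk, ← s1] at q1
    rw [rayEnd_step hΛ hw o2 hk, ← s2] at q2
    rw [← s3] at r3
    rw [← s4] at r4
    -- The strips along `k + turn w` and `k - turn w` are mixed. Those two labels further contain an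
    -- end of one of these on the side of `w`, which has the wrong colour by assumption. The same
    -- happens on the other side of the edge for `j`.
    have hik : i = k := by
      rcases cases i k (turn w) (turn_eq w) with rfl | rfl | rfl | rfl | rfl
      · rfl
      · obtain ⟨p, hp, h1, h2⟩ := m1.2; exact absurd (hi p hp h1) h2
      · obtain ⟨p, hp, h1, h2⟩ := m2.2; exact absurd (hi p hp h1) h2
      · exact absurd (hi _ (stripEnd_spec hΛ hw _).1 r3.2) b2
      · exact absurd (hi _ (stripStart_spec hΛ hw _).1 r4.2) b3
    have hjk : j = k := by
      rcases cases j k (turn w) (turn_eq w) with rfl | rfl | rfl | rfl | rfl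
      · rfl
      · obtain ⟨p, hp, h1, h2⟩ := m1.1; exact absurd h2 (hj p hp (i1.legBehind_iff.2 h1))
      · obtain ⟨p, hp, h1, h2⟩ := m2.1; exact absurd h2 (hj p hp (i2.legBehind_iff.2 h1))
      · exact absurd b1 (hj _ (stripStart_spec hΛ hw _).1 q1)
      · exact absurd b4 (hj _ (stripEnd_spec hΛ hw _).1 q2)
    -- The strip of `w` along the line of `k` is all of one colour. But its start lies beyond this
    -- line as seen from the neighbour, where everything has the other colour.
    subst hik hjk
    have hs := stripStart_spec hΛ hw j
    have hb := (legBehind_rayEnd hΛ hw (opp_turn w j).symm).1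
    refine hj _ hs.1 (.inl ?_) (hi _ hs.1 hb)
    have hsym : InStrip (nbr w j) j (nbr w j) := .refl _ _
    have e : (stripStart Λ w j).1⁻¹ * nbr w j = (stripStart Λ w j).1⁻¹ * w * gen j := by
      rw [nbr_eq, mul_assoc]
    rw [Behind, e, height_mul_gen_self, height_of_mem_stripGroup hs.2.1.symm]
    norm_num
  · rw [if_neg hk] at hx
    have hp : (w, k) ∈ openLegs Λ := mem_openLegs.2 ⟨hw, hk⟩
    have e1 := rayEnd_stop hΛ hw o1 hk
    have e2 := rayEnd_stop hΛ hw o2 hk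
    have r1 := (legBehind_rayEnd hΛ hw o1).1
    have r2 := (legBehind_rayEnd hΛ hw o2).1
    rw [e1] at r1
    rw [e2] at r2
    refine h.ends_of_mixed hw ⟨h.not_outside hw hT _, _, hp, r1, hx⟩
      ⟨h.not_outside hw hT _, _, hp, r2, hx⟩ ?_
    rintro ⟨b1, -⟩
    rw [s1, e1] at b1
    exact hx b1

/-- The colour of what lies across the edge `k` of `w`. -/
def Across (Λ : Finset Tile) (L : Tile × Fin 5 → Prop) (T : Tile → Prop) (w : Tile) (k : Fin 5) :
    Prop := if nbr w k ∈ Λ then T (nbr w k) else L (w, k)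

/-- If the two sides of an edge have different colours, then the two strips across the edge end in
these colours. -/
theorem ends_of_across (h : Colouring Λ L T) (hΛ : IsPatch Λ) {w : Tile} (hw : w ∈ Λ) {k : Fin 5}
    (hx : ¬ (Across Λ L T w k ↔ T w)) :
    (L (stripStart Λ w (k + turn w)) ↔ Across Λ L T w k) ∧ (L (stripEnd Λ w (k + turn w)) ↔ T w) ∧
      (L (stripStart Λ w (k - turn w)) ↔ T w) ∧
      (L (stripEnd Λ w (k - turn w)) ↔ Across Λ L T w k) := by
  by_cases hT : T w
  · have hA : ¬ Across Λ L T w k := by tauto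
    have := h.rayEnd_colour_aux hΛ hw hT (k := k) (by
      rw [Across] at hA; split_ifs at hA ⊢ <;> exact hA)
    tauto
  · have hA : Across Λ L T w k := by tauto
    have := h.compl.rayEnd_colour_aux hΛ hw hT (k := k) (by
      rw [Across] at hA; split_ifs at hA ⊢ <;> exact not_not.2 hA)
    tauto

end Colouring

end

end HaPPY

namespace HaPPY

noncomputable section

/-! ### Counting the cut edges -/

theorem mate_eq_stripEnd {Λ : Finset Tile} (hΛ : IsPatch Λ) (p : ↥(openLegs Λ)) :
    p.1 = stripStart Λ p.1.1 (p.1.2 + turn p.1.1) ∧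
      (mate hΛ p).1 = stripEnd Λ p.1.1 (p.1.2 + turn p.1.1) :=
  ⟨(eq_stripStart_iff hΛ (mem_openLegs.1 p.2).1 p.2).2 ⟨.refl _ _, rfl⟩, rfl⟩

theorem mate_symm_eq_stripStart {Λ : Finset Tile} (hΛ : IsPatch Λ) (p : ↥(openLegs Λ)) :
    p.1 = stripEnd Λ p.1.1 (p.1.2 - turn p.1.1) ∧
      ((mate hΛ).symm p).1 = stripStart Λ p.1.1 (p.1.2 - turn p.1.1) :=
  ⟨(eq_stripEnd_iff hΛ (mem_openLegs.1 p.2).1 p.2).2 ⟨.refl _ _, rfl⟩, rfl⟩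

namespace Colouring

variable {Λ : Finset Tile} {L : Tile × Fin 5 → Prop} {T : Tile → Prop}

open Classical in
/-- Integer-valued indicator function. -/
def chi (P : Prop) : ℤ := if P then 1 else 0

/-- Difference of the colours of the two ends of a strip. -/
def ends (Λ : Finset Tile) (L : Tile × Fin 5 → Prop) (w : Tile) (i : Fin 5) : ℤ :=
  chi (L (stripStart Λ w i)) - chi (L (stripEnd Λ w i))

/-- At an edge with equal colours everything vanishes; at a cut edge, `ends_of_across` identifies
the end colours with the colours of its sides. This turns the count of cut edges into a bilinear
expression that can be summed by parts. -/
theorem sum_sq_across (h : Colouring Λ L T) (hΛ : IsPatch Λ) {w : Tile} (hw : w ∈ Λ) (k : Fin 5) :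
    (chi (T w) - chi (Across Λ L T w k)) * ends Λ L w (k - turn w) =
        (chi (T w) - chi (Across Λ L T w k)) ^ 2 ∧
      (chi (Across Λ L T w k) - chi (T w)) * ends Λ L w (k + turn w) =
        (chi (T w) - chi (Across Λ L T w k)) ^ 2 := by
  by_cases hx : Across Λ L T w k ↔ T w
  · rw [hx, sub_self]; simp
  · obtain ⟨h1, h2, h3, h4⟩ := h.ends_of_across hΛ hw hx
    rw [ends, ends, h1, h2, h3, h4]
    constructor <;> ring

theorem sum_ends (w : Tile) :
    ∑ k, ends Λ L w (k - turn w) = ∑ k, ends Λ L w (k + turn w) :=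
  (Equiv.sum_comp (Equiv.subRight (turn w)) (ends Λ L w)).trans
    (Equiv.sum_comp (Equiv.addRight (turn w)) (ends Λ L w)).symm

/-- Seen from the other side of a bond, the tile across becomes the tile itself and the orientation
is reversed, while the strip stays the same. -/
theorem sum_bond_reindex (hΛ : IsPatch Λ) :
    ∑ p ∈ bondLegs Λ, chi (Across Λ L T p.1 p.2) * ends Λ L p.1 (p.2 - turn p.1) =
      ∑ p ∈ bondLegs Λ, chi (T p.1) * ends Λ L p.1 (p.2 + turn p.1) := by
  have hmem : ∀ p ∈ bondLegs Λ, (nbr p.1 p.2, p.2) ∈ bondLegs Λ := fun p hp => by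
    have := mem_bondLegs.1 hp
    exact mem_bondLegs.2 ⟨this.2, by rw [nbr_nbr]; exact this.1⟩
  refine Finset.sum_nbij' (fun p => (nbr p.1 p.2, p.2)) (fun p => (nbr p.1 p.2, p.2)) hmem hmem
    (fun p _ => by simp) (fun p _ => by simp) (fun p hp => ?_)
  have hp' := mem_bondLegs.1 hp
  rw [Across, if_pos hp'.2, turn_nbr, ← sub_eq_add_neg]
  have hs : p.2 = p.2 - turn p.1 - 1 ∨ p.2 = p.2 - turn p.1 + 1 := by
    rcases turn_eq p.1 with h | h <;> rw [h]
    · right; rw [sub_add_cancel]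
    · left; rw [sub_neg_eq_add, add_sub_cancel_right]
  have := strip_nbr hΛ hp'.1 hs hp'.2
  rw [ends, ends, this.1, this.2]

theorem sum_legs (f : Tile × Fin 5 → ℤ) :
    ∑ p ∈ bondLegs Λ, f p + ∑ p ∈ openLegs Λ, f p = ∑ w ∈ Λ, ∑ k, f (w, k) := by
  rw [bondLegs, openLegs, Finset.sum_filter_add_sum_filter_not, Finset.sum_product]

/-- Summation by parts. The terms with the colour of the tile cancel at every tile, because `k +
turn` and `k - turn` both run through all labels. Left are the terms with the colours of the open
legs, and these combine to the dimers. A bond is counted from both sides, hence the factor 2 at the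
open legs. -/
theorem sum_sq_eq (h : Colouring Λ L T) (hΛ : IsPatch Λ) :
    ∑ p ∈ bondLegs Λ, (chi (T p.1) - chi (Across Λ L T p.1 p.2)) ^ 2 +
      2 * ∑ p ∈ openLegs Λ, (chi (T p.1) - chi (L p)) ^ 2 =
    ∑ p : ↥(openLegs Λ), (chi (L p.1) - chi (L (mate hΛ p).1)) ^ 2 := by
  have hopen : ∀ p ∈ openLegs Λ, Across Λ L T p.1 p.2 = L p := fun p hp => by
    rw [Across, if_neg (mem_openLegs.1 hp).2]
  have e1 : ∑ p ∈ bondLegs Λ, (chi (T p.1) - chi (Across Λ L T p.1 p.2)) ^ 2 =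
      ∑ p ∈ bondLegs Λ, chi (T p.1) * ends Λ L p.1 (p.2 - turn p.1) -
        ∑ p ∈ bondLegs Λ, chi (T p.1) * ends Λ L p.1 (p.2 + turn p.1) := by
    rw [← sum_bond_reindex hΛ, ← Finset.sum_sub_distrib]
    refine Finset.sum_congr rfl fun p hp => ?_
    rw [← (h.sum_sq_across hΛ (mem_bondLegs.1 hp).1 p.2).1]; ring
  have e2 : 2 * ∑ p ∈ openLegs Λ, (chi (T p.1) - chi (L p)) ^ 2 =
      ∑ p ∈ openLegs Λ, chi (T p.1) * ends Λ L p.1 (p.2 - turn p.1) -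
        ∑ p ∈ openLegs Λ, chi (T p.1) * ends Λ L p.1 (p.2 + turn p.1) +
      ∑ p ∈ openLegs Λ, chi (L p) *
        (ends Λ L p.1 (p.2 + turn p.1) - ends Λ L p.1 (p.2 - turn p.1)) := by
    rw [← Finset.sum_sub_distrib, ← Finset.sum_add_distrib, Finset.mul_sum]
    refine Finset.sum_congr rfl fun p hp => ?_
    have := h.sum_sq_across hΛ (mem_openLegs.1 hp).1 p.2
    rw [hopen p hp] at this
    rw [two_mul]
    nth_rewrite 1 [← this.1]
    rw [← this.2]; ring
  have e3 := sum_legs (Λ := Λ) fun p => chi (T p.1) * ends Λ L p.1 (p.2 - turn p.1)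
  have e4 := sum_legs (Λ := Λ) fun p => chi (T p.1) * ends Λ L p.1 (p.2 + turn p.1)
  have e5 : ∑ w ∈ Λ, ∑ k, chi (T w) * ends Λ L w (k - turn w) =
      ∑ w ∈ Λ, ∑ k, chi (T w) * ends Λ L w (k + turn w) := by
    refine Finset.sum_congr rfl fun w _ => ?_
    rw [← Finset.mul_sum, ← Finset.mul_sum, sum_ends]
  have e6 : ∑ p ∈ openLegs Λ, chi (L p) *
        (ends Λ L p.1 (p.2 + turn p.1) - ends Λ L p.1 (p.2 - turn p.1)) =
      ∑ p : ↥(openLegs Λ), (chi (L p.1) - chi (L (mate hΛ p).1)) ^ 2 := by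
    rw [← Finset.sum_coe_sort]
    -- At an open leg `p` one strip starts and another one ends, namely the dimers at its two nodes.
    have e7 : ∀ p : ↥(openLegs Λ), chi (L p.1) *
        (ends Λ L p.1.1 (p.1.2 + turn p.1.1) - ends Λ L p.1.1 (p.1.2 - turn p.1.1)) =
        chi (L p.1) ^ 2 - chi (L p.1) * chi (L (mate hΛ p).1) +
        (chi (L p.1) ^ 2 - chi (L ((mate hΛ).symm p).1) * chi (L p.1)) := fun p => by
      rw [ends, ends, ← (mate_eq_stripEnd hΛ p).2, ← (mate_eq_stripEnd hΛ p).1,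
        ← (mate_symm_eq_stripStart hΛ p).2, ← (mate_symm_eq_stripStart hΛ p).1]
      ring
    have e8 : ∑ p : ↥(openLegs Λ),
        (chi (L p.1) ^ 2 - chi (L ((mate hΛ).symm p).1) * chi (L p.1)) =
        ∑ p : ↥(openLegs Λ),
          (chi (L (mate hΛ p).1) ^ 2 - chi (L p.1) * chi (L (mate hΛ p).1)) := by
      rw [← Equiv.sum_comp (mate hΛ)]
      simp only [Equiv.symm_apply_apply]
    rw [Finset.sum_congr rfl fun p _ => e7 p, Finset.sum_add_distrib, e8,
      ← Finset.sum_add_distrib]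
    exact Finset.sum_congr rfl fun p _ => by ring
  rw [e1, e2, ← e6]
  linear_combination e3 - e4 + e5

open Classical in
/-- The number of dimers from one colour to the other is the number of edges between the colours. -/
theorem card_cut (h : Colouring Λ L T) (hΛ : IsPatch Λ) (R : Finset (Tile × Fin 5))
    (hR : ∀ p, p ∈ R ↔ (p ∈ bondLegs Λ ∧ T p.1 ∧ ¬ T (nbr p.1 p.2)) ∨
      (p ∈ openLegs Λ ∧ ((T p.1 ∧ ¬ L p) ∨ (¬ T p.1 ∧ L p)))) :
    (Finset.univ.filter fun p : ↥(openLegs Λ) => L p.1 ∧ ¬ L (mate hΛ p).1).card = R.card ∧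
      (Finset.univ.filter fun p : ↥(openLegs Λ) => ¬ L p.1 ∧ L (mate hΛ p).1).card = R.card := by
  set X := Finset.univ.filter fun p : ↥(openLegs Λ) => L p.1 ∧ ¬ L (mate hΛ p).1
  set Y := Finset.univ.filter fun p : ↥(openLegs Λ) => ¬ L p.1 ∧ L (mate hΛ p).1
  have hX : (X.card : ℤ) = ∑ p : ↥(openLegs Λ), chi (L p.1 ∧ ¬ L (mate hΛ p).1) := by
    rw [Finset.card_filter, Nat.cast_sum]
    exact Finset.sum_congr rfl fun p _ => by unfold chi; split_ifs <;> simp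
  have hY : (Y.card : ℤ) = ∑ p : ↥(openLegs Λ), chi (¬ L p.1 ∧ L (mate hΛ p).1) := by
    rw [Finset.card_filter, Nat.cast_sum]
    exact Finset.sum_congr rfl fun p _ => by unfold chi; split_ifs <;> simp
  -- As `mate` is a permutation, as many dimers lead out of a colour class as into it.
  have h1 : (X.card : ℤ) - Y.card = 0 := by
    rw [hX, hY, ← Finset.sum_sub_distrib]
    have : ∑ p : ↥(openLegs Λ), (chi (L p.1) - chi (L (mate hΛ p).1)) = 0 := by
      rw [Finset.sum_sub_distrib, Equiv.sum_comp (mate hΛ) (fun p => chi (L p.1)), sub_self]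
    rw [← this]
    refine Finset.sum_congr rfl fun p _ => ?_
    by_cases h1 : L p.1 <;> by_cases h2 : L (mate hΛ p).1 <;> simp [chi, h1, h2]
  have h2 : (X.card : ℤ) + Y.card =
      ∑ p : ↥(openLegs Λ), (chi (L p.1) - chi (L (mate hΛ p).1)) ^ 2 := by
    rw [hX, hY, ← Finset.sum_add_distrib]
    refine Finset.sum_congr rfl fun p _ => ?_
    by_cases h1 : L p.1 <;> by_cases h2 : L (mate hΛ p).1 <;> simp [chi, h1, h2]
  have hR' : (R.card : ℤ) = ∑ p ∈ bondLegs Λ, chi (T p.1 ∧ ¬ T (nbr p.1 p.2)) +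
      ∑ p ∈ openLegs Λ, (chi (T p.1) - chi (L p)) ^ 2 := by
    have e : R = ((bondLegs Λ).filter fun p => T p.1 ∧ ¬ T (nbr p.1 p.2)) ∪
        ((openLegs Λ).filter fun p => (T p.1 ∧ ¬ L p) ∨ (¬ T p.1 ∧ L p)) := by
      ext p
      rw [hR, Finset.mem_union, Finset.mem_filter, Finset.mem_filter]
    rw [e, Finset.card_union_of_disjoint, Nat.cast_add]
    · congr 1
      · rw [Finset.card_filter, Nat.cast_sum]
        exact Finset.sum_congr rfl fun p _ => by unfold chi; split_ifs <;> simp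
      · rw [Finset.card_filter, Nat.cast_sum]
        refine Finset.sum_congr rfl fun p _ => ?_
        by_cases h1 : T p.1 <;> by_cases h2 : L p <;> simp [chi, h1, h2]
    · rw [Finset.disjoint_left]
      intro p hp hp'
      exact (mem_openLegs.1 (Finset.mem_filter.1 hp').1).2
        (mem_bondLegs.1 (Finset.mem_filter.1 hp).1).2
  -- The set `R` contains a cut bond only with its leg at the inner tile, while the sum counts it
  -- from both sides.
  have h3 : ∑ p ∈ bondLegs Λ, (chi (T p.1) - chi (Across Λ L T p.1 p.2)) ^ 2 =
      2 * ∑ p ∈ bondLegs Λ, chi (T p.1 ∧ ¬ T (nbr p.1 p.2)) := by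
    have hmem : ∀ p ∈ bondLegs Λ, (nbr p.1 p.2, p.2) ∈ bondLegs Λ := fun p hp => by
      have := mem_bondLegs.1 hp
      exact mem_bondLegs.2 ⟨this.2, by rw [nbr_nbr]; exact this.1⟩
    have e : ∑ p ∈ bondLegs Λ, chi (T p.1 ∧ ¬ T (nbr p.1 p.2)) =
        ∑ p ∈ bondLegs Λ, chi (¬ T p.1 ∧ T (nbr p.1 p.2)) := by
      refine Finset.sum_nbij' (fun p => (nbr p.1 p.2, p.2)) (fun p => (nbr p.1 p.2, p.2)) hmem hmem
        (fun p _ => by simp) (fun p _ => by simp) (fun p hp => ?_)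
      simp only [nbr_nbr, and_comm]
    rw [two_mul]
    nth_rewrite 2 [e]
    rw [← Finset.sum_add_distrib]
    refine Finset.sum_congr rfl fun p hp => ?_
    rw [Across, if_pos (mem_bondLegs.1 hp).2]
    by_cases h1 : T p.1 <;> by_cases h2 : T (nbr p.1 p.2) <;> simp [chi, h1, h2]
  have h4 := h.sum_sq_eq hΛ
  omega

end Colouring

end

end HaPPY

namespace HaPPY

noncomputable section

set_option linter.unusedSectionVars false

/-! ### Pauli strings -/

/-- The sign `(-1) ^ z`. -/
def sgn (z : ZMod 2) : ℂ := (-1) ^ z.val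

theorem sgn_zero : sgn 0 = 1 := by simp [sgn]

theorem sgn_one : sgn 1 = -1 := by
  rw [sgn, show (1 : ZMod 2).val = 1 from rfl, pow_one]

theorem zmod_two_cases (z : ZMod 2) : z = 0 ∨ z = 1 := by revert z; decide

theorem zadd_self (z : ZMod 2) : z + z = 0 := CharTwo.add_self_eq_zero z

theorem fadd_self {α : Type*} (u : α → ZMod 2) : u + u = 0 := funext fun _ => zadd_self _

theorem sgn_add (a b : ZMod 2) : sgn (a + b) = sgn a * sgn b := by
  rcases zmod_two_cases a with rfl | rfl <;> rcases zmod_two_cases b with rfl | rfl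
  · simp [sgn_zero]
  · simp [sgn_zero]
  · simp [sgn_zero]
  · rw [zadd_self, sgn_zero, sgn_one]; ring

theorem sgn_mul_self (a : ZMod 2) : sgn a * sgn a = 1 := by rw [← sgn_add, zadd_self, sgn_zero]

theorem sgn_ne_zero (a : ZMod 2) : sgn a ≠ 0 := fun h => by
  have := sgn_mul_self a
  rw [h] at this; simp at this

theorem star_sgn (a : ZMod 2) : star (sgn a) = sgn a := by
  rcases zmod_two_cases a with rfl | rfl
  · simp [sgn_zero]
  · simp [sgn_one]

theorem norm_sgn (a : ZMod 2) : ‖sgn a‖ = 1 := by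
  rcases zmod_two_cases a with rfl | rfl
  · simp [sgn_zero]
  · simp [sgn_one]

theorem sgn_injective : Function.Injective sgn := by
  intro a b h
  rcases zmod_two_cases a with rfl | rfl <;> rcases zmod_two_cases b with rfl | rfl
  · rfl
  · rw [sgn_zero, sgn_one] at h; norm_num at h
  · rw [sgn_zero, sgn_one] at h; norm_num at h
  · rfl

variable {ι : Type} [Fintype ι] [DecidableEq ι]

theorem pauli_apply (u v : ι → ZMod 2) (x y : ι → ZMod 2) :
    pauli u v x y = if x = y + u then sgn (v ⬝ᵥ y) else 0 := rfl

theorem pauli_act (u v : ι → ZMod 2) (ψ : (ι → ZMod 2) → ℂ) (x : ι → ZMod 2) :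
    (pauli u v *ᵥ ψ) x = sgn (v ⬝ᵥ (x + u)) * ψ (x + u) := pauli_mulVec u v ψ x

theorem matrix_ext_mulVec {m n : Type*} [Fintype n] [DecidableEq n] {M M' : Matrix m n ℂ}
    (h : ∀ ψ, M *ᵥ ψ = M' *ᵥ ψ) : M = M' := by
  ext x y
  have := congrFun (h (Pi.single y 1)) x
  simpa using this

theorem pauli_mul (u v u' v' : ι → ZMod 2) :
    pauli u v * pauli u' v' = sgn (v ⬝ᵥ u') • pauli (u + u') (v + v') := by
  refine matrix_ext_mulVec fun ψ => funext fun x => ?_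
  rw [← Matrix.mulVec_mulVec, Matrix.smul_mulVec, Pi.smul_apply, pauli_act, pauli_act, pauli_act,
    smul_eq_mul, ← mul_assoc, ← mul_assoc, ← sgn_add, ← sgn_add, ← add_assoc]
  congr 2
  rw [add_dotProduct, ← add_assoc]
  congr 1
  rw [← dotProduct_add, add_comm (x + u) u', ← add_assoc, fadd_self, ← add_assoc]
  simp [add_comm]

theorem pauli_zero : pauli (0 : ι → ZMod 2) 0 = 1 := by
  ext x y
  rw [pauli_apply, zero_dotProduct, sgn_zero, add_zero, Matrix.one_apply]

theorem pauli_conjTranspose (u v : ι → ZMod 2) :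
    (pauli u v)ᴴ = sgn (u ⬝ᵥ v) • pauli u v := by
  ext x y
  rw [conjTranspose_apply, Matrix.smul_apply, pauli_apply, pauli_apply, smul_eq_mul]
  by_cases h : y = x + u
  · have h' : x = y + u := by rw [h, add_assoc, fadd_self, add_zero]
    rw [if_pos h, if_pos h', star_sgn, ← sgn_add, h, dotProduct_add, dotProduct_comm u v,
      add_left_comm, zadd_self, add_zero]
  · have h' : ¬ x = y + u := fun h' => h (by rw [h', add_assoc, fadd_self, add_zero])
    rw [if_neg h, if_neg h', star_zero, mul_zero]

theorem pauli_mul_pauli_self (u v : ι → ZMod 2) : pauli u v * pauli u v = sgn (v ⬝ᵥ u) • 1 := by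
  rw [pauli_mul, fadd_self, fadd_self, pauli_zero]

theorem pauli_conjTranspose_mul (u v : ι → ZMod 2) : (pauli u v)ᴴ * pauli u v = 1 := by
  rw [pauli_conjTranspose, smul_mul_assoc, pauli_mul_pauli_self, smul_smul, dotProduct_comm v u,
    sgn_mul_self, one_smul]

theorem pauli_comm (u v u' v' : ι → ZMod 2) :
    pauli u v * pauli u' v' = sgn (v ⬝ᵥ u' + v' ⬝ᵥ u) • (pauli u' v' * pauli u v) := by
  rw [pauli_mul, pauli_mul, smul_smul, add_comm u' u, add_comm v' v, ← sgn_add, add_assoc,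
    zadd_self, add_zero]

/-! ### Majorana operators -/

variable {N : ℕ}

/-- The positions of the factors `Z` in a Majorana operator. -/
def jw (e : Fin N ≃ ι) (k : ι × ZMod 2) : ι → ZMod 2 :=
  fun l => if e.symm l < e.symm k.1 ∨ (l = k.1 ∧ k.2 = 1) then 1 else 0

/-- The phase of a Majorana operator. -/
def jwPhase (k : ι × ZMod 2) : ℂ := if k.2 = 0 then 1 else I

theorem majorana_eq (e : Fin N ≃ ι) (k : ι × ZMod 2) :
    majorana e k = jwPhase k • pauli (Pi.single k.1 1) (jw e k) := rfl

theorem jw_self (e : Fin N ≃ ι) (k : ι × ZMod 2) : jw e k k.1 = k.2 := by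
  unfold jw
  rcases zmod_two_cases k.2 with h | h <;> simp [h]

/-- Of two different nodes exactly one comes later, and its string has a Z at the qubit of the
other. This is the sign in the anticommutation relation. -/
theorem jw_add_jw (e : Fin N ≃ ι) {k l : ι × ZMod 2} (h : k ≠ l) : jw e k l.1 + jw e l k.1 = 1 := by
  by_cases h1 : k.1 = l.1
  · rw [← h1, jw_self]
    conv_lhs => rw [h1]
    rw [jw_self]
    have h2 : k.2 ≠ l.2 := fun h2 => h (Prod.ext h1 h2)
    revert h2
    generalize k.2 = a
    generalize l.2 = b
    revert a b; decide
  · have h2 : e.symm k.1 ≠ e.symm l.1 := fun h2 => h1 (e.symm.injective h2)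
    unfold jw
    rcases lt_or_gt_of_ne h2 with h3 | h3
    · simp [h3, not_lt.2 h3.le, Ne.symm h1]
    · simp [h3, not_lt.2 h3.le, h1]

theorem jwPhase_sq (k : ι × ZMod 2) : jwPhase k * jwPhase k * sgn k.2 = 1 := by
  unfold jwPhase
  rcases zmod_two_cases k.2 with h | h
  · simp [h, sgn_zero]
  · simp [h, sgn_one]

theorem star_jwPhase (k : ι × ZMod 2) : star (jwPhase k) * sgn k.2 = jwPhase k := by
  unfold jwPhase
  rcases zmod_two_cases k.2 with h | h
  · simp [h, sgn_zero]
  · simp [h, sgn_one]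

theorem majorana_sq (e : Fin N ≃ ι) (k : ι × ZMod 2) : majorana e k * majorana e k = 1 := by
  rw [majorana_eq, smul_mul_smul_comm, pauli_mul_pauli_self, dotProduct_single, mul_one, jw_self,
    smul_smul, jwPhase_sq, one_smul]

theorem majorana_conjTranspose (e : Fin N ≃ ι) (k : ι × ZMod 2) :
    (majorana e k)ᴴ = majorana e k := by
  rw [majorana_eq, conjTranspose_smul, pauli_conjTranspose, single_dotProduct, one_mul, jw_self,
    smul_smul, star_jwPhase]

theorem majorana_anticomm (e : Fin N ≃ ι) {k l : ι × ZMod 2} (h : k ≠ l) :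
    majorana e k * majorana e l = -(majorana e l * majorana e k) := by
  rw [majorana_eq, majorana_eq, smul_mul_smul_comm, smul_mul_smul_comm, pauli_comm,
    dotProduct_single, dotProduct_single, mul_one, mul_one, jw_add_jw e h, sgn_one, neg_one_smul,
    smul_neg, mul_comm (jwPhase k)]

/-- The total parity operator. -/
def totalParity : Matrix (ι → ZMod 2) (ι → ZMod 2) ℂ := pauli 0 fun _ => 1

theorem totalParity_sq : (totalParity : Matrix (ι → ZMod 2) (ι → ZMod 2) ℂ) * totalParity = 1 := by
  rw [totalParity, pauli_mul_pauli_self, dotProduct_zero, sgn_zero, one_smul]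

theorem totalParity_conjTranspose :
    (totalParity : Matrix (ι → ZMod 2) (ι → ZMod 2) ℂ)ᴴ = totalParity := by
  rw [totalParity, pauli_conjTranspose, zero_dotProduct, sgn_zero, one_smul]

theorem majorana_mul_totalParity (e : Fin N ≃ ι) (k : ι × ZMod 2) :
    majorana e k * totalParity = -(totalParity * majorana e k) := by
  rw [majorana_eq, totalParity, smul_mul_assoc, mul_smul_comm, pauli_comm, dotProduct_zero,
    dotProduct_single, zero_add, mul_one, sgn_one, neg_one_smul, smul_neg]

/-! ### Dimer swaps -/

theorem dimerSwap_eq (e : Fin N ≃ ι) (k l : ι × ZMod 2) : dimerSwap e k l =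
    ((Real.sqrt 2 : ℝ) : ℂ)⁻¹ • (totalParity * (majorana e k - majorana e l)) := rfl

/-- For a third node both factors of the swap anticommute with the Majorana operator, and the signs
cancel. For `k` and `l` the difference of the two Majorana operators exchanges them with a minus
sign, which the total parity removes. -/
theorem dimerSwap_mul_majorana (e : Fin N ≃ ι) {k l : ι × ZMod 2} (h : k ≠ l) (n : ι × ZMod 2) :
    dimerSwap e k l * majorana e n = majorana e (Equiv.swap k l n) * dimerSwap e k l := by
  have hP : ∀ n, majorana e n * totalParity = -(totalParity * majorana e n) :=
    majorana_mul_totalParity e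
  have key : totalParity * (majorana e k - majorana e l) * majorana e n =
      majorana e (Equiv.swap k l n) * (totalParity * (majorana e k - majorana e l)) := by
    rw [← mul_assoc (majorana e _), hP, mul_assoc, neg_mul, mul_assoc, ← mul_neg]
    congr 1
    by_cases h1 : n = k
    · subst h1
      rw [Equiv.swap_apply_left, sub_mul, mul_sub, majorana_sq, majorana_sq, neg_sub]
    by_cases h2 : n = l
    · subst h2
      rw [Equiv.swap_apply_right, sub_mul, mul_sub, majorana_sq, majorana_sq, neg_sub]
    · rw [Equiv.swap_apply_of_ne_of_ne h1 h2, sub_mul, mul_sub, majorana_anticomm e h1,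
        majorana_anticomm e h2]
      abel
  rw [dimerSwap_eq, smul_mul_assoc, mul_smul_comm, key]

theorem dimerSwap_unitary (e : Fin N ≃ ι) {k l : ι × ZMod 2} (h : k ≠ l) :
    (dimerSwap e k l)ᴴ * dimerSwap e k l = 1 := by
  have h2 : ((Real.sqrt 2 : ℝ) : ℂ)⁻¹ * ((Real.sqrt 2 : ℝ) : ℂ)⁻¹ = 1 / 2 := by
    rw [← _root_.mul_inv, ← Complex.ofReal_mul, Real.mul_self_sqrt (by norm_num)]; norm_num
  rw [dimerSwap_eq, conjTranspose_smul, conjTranspose_mul, conjTranspose_sub,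
    majorana_conjTranspose, majorana_conjTranspose, totalParity_conjTranspose, smul_mul_smul_comm,
    mul_assoc, ← mul_assoc totalParity, totalParity_sq, one_mul, sub_mul, mul_sub, mul_sub,
    majorana_sq, majorana_sq, majorana_anticomm e h]
  rw [show star ((Real.sqrt 2 : ℝ) : ℂ)⁻¹ = ((Real.sqrt 2 : ℝ) : ℂ)⁻¹ by simp, h2]
  have : (1 : Matrix (ι → ZMod 2) (ι → ZMod 2) ℂ) - -(majorana e l * majorana e k) -
      (majorana e l * majorana e k - 1) = (2 : ℂ) • 1 := by
    rw [two_smul]; abel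
  rw [this, smul_smul]; norm_num

/-- All swaps of the list are between different nodes of qubits in `A`. -/
def SwapsIn (A : Finset ι) (S : List ((ι × ZMod 2) × (ι × ZMod 2))) : Prop :=
  ∀ p ∈ S, p.1 ≠ p.2 ∧ p.1.1 ∈ A ∧ p.2.1 ∈ A

theorem swapProd_mul_majorana (e : Fin N ≃ ι) {A : Finset ι}
    {S : List ((ι × ZMod 2) × (ι × ZMod 2))} (hS : SwapsIn A S) (n : ι × ZMod 2) :
    swapProd e S * majorana e n = majorana e (nodePerm S n) * swapProd e S := by
  induction S generalizing n with
  | nil => simp [swapProd, nodePerm]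
  | cons p S ih =>
    have h1 := ih (fun p hp => hS p (List.mem_cons_of_mem _ hp)) n
    have h2 := dimerSwap_mul_majorana e (hS p List.mem_cons_self).1 (nodePerm S n)
    simp only [swapProd, nodePerm, List.map_cons, List.prod_cons, Equiv.Perm.mul_apply] at h1 h2 ⊢
    rw [mul_assoc, h1, ← mul_assoc, h2, mul_assoc]

theorem swapProd_unitary (e : Fin N ≃ ι) {A : Finset ι}
    {S : List ((ι × ZMod 2) × (ι × ZMod 2))} (hS : SwapsIn A S) :
    (swapProd e S)ᴴ * swapProd e S = 1 := by
  induction S with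
  | nil => simp [swapProd]
  | cons p S ih =>
    have h1 := ih (fun p hp => hS p (List.mem_cons_of_mem _ hp))
    have h2 := dimerSwap_unitary e (hS p List.mem_cons_self).1
    simp only [swapProd, List.map_cons, List.prod_cons] at h1 h2 ⊢
    rw [conjTranspose_mul, mul_assoc, ← mul_assoc _ (dimerSwap e p.1 p.2), h2, one_mul, h1]

theorem HasDimer.swapProd {e : Fin N ≃ ι} {ψ : (ι → ZMod 2) → ℂ} {k l : ι × ZMod 2} {p : ZMod 2}
    (h : HasDimer e ψ k l p) {A : Finset ι} {S : List ((ι × ZMod 2) × (ι × ZMod 2))}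
    (hS : SwapsIn A S) :
    HasDimer e (HaPPY.swapProd e S *ᵥ ψ) (nodePerm S k) (nodePerm S l) p := by
  unfold HasDimer at h ⊢
  rw [Matrix.mulVec_mulVec, add_mul, smul_mul_assoc, ← swapProd_mul_majorana e hS,
    ← swapProd_mul_majorana e hS, ← mul_smul_comm, ← mul_add, ← Matrix.mulVec_mulVec, h,
    Matrix.mulVec_zero]

theorem hasDimer_iff {e : Fin N ≃ ι} {ψ : (ι → ZMod 2) → ℂ} {k l : ι × ZMod 2} {p : ZMod 2} :
    HasDimer e ψ k l p ↔ majorana e k *ᵥ ψ = -(I * sgn p) • majorana e l *ᵥ ψ := by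
  rw [HasDimer, Matrix.add_mulVec, Matrix.smul_mulVec, add_eq_zero_iff_eq_neg, neg_smul]; rfl

/-- A dimer as an eigenvalue of a product of two Majorana operators. -/
theorem hasDimer_iff_mul {e : Fin N ≃ ι} {ψ : (ι → ZMod 2) → ℂ} {k l : ι × ZMod 2} {p : ZMod 2}
    (h : k ≠ l) :
    HasDimer e ψ k l p ↔ (majorana e k * majorana e l) *ᵥ ψ = (I * sgn p) • ψ := by
  rw [hasDimer_iff]
  have hs : -(I * sgn p) * -(I * sgn p) = -1 := by
    linear_combination I * I * sgn_mul_self p + I_mul_I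
  constructor
  · intro h'
    rw [majorana_anticomm e h, Matrix.neg_mulVec, ← Matrix.mulVec_mulVec, h', Matrix.mulVec_smul,
      Matrix.mulVec_mulVec, majorana_sq, Matrix.one_mulVec, neg_smul, neg_neg]
  · intro h'
    have := congrArg (majorana e l *ᵥ ·) h'
    simp only [majorana_anticomm e h, Matrix.neg_mulVec, Matrix.mulVec_neg, Matrix.mulVec_mulVec,
      Matrix.mulVec_smul] at this
    rw [← mul_assoc, majorana_sq, one_mul] at this
    rw [neg_smul, ← this, neg_neg]

theorem HasDimer.symm {e : Fin N ≃ ι} {ψ : (ι → ZMod 2) → ℂ} {k l : ι × ZMod 2} {p : ZMod 2}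
    (h : HasDimer e ψ k l p) : HasDimer e ψ l k (p + 1) := by
  rw [hasDimer_iff] at h ⊢
  rw [h, smul_smul, sgn_add, sgn_one]
  rw [show -(I * (sgn p * -1)) * -(I * sgn p) = (1 : ℂ) by
    linear_combination (-I * I) * sgn_mul_self p - I_mul_I, one_smul]

end

end HaPPY

namespace HaPPY

noncomputable section

set_option linter.unusedSectionVars false

/-! ### Local operators -/

variable {ι : Type} [Fintype ι] [DecidableEq ι]

theorem glue_mem {s : Finset ι} (x : ↥s → ZMod 2) (y : ↥sᶜ → ZMod 2) {l : ι} (h : l ∈ s) :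
    glue s x y l = x ⟨l, h⟩ := dif_pos h

theorem glue_not_mem {s : Finset ι} (x : ↥s → ZMod 2) (y : ↥sᶜ → ZMod 2) {l : ι} (h : l ∉ s) :
    glue s x y l = y ⟨l, Finset.mem_compl.2 h⟩ := dif_neg h

theorem glue_restrict (s : Finset ι) (x : ι → ZMod 2) :
    glue s (fun l => x l) (fun l => x l) = x := by
  funext l
  by_cases h : l ∈ s
  · rw [glue_mem _ _ h]
  · rw [glue_not_mem _ _ h]

/-- The configurations of all qubits as pairs of configurations. -/
def glueEquiv (s : Finset ι) : (↥s → ZMod 2) × (↥sᶜ → ZMod 2) ≃ (ι → ZMod 2) where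
  toFun p := glue s p.1 p.2
  invFun x := (fun l => x l, fun l => x l)
  left_inv p := by
    refine Prod.ext (funext fun l => ?_) (funext fun l => ?_)
    · exact glue_mem _ _ l.2
    · exact glue_not_mem _ _ (Finset.mem_compl.1 l.2)
  right_inv x := glue_restrict s x

theorem localOp_apply (A : Finset ι) (U : Matrix (↥A → ZMod 2) (↥A → ZMod 2) ℂ)
    (x y : ι → ZMod 2) :
    localOp A U x y = if ∀ l, l ∉ A → x l = y l then U (fun l => x l) (fun l => y l) else 0 := rfl

theorem localOp_mulVec (A : Finset ι) (U : Matrix (↥A → ZMod 2) (↥A → ZMod 2) ℂ)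
    (ψ : (ι → ZMod 2) → ℂ) (x : ι → ZMod 2) :
    (localOp A U *ᵥ ψ) x = ∑ z, U (fun l => x l) z * ψ (glue A z fun l => x l) := by
  simp only [Matrix.mulVec, dotProduct]
  rw [← Equiv.sum_comp (glueEquiv A), Fintype.sum_prod_type]
  refine Finset.sum_congr rfl fun z _ => ?_
  rw [Finset.sum_eq_single fun l : ↥Aᶜ => x l]
  · simp only [glueEquiv, Equiv.coe_fn_mk]
    rw [localOp_apply, if_pos]
    · congr 2
      exact funext fun l => glue_mem _ _ l.2
    · exact fun l hl => (glue_not_mem z (fun l : ↥Aᶜ => x l) hl).symm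
  · intro y _ hy
    rw [localOp_apply, if_neg, zero_mul]
    intro h
    refine hy (funext fun l => ?_)
    rw [h l (Finset.mem_compl.1 l.2)]
    exact (glue_not_mem _ _ (Finset.mem_compl.1 l.2)).symm
  · exact fun h => absurd (Finset.mem_univ _) h

theorem localOp_mul (A : Finset ι) (U W : Matrix (↥A → ZMod 2) (↥A → ZMod 2) ℂ) :
    localOp A (U * W) = localOp A U * localOp A W := by
  refine matrix_ext_mulVec fun ψ => funext fun x => ?_
  rw [← Matrix.mulVec_mulVec, localOp_mulVec, localOp_mulVec]
  simp only [localOp_mulVec, Matrix.mul_apply, Finset.sum_mul, Finset.mul_sum]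
  rw [Finset.sum_comm]
  refine Finset.sum_congr rfl fun z _ => Finset.sum_congr rfl fun y _ => ?_
  have h1 : (fun l : ↥A => glue A z (fun l => x l) l) = z := funext fun l => glue_mem _ _ l.2
  have h2 : (fun l : ↥Aᶜ => glue A z (fun l => x l) l) = fun l : ↥Aᶜ => x l :=
    funext fun l => glue_not_mem _ _ (Finset.mem_compl.1 l.2)
  rw [h1, h2, mul_assoc]

theorem localOp_one (A : Finset ι) : localOp A (1 : Matrix (↥A → ZMod 2) (↥A → ZMod 2) ℂ) = 1 := by
  ext x y
  rw [localOp_apply, Matrix.one_apply, Matrix.one_apply]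
  by_cases h : x = y
  · subst h; simp
  · rw [if_neg h]
    split_ifs with h1 h2
    · refine absurd (funext fun l => ?_) h
      by_cases hl : l ∈ A
      · exact congrFun h2 ⟨l, hl⟩
      · exact h1 l hl
    · rfl
    · rfl

theorem localOp_conjTranspose (A : Finset ι) (U : Matrix (↥A → ZMod 2) (↥A → ZMod 2) ℂ) :
    (localOp A U)ᴴ = localOp A Uᴴ := by
  ext x y
  rw [conjTranspose_apply, localOp_apply, localOp_apply, conjTranspose_apply]
  by_cases h : ∀ l, l ∉ A → x l = y l
  · rw [if_pos h, if_pos fun l hl => (h l hl).symm]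
  · rw [if_neg h, if_neg fun h' => h fun l hl => (h' l hl).symm, star_zero]

theorem localOp_injective (A : Finset ι) : Function.Injective (localOp A) := by
  intro U W h
  ext x y
  have := congrFun (congrFun h (glue A x 0)) (glue A y 0)
  rw [localOp_apply, localOp_apply, if_pos, if_pos] at this
  · have e : ∀ z : ↥A → ZMod 2, (fun l : ↥A => glue A z 0 l) = z := fun z =>
      funext fun l => glue_mem _ _ l.2
    rwa [e, e] at this
  all_goals
    intro l hl
    rw [glue_not_mem _ _ hl, glue_not_mem _ _ hl]

theorem localOp_add (A : Finset ι) (U W : Matrix (↥A → ZMod 2) (↥A → ZMod 2) ℂ) :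
    localOp A (U + W) = localOp A U + localOp A W := by
  ext x y
  rw [Matrix.add_apply, localOp_apply, localOp_apply, localOp_apply]
  split_ifs <;> simp

theorem localOp_smul (A : Finset ι) (c : ℂ) (U : Matrix (↥A → ZMod 2) (↥A → ZMod 2) ℂ) :
    localOp A (c • U) = c • localOp A U := by
  ext x y
  rw [Matrix.smul_apply, localOp_apply, localOp_apply]
  split_ifs <;> simp

theorem localOp_mul_localOp {A C : Finset ι} (h : Disjoint A C)
    (U : Matrix (↥A → ZMod 2) (↥A → ZMod 2) ℂ) (W : Matrix (↥C → ZMod 2) (↥C → ZMod 2) ℂ)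
    (x y : ι → ZMod 2) : (localOp A U * localOp C W) x y =
      if ∀ l, l ∉ A → l ∉ C → x l = y l then
        U (fun l => x l) (fun l => y l) * W (fun l => x l) (fun l => y l) else 0 := by
  have hAC : ∀ l, l ∈ A → l ∉ C := fun l hl => Finset.disjoint_left.1 h hl
  rw [Matrix.mul_apply, Finset.sum_eq_single fun l => if l ∈ A then y l else x l]
  · rw [localOp_apply, localOp_apply, if_pos fun l hl => (if_neg hl).symm]
    by_cases h1 : ∀ l, l ∉ A → l ∉ C → x l = y l
    · rw [if_pos h1, if_pos]
      · congr 1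
        · congr 1; funext l; simp
        · congr 1; funext l; exact if_neg fun h => hAC _ h l.2
      · intro l hl
        split_ifs with hA
        · rfl
        · exact h1 l hA hl
    · rw [if_neg h1, if_neg, mul_zero]
      intro h2
      refine h1 fun l hA hC => ?_
      rw [← h2 l hC, if_neg hA]
  · intro z _ hz
    rw [localOp_apply, localOp_apply]
    split_ifs with h1 h2
    · refine absurd (funext fun l => ?_) hz
      split_ifs with hA
      · exact h2 l (hAC l hA)
      · exact (h1 l hA).symm
    all_goals simp
  · exact fun h => absurd (Finset.mem_univ _) h

theorem localOp_comm {A C : Finset ι} (h : Disjoint A C)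
    (U : Matrix (↥A → ZMod 2) (↥A → ZMod 2) ℂ) (W : Matrix (↥C → ZMod 2) (↥C → ZMod 2) ℂ) :
    localOp A U * localOp C W = localOp C W * localOp A U := by
  ext x y
  rw [localOp_mul_localOp h, localOp_mul_localOp h.symm, mul_comm]
  simp only [imp.swap]

/-- An operator that acts only on the qubits in `A`. -/
def IsLocal (A : Finset ι) (M : Matrix (ι → ZMod 2) (ι → ZMod 2) ℂ) : Prop :=
  ∃ U, M = localOp A U

namespace IsLocal

variable {A C : Finset ι} {M M' : Matrix (ι → ZMod 2) (ι → ZMod 2) ℂ}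

theorem mul (h : IsLocal A M) (h' : IsLocal A M') : IsLocal A (M * M') := by
  obtain ⟨U, rfl⟩ := h
  obtain ⟨W, rfl⟩ := h'
  exact ⟨U * W, (localOp_mul A U W).symm⟩

theorem add (h : IsLocal A M) (h' : IsLocal A M') : IsLocal A (M + M') := by
  obtain ⟨U, rfl⟩ := h
  obtain ⟨W, rfl⟩ := h'
  exact ⟨U + W, (localOp_add A U W).symm⟩

theorem smul (h : IsLocal A M) (c : ℂ) : IsLocal A (c • M) := by
  obtain ⟨U, rfl⟩ := h
  exact ⟨c • U, (localOp_smul A c U).symm⟩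

theorem neg (h : IsLocal A M) : IsLocal A (-M) := by
  rw [← neg_one_smul ℂ M]; exact h.smul _

theorem sub (h : IsLocal A M) (h' : IsLocal A M') : IsLocal A (M - M') := by
  rw [sub_eq_add_neg]; exact h.add h'.neg

theorem one : IsLocal A (1 : Matrix (ι → ZMod 2) (ι → ZMod 2) ℂ) := ⟨1, (localOp_one A).symm⟩

theorem conjTranspose (h : IsLocal A M) : IsLocal A Mᴴ := by
  obtain ⟨U, rfl⟩ := h
  exact ⟨Uᴴ, localOp_conjTranspose A U⟩

theorem comm (h : IsLocal A M) (h' : IsLocal C M') (hd : Disjoint A C) : M * M' = M' * M := by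
  obtain ⟨U, rfl⟩ := h
  obtain ⟨W, rfl⟩ := h'
  exact localOp_comm hd U W

theorem exists_unitary (h : IsLocal A M) (hM : Mᴴ * M = 1) :
    ∃ U ∈ Matrix.unitaryGroup (↥A → ZMod 2) ℂ, localOp A U = M := by
  obtain ⟨U, rfl⟩ := h
  refine ⟨U, ?_, rfl⟩
  rw [localOp_conjTranspose, ← localOp_mul, ← localOp_one A] at hM
  exact Matrix.mem_unitaryGroup_iff'.2 (localOp_injective A hM)

end IsLocal

theorem pauli_eq_localOp {A : Finset ι} {u v : ι → ZMod 2} (hu : ∀ l, l ∉ A → u l = 0)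
    (hv : ∀ l, l ∉ A → v l = 0) :
    pauli u v = localOp A (pauli (fun l => u l) fun l => v l) := by
  have hs : ∀ y : ι → ZMod 2, v ⬝ᵥ y = (fun l : ↥A => v l) ⬝ᵥ (fun l : ↥A => y l) := fun y => by
    simp only [dotProduct]
    rw [Finset.sum_coe_sort A fun l => v l * y l]
    refine (Finset.sum_subset (Finset.subset_univ A) fun l _ hl => ?_).symm
    rw [hv l hl, zero_mul]
  ext x y
  rw [pauli_apply, localOp_apply, pauli_apply, hs]
  by_cases h : x = y + u
  · rw [if_pos h, if_pos, if_pos]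
    · funext l; rw [h]; rfl
    · intro l hl; rw [h, Pi.add_apply, hu l hl, add_zero]
  · rw [if_neg h]
    split_ifs with h1 h2
    · refine absurd (funext fun l => ?_) h
      by_cases hl : l ∈ A
      · exact congrFun h2 ⟨l, hl⟩
      · rw [h1 l hl, Pi.add_apply, hu l hl, add_zero]
    · rfl
    · rfl

theorem isLocal_pauli {A : Finset ι} {u v : ι → ZMod 2} (hu : ∀ l, l ∉ A → u l = 0)
    (hv : ∀ l, l ∉ A → v l = 0) : IsLocal A (pauli u v) := ⟨_, pauli_eq_localOp hu hv⟩

/-! ### Bilinear Majorana operators -/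

variable {N : ℕ}

/-- A set of consecutive qubits: either before or after every other qubit. -/
def Consecutive (e : Fin N ≃ ι) (A : Finset ι) : Prop :=
  ∀ l, l ∉ A → ∀ k ∈ A, ∀ k' ∈ A, (e.symm l < e.symm k ↔ e.symm l < e.symm k')

theorem jw_add_eq_zero {e : Fin N ≃ ι} {A : Finset ι} (hA : Consecutive e A) {k k' : ι × ZMod 2}
    (hk : k.1 ∈ A) (hk' : k'.1 ∈ A) {l : ι} (hl : l ∉ A) : (jw e k + jw e k') l = 0 := by
  have h1 : l ≠ k.1 := fun h => hl (h ▸ hk)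
  have h2 : l ≠ k'.1 := fun h => hl (h ▸ hk')
  have h3 := hA l hl k.1 hk k'.1 hk'
  rw [Pi.add_apply]
  unfold jw
  simp only [h1, h2, h3, false_and, or_false]
  exact zadd_self _

/-- Outside a set of consecutive qubits the strings of two of its nodes coincide and cancel. -/
theorem isLocal_majorana_mul {e : Fin N ≃ ι} {A : Finset ι} (hA : Consecutive e A)
    {k k' : ι × ZMod 2} (hk : k.1 ∈ A) (hk' : k'.1 ∈ A) :
    IsLocal A (majorana e k * majorana e k') := by
  rw [majorana_eq, majorana_eq, smul_mul_smul_comm, pauli_mul]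
  refine ((isLocal_pauli (fun l hl => ?_) fun l hl => jw_add_eq_zero hA hk hk' hl).smul _).smul _
  have h1 : l ≠ k.1 := fun h => hl (h ▸ hk)
  have h2 : l ≠ k'.1 := fun h => hl (h ▸ hk')
  rw [Pi.add_apply, Pi.single_eq_of_ne h1, Pi.single_eq_of_ne h2, add_zero]

/-- In a product of two swaps the total parities cancel, and only bilinears in the Majorana
operators remain. This is why an even number of swaps acts locally and does not depend on the pivot.
-/
theorem dimerSwap_mul_dimerSwap (e : Fin N ≃ ι) (k l k' l' : ι × ZMod 2) :
    dimerSwap e k l * dimerSwap e k' l' = (-(1 / 2) : ℂ) •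
      (majorana e k * majorana e k' - majorana e k * majorana e l' -
        (majorana e l * majorana e k' - majorana e l * majorana e l')) := by
  have h2 : ((Real.sqrt 2 : ℝ) : ℂ)⁻¹ * ((Real.sqrt 2 : ℝ) : ℂ)⁻¹ = 1 / 2 := by
    rw [← _root_.mul_inv, ← Complex.ofReal_mul, Real.mul_self_sqrt (by norm_num)]; norm_num
  have h3 : (majorana e k - majorana e l) * totalParity =
      -(totalParity * (majorana e k - majorana e l)) := by
    rw [sub_mul, majorana_mul_totalParity, majorana_mul_totalParity, mul_sub]; abel
  rw [dimerSwap_eq, dimerSwap_eq, smul_mul_smul_comm, h2, ← mul_assoc, mul_assoc totalParity, h3,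
    mul_neg, neg_mul, ← mul_assoc, totalParity_sq, one_mul, neg_smul, smul_neg, sub_mul, mul_sub,
    mul_sub]

theorem isLocal_dimerSwap_mul {e : Fin N ≃ ι} {A : Finset ι} (hA : Consecutive e A)
    {k l k' l' : ι × ZMod 2} (hk : k.1 ∈ A) (hl : l.1 ∈ A) (hk' : k'.1 ∈ A) (hl' : l'.1 ∈ A) :
    IsLocal A (dimerSwap e k l * dimerSwap e k' l') := by
  rw [dimerSwap_mul_dimerSwap]
  exact (((isLocal_majorana_mul hA hk hk').sub (isLocal_majorana_mul hA hk hl')).sub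
    ((isLocal_majorana_mul hA hl hk').sub (isLocal_majorana_mul hA hl hl'))).smul _

theorem even_list_induction {α : Type*} {P : List α → Prop} (nil : P [])
    (step : ∀ a b l, P l → P (a :: b :: l)) : ∀ l : List α, Even l.length → P l
  | [], _ => nil
  | [_], h => by simp at h
  | a :: b :: l, h => step a b l (even_list_induction nil step l (by
      simpa [Nat.even_add_one, ← Nat.not_even_iff_odd] using h))

theorem isLocal_swapProd {e : Fin N ≃ ι} {A : Finset ι} (hA : Consecutive e A)
    {S : List ((ι × ZMod 2) × (ι × ZMod 2))} (hS : SwapsIn A S) (he : Even S.length) :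
    IsLocal A (swapProd e S) := by
  revert hS
  refine even_list_induction (P := fun S => SwapsIn A S → IsLocal A (swapProd e S)) ?_ ?_ S he
  · intro _; exact IsLocal.one
  · intro a b l ih hS
    have ha := hS a List.mem_cons_self
    have hb := hS b (List.mem_cons_of_mem _ List.mem_cons_self)
    simp only [swapProd, List.map_cons, List.prod_cons] at ih ⊢
    rw [← mul_assoc]
    exact (isLocal_dimerSwap_mul hA ha.2.1 ha.2.2 hb.2.1 hb.2.2).mul
      (ih fun p hp => hS p (List.mem_cons_of_mem _ (List.mem_cons_of_mem _ hp)))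

/-! ### Moving the pivot -/

/-- The Majorana operators of the qubits in `A` for `e` and `e'` differ by the same string. -/
def SameOrder (e e' : Fin N ≃ ι) (A : Finset ι) (s : ι → ZMod 2) : Prop :=
  (∀ l ∈ A, s l = 0) ∧ ∀ k : ι × ZMod 2, k.1 ∈ A → jw e' k = s + jw e k

namespace SameOrder

variable {e e' : Fin N ≃ ι} {A : Finset ι} {s : ι → ZMod 2}

theorem majorana (h : SameOrder e e' A s) {k : ι × ZMod 2} (hk : k.1 ∈ A) :
    majorana e' k = pauli 0 s * majorana e k := by
  rw [majorana_eq, majorana_eq, mul_smul_comm, pauli_mul, dotProduct_single, h.1 _ hk, zero_mul,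
    sgn_zero, one_smul, zero_add, h.2 k hk]

theorem comm (h : SameOrder e e' A s) {k : ι × ZMod 2} (hk : k.1 ∈ A) :
    HaPPY.majorana e k * pauli 0 s = pauli 0 s * HaPPY.majorana e k := by
  rw [majorana_eq, smul_mul_assoc, mul_smul_comm, pauli_comm, dotProduct_zero, dotProduct_single,
    h.1 _ hk, zero_mul, zero_add, sgn_zero, one_smul]

/-- The string `s` by which the two transformations differ commutes with the Majorana operators on
`A` and squares to one, so it drops out of bilinears. -/
theorem mul (h : SameOrder e e' A s) {k k' : ι × ZMod 2} (hk : k.1 ∈ A) (hk' : k'.1 ∈ A) :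
    HaPPY.majorana e' k * HaPPY.majorana e' k' = HaPPY.majorana e k * HaPPY.majorana e k' := by
  rw [h.majorana hk, h.majorana hk', mul_assoc, ← mul_assoc (HaPPY.majorana e k), h.comm hk,
    ← mul_assoc, ← mul_assoc, pauli_mul_pauli_self, dotProduct_zero, sgn_zero, one_smul, one_mul]

theorem swapProd (h : SameOrder e e' A s) {S : List ((ι × ZMod 2) × (ι × ZMod 2))}
    (hS : SwapsIn A S) (he : Even S.length) : swapProd e' S = HaPPY.swapProd e S := by
  revert hS
  refine even_list_induction
    (P := fun S => SwapsIn A S → HaPPY.swapProd e' S = HaPPY.swapProd e S) ?_ ?_ S he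
  · intro _; rfl
  · intro a b l ih hS
    have ha := hS a List.mem_cons_self
    have hb := hS b (List.mem_cons_of_mem _ List.mem_cons_self)
    have ih := ih fun p hp => hS p (List.mem_cons_of_mem _ (List.mem_cons_of_mem _ hp))
    simp only [HaPPY.swapProd, List.map_cons, List.prod_cons] at ih ⊢
    rw [← mul_assoc, ← mul_assoc, ih, dimerSwap_mul_dimerSwap, dimerSwap_mul_dimerSwap,
      h.mul ha.2.1 hb.2.1, h.mul ha.2.1 hb.2.2, h.mul ha.2.2 hb.2.1, h.mul ha.2.2 hb.2.2]

theorem hasDimer (h : SameOrder e e' A s) {ψ : (ι → ZMod 2) → ℂ} {k l : ι × ZMod 2}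
    (hk : k.1 ∈ A) (hl : l.1 ∈ A) {p : ZMod 2} (hd : HasDimer e ψ k l p) : HasDimer e' ψ k l p := by
  unfold HasDimer at hd ⊢
  rw [h.majorana hk, h.majorana hl, ← mul_smul_comm, ← mul_add, ← Matrix.mulVec_mulVec, hd,
    Matrix.mulVec_zero]

end SameOrder

end

end HaPPY

namespace HaPPY

noncomputable section

set_option linter.unusedSectionVars false

/-! ### Stabilizers and logical operators of the encoding -/

theorem sgn_sum {α : Type*} (s : Finset α) (f : α → ZMod 2) :
    sgn (∑ k ∈ s, f k) = ∏ k ∈ s, sgn (f k) := by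
  classical
  induction s using Finset.induction_on with
  | empty => simp [sgn_zero]
  | insert k s hk ih => rw [Finset.sum_insert hk, Finset.prod_insert hk, sgn_add, ih]

theorem sum_bondLegs_eq_zero {Λ : Finset Tile} (f : Tile × Fin 5 → ZMod 2)
    (hf : ∀ p ∈ bondLegs Λ, f (nbr p.1 p.2, p.2) = f p) : ∑ p ∈ bondLegs Λ, f p = 0 := by
  refine Finset.sum_involution (fun p _ => (nbr p.1 p.2, p.2)) (fun p hp => ?_) (fun p _ _ h => ?_)
    (fun p hp => ?_) (fun p _ => ?_)
  · rw [hf p hp, zadd_self]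
  · have h1 := congrArg (fun q : Tile × Fin 5 => depth q.1) h
    rcases depth_nbr p.1 p.2 with h2 | h2 <;> simp only at h1 <;> omega
  · have := mem_bondLegs.1 hp
    exact mem_bondLegs.2 ⟨this.2, by rw [nbr_nbr]; exact this.1⟩
  · simp

theorem sum_tiles_eq_sum_openLegs {Λ : Finset Tile} (f : Tile × Fin 5 → ZMod 2)
    (hf : ∀ p ∈ bondLegs Λ, f (nbr p.1 p.2, p.2) = f p) :
    ∑ w : ↥Λ, ∑ i, f (w.1, i) = ∑ l : ↥(openLegs Λ), f l.1 := by
  rw [Finset.sum_coe_sort Λ fun w => ∑ i, f (w, i), Finset.sum_coe_sort (openLegs Λ) f,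
    ← Finset.sum_product' (f := fun w i => f (w, i)),
    ← Finset.sum_filter_add_sum_filter_not (Λ ×ˢ Finset.univ) fun p => nbr p.1 p.2 ∈ Λ]
  have := sum_bondLegs_eq_zero f hf
  rw [bondLegs] at this
  rw [this, zero_add]; rfl

/-- Operator pushing. Shifting the leg configuration by `u` respects the bonds because `u` agrees on
both sides of them. For the same reason the signs from `v` occur twice on every bond and cancel,
leaving those of the open legs. -/
theorem pauli_mulVec_encoding {Λ : Finset Tile} {u v : Tile → Fin 5 → ZMod 2} {z : Tile → ZMod 2}
    (ht : ∀ w ∈ Λ, ∀ b y, sgn (v w ⬝ᵥ y) * codeword b y = sgn (z w * b) * codeword b (y + u w))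
    (hm : ∀ w ∈ Λ, ∀ i, nbr w i ∈ Λ → u (nbr w i) i = u w i ∧ v (nbr w i) i = v w i)
    (b : ↥Λ → ZMod 2) :
    pauli (fun l : ↥(openLegs Λ) => u l.1.1 l.1.2) (fun l => v l.1.1 l.1.2) *ᵥ
        (fun x => encoding Λ x b) =
      sgn (∑ w : ↥Λ, z w * b w) • fun x => encoding Λ x b := by
  classical
  funext x
  rw [pauli_act, Pi.smul_apply, smul_eq_mul]
  simp only [encoding, Matrix.of_apply]
  rw [mul_left_comm, mul_left_comm (sgn _)]
  congr 1
  rw [Finset.mul_sum, Finset.mul_sum]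
  let sh : Equiv.Perm (↥Λ → Fin 5 → ZMod 2) :=
    { toFun := fun y w => y w + u w
      invFun := fun y w => y w + u w
      left_inv := fun y => funext fun w => by
        change y w + u w + u w = y w
        rw [add_assoc, fadd_self, add_zero]
      right_inv := fun y => funext fun w => by
        change y w + u w + u w = y w
        rw [add_assoc, fadd_self, add_zero] }
  rw [← Equiv.sum_comp sh fun y => sgn (∑ w : ↥Λ, z w * b w) * ite _ _ _]
  refine Finset.sum_congr rfl fun y _ => ?_
  have hsh : ∀ w, sh y w = y w + u w := fun w => rfl
  have e1 : (∀ (w w' : ↥Λ) (i : Fin 5), nbr w i = w' → sh y w i = sh y w' i) ↔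
      ∀ (w w' : ↥Λ) (i : Fin 5), nbr w i = w' → y w i = y w' i := by
    refine forall₃_congr fun w w' i => imp_congr_right fun h => ?_
    have := (hm w w.2 i (h ▸ w'.2)).1
    rw [h] at this
    rw [hsh, hsh, Pi.add_apply, Pi.add_apply, this, add_left_inj]
  have e2 : (∀ l : ↥(openLegs Λ), ∀ w : ↥Λ, (w : Tile) = l.1.1 → sh y w l.1.2 = x l) ↔
      ∀ l : ↥(openLegs Λ), ∀ w : ↥Λ, (w : Tile) = l.1.1 →
        y w l.1.2 = (x + fun l : ↥(openLegs Λ) => u l.1.1 l.1.2) l := by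
    refine forall₃_congr fun l w h => ?_
    rw [hsh, Pi.add_apply, Pi.add_apply, ← h]
    constructor
    · intro h'; rw [← h', add_assoc, zadd_self, add_zero]
    · intro h'; rw [h', add_assoc, zadd_self, add_zero]
  by_cases hc : (∀ (w w' : ↥Λ) (i : Fin 5), nbr w i = w' → y w i = y w' i) ∧
      ∀ l : ↥(openLegs Λ), ∀ w : ↥Λ, (w : Tile) = l.1.1 →
        y w l.1.2 = (x + fun l : ↥(openLegs Λ) => u l.1.1 l.1.2) l
  · rw [if_pos hc, if_pos ⟨e1.2 hc.1, e2.2 hc.2⟩]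
    have e3 : (fun l : ↥(openLegs Λ) => v l.1.1 l.1.2) ⬝ᵥ
        (x + fun l : ↥(openLegs Λ) => u l.1.1 l.1.2) = ∑ w : ↥Λ, v w ⬝ᵥ y w := by
      let f : Tile × Fin 5 → ZMod 2 := fun p =>
        if h : p.1 ∈ Λ then v p.1 p.2 * y ⟨p.1, h⟩ p.2 else 0
      have hf : ∀ p ∈ bondLegs Λ, f (nbr p.1 p.2, p.2) = f p := fun p hp => by
        have hp := mem_bondLegs.1 hp
        simp only [f]
        rw [dif_pos hp.1, dif_pos hp.2, (hm _ hp.1 _ hp.2).2, hc.1 ⟨p.1, hp.1⟩ ⟨_, hp.2⟩ _ rfl]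
      have h4 := sum_tiles_eq_sum_openLegs f hf
      have h5 : ∀ w : ↥Λ, ∑ i, f (w.1, i) = v w ⬝ᵥ y w := fun w => by
        simp only [f, w.2, dif_pos, dotProduct]
      rw [Finset.sum_congr rfl fun w _ => h5 w] at h4
      rw [h4]
      refine Finset.sum_congr rfl fun l _ => ?_
      have hl := (mem_openLegs.1 l.2).1
      simp only [f]
      rw [dif_pos hl, hc.2 l ⟨_, hl⟩ rfl]
    rw [e3, sgn_sum, sgn_sum, ← Finset.prod_mul_distrib, ← Finset.prod_mul_distrib]
    exact Finset.prod_congr rfl fun w _ => ht w w.2 (b w) (y w)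
  · rw [if_neg hc, if_neg fun h => hc ⟨e1.1 h.1, e2.1 h.2⟩, mul_zero, mul_zero]

/-- The shift part of the strip operator at a tile. -/
def stripX (i : Fin 5) (c : Fin 3) (l : Fin 5) : ZMod 2 :=
  if c = 1 ∧ (l = i - 1 ∨ l = i + 1) then 1 else 0

/-- The phase part of the strip operator at a tile. -/
def stripZ (i : Fin 5) (c : Fin 3) (l : Fin 5) : ZMod 2 := if LegIn i c l then 1 else 0

/-- The bulk qubit is flipped in phase by the strip operator at all tiles in or behind the strip. -/
def stripLogical (c : Fin 3) : ZMod 2 := if c = 2 then 0 else 1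

/-- The three regions give three operators of the five-qubit code: Z on all legs beyond the line, a
string with X on the two side legs and Z on these and the leg `i` in the strip, and the identity.
The first two act on the encoded qubit as a logical Z. -/
theorem codewordSign_strip : ∀ (i : Fin 5) (c : Fin 3) (b : ZMod 2) (y : Fin 5 → ZMod 2),
    (-1) ^ (∑ k, stripZ i c k * y k).val * codewordSign b y =
      (-1) ^ (stripLogical c * b).val * codewordSign b (y + stripX i c) := by
  decide +kernel

theorem codeword_strip (i : Fin 5) (c : Fin 3) (b : ZMod 2) (y : Fin 5 → ZMod 2) :
    sgn (stripZ i c ⬝ᵥ y) * codeword b y =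
      sgn (stripLogical c * b) * codeword b (y + stripX i c) := by
  have h := congrArg (Int.cast : ℤ → ℂ) (codewordSign_strip i c b y)
  push_cast at h
  rw [codeword, codeword, sgn, sgn, dotProduct, ← mul_div_assoc, h, mul_div_assoc]

theorem strip_match : ∀ (i k : Fin 5) (c c' : Fin 3), RegionStep i k c c' →
    stripX i c' k = stripX i c k ∧ stripZ i c' k = stripZ i c k := by
  decide +kernel

open Classical in
/-- The bulk qubits that the strip operator acts on. -/
def stripTiles (w : Tile) (i : Fin 5) (y : Tile) : ZMod 2 := stripLogical (region w i y)

theorem stripTiles_self (w : Tile) (i : Fin 5) : stripTiles w i w = 1 := by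
  rw [stripTiles, region_eq_one.2 (InStrip.refl w i)]; rfl

/-- The tile operators fit together on the bonds by `strip_match`. Of their X factors only those at
the two ends of the strip reach the boundary, and the Z factors are those of the legs behind it. -/
theorem strip_mulVec_encoding {Λ : Finset Tile} (hΛ : IsPatch Λ) {w : Tile} (hw : w ∈ Λ) (i : Fin 5)
    {p q : ↥(openLegs Λ)} (hp : p.1 = stripStart Λ w i) (hq : q.1 = stripEnd Λ w i)
    (b : ↥Λ → ZMod 2) :
    pauli (Pi.single p 1 + Pi.single q 1) (fun l => ind (LegBehind w i l.1)) *ᵥ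
        (fun x => encoding Λ x b) =
      sgn (∑ y : ↥Λ, stripTiles w i y * b y) • fun x => encoding Λ x b := by
  have h := pauli_mulVec_encoding (Λ := Λ) (u := fun y => stripX i (region w i y))
    (v := fun y => stripZ i (region w i y)) (z := stripTiles w i)
    (fun y _ b x => codeword_strip i _ b x)
    (fun y _ k _ => strip_match i k _ _ (regionStep_nbr w i y k)) b
  convert h using 3
  · funext l
    have hd : ∀ a d c : Fin 5, (d = 1 ∨ d = -1) → (a = c - 1 ∨ a = c + 1 ↔ a + d = c ∨ a - d = c) ∧
        ¬ (a + d = c ∧ a - d = c) := by decide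
    have h1 := hd l.1.2 (turn l.1.1) i (turn_eq _)
    have h2 : l = p ↔ InStrip w i l.1.1 ∧ l.1.2 + turn l.1.1 = i := by
      rw [Subtype.ext_iff, hp]; exact eq_stripStart_iff hΛ hw l.2
    have h3 : l = q ↔ InStrip w i l.1.1 ∧ l.1.2 - turn l.1.1 = i := by
      rw [Subtype.ext_iff, hq]; exact eq_stripEnd_iff hΛ hw l.2
    have h4 : region w i l.1.1 = 1 ∧ (l.1.2 = i - 1 ∨ l.1.2 = i + 1) ↔ l = p ∨ l = q := by
      rw [region_eq_one, h2, h3]; tauto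
    have h5 : ¬ (l = p ∧ l = q) := fun h => h1.2 ⟨(h2.1 h.1).2, (h3.1 h.2).2⟩
    rw [Pi.add_apply, Pi.single_apply, Pi.single_apply, stripX, if_congr h4 rfl rfl]
    by_cases ha : l = p
    · rw [if_pos ha, if_neg fun hb => h5 ⟨ha, hb⟩, if_pos (.inl ha), add_zero]
    · by_cases hb : l = q
      · rw [if_neg ha, if_pos hb, if_pos (.inr hb), zero_add]
      · rw [if_neg ha, if_neg hb, if_neg fun h => h.elim ha hb, add_zero]
  · funext l
    by_cases hl : LegBehind w i l.1
    · rw [ind_of hl, stripZ, if_pos (legIn_iff.2 hl)]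
    · rw [ind_of_not hl, stripZ, if_neg fun h => hl (legIn_iff.1 h)]

theorem codewordSign_parity : ∀ (b : ZMod 2) (y : Fin 5 → ZMod 2),
    (-1) ^ (∑ k, 1 * y k).val * codewordSign b y = (-1) ^ b.val * codewordSign b y := by
  decide +kernel

theorem parity_mulVec_encoding {Λ : Finset Tile} (b : ↥Λ → ZMod 2) :
    pauli 0 (fun _ => 1) *ᵥ (fun x => encoding Λ x b) =
      sgn (∑ y : ↥Λ, b y) • fun x => encoding Λ x b := by
  have h := pauli_mulVec_encoding (Λ := Λ) (u := fun _ _ => 0) (v := fun _ _ => 1)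
    (z := fun _ => 1) (fun y _ b x => by
      have h := congrArg (Int.cast : ℤ → ℂ) (codewordSign_parity b x)
      push_cast at h
      rw [show (x + fun _ : Fin 5 => (0 : ZMod 2)) = x from add_zero x, codeword, sgn, sgn,
        dotProduct, ← mul_div_assoc, h, mul_div_assoc, one_mul])
    (fun y _ k _ => ⟨rfl, rfl⟩) b
  simp only [one_mul] at h
  exact h

/-- The dimers of the encoded basis states. -/
theorem exists_hasDimer {Λ : Finset Tile} (hΛ : IsPatch Λ) {N : ℕ} (e : Fin N ≃ ↥(openLegs Λ))
    (he : ∀ k, (e (finRotate N k)).1 = nextLeg Λ (e k).1) (p : ↥(openLegs Λ)) :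
    ∃ (c : ZMod 2) (z : ↥Λ → ZMod 2), ∀ b,
      HasDimer e (fun x => encoding Λ x b) (p, 0) (mate hΛ p, 1) (c + ∑ w, z w * b w) := by
  set q := mate hΛ p
  set w := p.1.1 with hwdef
  have hw : w ∈ Λ := (mem_openLegs.1 p.2).1
  obtain ⟨hp, hq⟩ := mate_eq_stripEnd hΛ p
  set i := p.1.2 + turn p.1.1
  have hnext : ∀ k, nextLeg Λ (e k).1 ∈ openLegs Λ := fun k => he k ▸ (e _).2
  -- The constant `c` tells whether the legs behind the strip form the Jordan-Wigner string of the
  -- two nodes or its complement.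
  obtain ⟨c, hc⟩ := exists_interval (fun k => ind (LegBehind w i (e k).1)) (e.symm p) (e.symm q)
    (fun k => by
      have := ind_nextLeg hw hΛ i (e k).2 (hnext k)
      rw [he, this, ← he, Equiv.eq_symm_apply, Equiv.eq_symm_apply, Subtype.ext_iff,
        Subtype.ext_iff, hp, ← hq])
  have hV : (fun l : ↥(openLegs Λ) => ind (LegBehind w i l.1)) =
      (fun _ => c) + (jw e (p, 0) + jw e (q, 1)) := by
    funext l
    have := hc (e.symm l)
    rw [Equiv.apply_symm_apply] at this
    rw [this]
    have h1 : jw e (p, 0) l = ind (e.symm l < e.symm p) := by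
      unfold jw ind; simp
    have h2 : jw e (q, 1) l = ind (e.symm l ≤ e.symm q) := by
      unfold jw ind
      simp [le_iff_lt_or_eq]
    rw [Pi.add_apply, Pi.add_apply, h1, h2]
  have key : ∃ z : ↥Λ → ZMod 2, ∀ b,
      pauli (Pi.single p 1 + Pi.single q 1) (jw e (p, 0) + jw e (q, 1)) *ᵥ
        (fun x => encoding Λ x b) = sgn (∑ w, z w * b w) • fun x => encoding Λ x b := by
    have hs := strip_mulVec_encoding hΛ hw i hp hq
    rcases zmod_two_cases c with rfl | rfl
    · refine ⟨fun y => stripTiles w i y, fun b => ?_⟩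
      rw [← hs, hV]
      congr 2
      exact (zero_add _).symm
    -- Multiplying by the total parity complements the string; all bulk qubits are added to the
    -- parity.
    · refine ⟨fun y => 1 + stripTiles w i y, fun b => ?_⟩
      have h1 := parity_mulVec_encoding b
      have h2 : pauli (Pi.single p 1 + Pi.single q 1) (jw e (p, 0) + jw e (q, 1)) =
          pauli 0 (fun _ => 1) * pauli (Pi.single p 1 + Pi.single q 1)
            (fun l : ↥(openLegs Λ) => ind (LegBehind w i l.1)) * sgn 0 • 1 := by
        rw [pauli_mul, dotProduct_add, dotProduct_single, dotProduct_single, mul_one, zadd_self,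
          sgn_zero, one_smul, one_smul, mul_one, zero_add, hV, ← add_assoc]
        congr 1
        rw [fadd_self, zero_add]
      rw [h2, sgn_zero, one_smul, mul_one, ← Matrix.mulVec_mulVec, hs, Matrix.mulVec_smul, h1,
        smul_smul, ← sgn_add, ← Finset.sum_add_distrib]
      congr 2
      exact Finset.sum_congr rfl fun y _ => by ring
  obtain ⟨z, hz⟩ := key
  -- The constant part is the sign from ordering the two Pauli strings in the product of the
  -- Majorana operators.
  refine ⟨jw e (p, 0) q, z, fun b => ?_⟩
  rw [hasDimer_iff_mul (fun h => zero_ne_one (congrArg Prod.snd h)), majorana_eq, majorana_eq,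
    smul_mul_smul_comm, pauli_mul, dotProduct_single, mul_one, smul_smul, Matrix.smul_mulVec, hz,
    smul_smul, sgn_add]
  congr 1
  simp only [jwPhase]
  simp [mul_assoc]

end

end HaPPY

namespace HaPPY

noncomputable section

set_option linter.unusedSectionVars false

/-! ### The encoding is normalized -/

/-- The sets of edges of a tile that can lead to tiles closer to the centre. -/
theorem exists_eq_of_adj : ∀ D : Finset (Fin 5), (∀ i ∈ D, ∀ j ∈ D, i ≠ j → Adj i j) →
    D = ∅ ∨ (∃ i, D = {i}) ∨ ∃ i, D = {i, i + 1} := by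
  decide +kernel

/-- The values 16, 8, 4 in the three contractions count the configurations of the right parity with
none, one or two legs fixed. After normalization every fixed leg costs a factor 1/2. -/
theorem codewordSign_contract_one : ∀ (b : ZMod 2) (i : Fin 5) (p p' : ZMod 2),
    ∑ y : Fin 5 → ZMod 2, (if y i = p then codewordSign b y *
      codewordSign b (Function.update y i p') else 0) = if p = p' then 8 else 0 := by
  decide +kernel

theorem codewordSign_contract_two : ∀ (b : ZMod 2) (i : Fin 5) (p q p' q' : ZMod 2),
    ∑ y : Fin 5 → ZMod 2, (if y i = p ∧ y (i + 1) = q then codewordSign b y *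
      codewordSign b (Function.update (Function.update y i p') (i + 1) q') else 0) =
      if p = p' ∧ q = q' then 4 else 0 := by
  decide +kernel

theorem codewordSign_contract_zero : ∀ b : ZMod 2,
    ∑ y : Fin 5 → ZMod 2, codewordSign b y * codewordSign b y = 16 := by
  decide +kernel

/-- The five-qubit code is an isometry from any one leg, or two neighbouring legs, and the bulk
qubit to the other legs. -/
theorem codeword_contract (D : Finset (Fin 5)) (hD : ∀ i ∈ D, ∀ j ∈ D, i ≠ j → Adj i j)
    (b : ZMod 2) (s s' : Fin 5 → ZMod 2) :
    ∑ y : Fin 5 → ZMod 2, (if ∀ i ∈ D, y i = s i then codeword b y *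
      codeword b (fun i => if i ∈ D then s' i else y i) else 0) =
      if ∀ i ∈ D, s i = s' i then (1 / 2 : ℂ) ^ D.card else 0 := by
  have hcw : ∀ (P : (Fin 5 → ZMod 2) → Prop) [DecidablePred P]
      (f : (Fin 5 → ZMod 2) → Fin 5 → ZMod 2),
      ∑ y : Fin 5 → ZMod 2, (if P y then codeword b y * codeword b (f y) else 0) =
        ((∑ y : Fin 5 → ZMod 2,
          if P y then codewordSign b y * codewordSign b (f y) else 0 : ℤ) : ℂ) / 16 := by
    intro P _ f
    rw [Int.cast_sum, Finset.sum_div]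
    refine Finset.sum_congr rfl fun y _ => ?_
    split_ifs
    · rw [codeword, codeword]; push_cast; ring
    · simp
  rcases exists_eq_of_adj D hD with rfl | ⟨i, rfl⟩ | ⟨i, rfl⟩
  · have := hcw (fun _ => True) id
    simp only [if_true, id, codewordSign_contract_zero] at this
    simp [this]
  · have h1 : ∀ y : Fin 5 → ZMod 2, (fun j => if j ∈ ({i} : Finset (Fin 5)) then s' j else y j) =
        Function.update y i (s' i) := fun y => by
      funext j
      by_cases h : j = i
      · subst h; simp
      · simp [h]
    simp only [Finset.mem_singleton, forall_eq, Finset.card_singleton, pow_one] at hcw ⊢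
    have := hcw (fun y => y i = s i) (fun y => Function.update y i (s' i))
    simp only [Finset.mem_singleton] at h1
    simp only [h1]
    rw [this, codewordSign_contract_one]
    split_ifs <;> norm_num
  · have hne : i ≠ i + 1 := by revert i; decide
    have h1 : ∀ y : Fin 5 → ZMod 2,
        (fun j => if j ∈ ({i, i + 1} : Finset (Fin 5)) then s' j else y j) =
        Function.update (Function.update y i (s' i)) (i + 1) (s' (i + 1)) := fun y => by
      funext j
      by_cases h : j = i + 1
      · subst h; simp
      · by_cases h' : j = i
        · subst h'; simp [h]
        · simp [h, h']
    have h2 : ∀ f g : Fin 5 → ZMod 2, (∀ j ∈ ({i, i + 1} : Finset (Fin 5)), f j = g j) ↔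
        f i = g i ∧ f (i + 1) = g (i + 1) := fun f g => by simp
    have := hcw (fun y => y i = s i ∧ y (i + 1) = s (i + 1))
      (fun y => Function.update (Function.update y i (s' i)) (i + 1) (s' (i + 1)))
    rw [codewordSign_contract_two] at this
    simp only [h1, h2, Finset.card_pair hne]
    rw [this]
    split_ifs <;> norm_num

/-! ### Contracting two copies of a network tile by tile. -/

section Network

variable {κ : Type} [Fintype κ] [DecidableEq κ]

/-- Two leg configurations agree on both sides of every bond. -/
def Matches (t : κ → Tile) (y : κ → Fin 5 → ZMod 2) : Prop :=
  ∀ k k' i, nbr (t k) i = t k' → y k i = y k' i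

/-- Two leg configurations agree on the open legs. -/
def AgreeOpen (t : κ → Tile) (y y' : κ → Fin 5 → ZMod 2) : Prop :=
  ∀ k i, (∀ k', nbr (t k) i ≠ t k') → y k i = y' k i

open Classical in
/-- The contraction of two copies of a network along the open legs. -/
def overlap (t : κ → Tile) (b : κ → ZMod 2) : ℂ :=
  ∑ y : κ → Fin 5 → ZMod 2, ∑ y' : κ → Fin 5 → ZMod 2,
    if Matches t y ∧ Matches t y' ∧ AgreeOpen t y y' then
      (∏ k, codeword (b k) (y k)) * ∏ k, codeword (b k) (y' k) else 0

open Classical in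
/-- Twice the number of bonds. -/
def bondCount (t : κ → Tile) : ℕ := ∑ k, ∑ i, if ∃ k', nbr (t k) i = t k' then 1 else 0

variable {t : Option κ → Tile}

theorem nbr_ne (w : Tile) (i : Fin 5) : nbr w i ≠ w := fun h => by
  have := congrArg depth h
  rcases depth_nbr w i with h1 | h1 <;> omega

theorem matches_option (y : Option κ → Fin 5 → ZMod 2) : Matches t y ↔
    Matches (t ∘ some) (y ∘ some) ∧
      ∀ i k, nbr (t none) i = t (some k) → y none i = y (some k) i := by
  constructor
  · exact fun h => ⟨fun k k' i => h _ _ i, fun i k => h _ _ i⟩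
  · rintro ⟨h1, h2⟩ (_ | k) (_ | k') i h
    · rfl
    · exact h2 i k' h
    · exact (h2 i k (by rw [← h, nbr_nbr])).symm
    · exact h1 k k' i h

open Classical in
/-- The legs of the last tile that are contracted with other tiles. -/
def inLegs (t : Option κ → Tile) : Finset (Fin 5) :=
  Finset.univ.filter fun i => ∃ k, nbr (t none) i = t (some k)

theorem mem_inLegs {i : Fin 5} : i ∈ inLegs t ↔ ∃ k, nbr (t none) i = t (some k) := by
  simp [inLegs]

open Classical in
/-- The values that a configuration of the other tiles imposes on the legs of the last tile. -/
def inValue (t : Option κ → Tile) (y : κ → Fin 5 → ZMod 2) (i : Fin 5) : ZMod 2 :=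
  if h : ∃ k, nbr (t none) i = t (some k) then y h.choose i else 0

theorem inValue_eq (ht : Function.Injective t) (y : κ → Fin 5 → ZMod 2) {i : Fin 5} {k : κ}
    (h : nbr (t none) i = t (some k)) : inValue t y i = y k i := by
  have h' : ∃ k, nbr (t none) i = t (some k) := ⟨k, h⟩
  rw [inValue, dif_pos h', Option.some_injective _ (ht (h'.choose_spec.symm.trans h))]

theorem forall_inLegs (ht : Function.Injective t) (y : κ → Fin 5 → ZMod 2) (x : Fin 5 → ZMod 2) :
    (∀ i k, nbr (t none) i = t (some k) → x i = y k i) ↔ ∀ i ∈ inLegs t, x i = inValue t y i := by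
  constructor
  · intro h i hi
    obtain ⟨k, hk⟩ := mem_inLegs.1 hi
    rw [inValue_eq ht y hk]; exact h i k hk
  · intro h i k hk
    rw [← inValue_eq ht y hk]; exact h i (mem_inLegs.2 ⟨k, hk⟩)

/-- Agreement on those legs of the other tiles that are open in the whole network. -/
def AgreeRest (t : Option κ → Tile) (y y' : κ → Fin 5 → ZMod 2) : Prop :=
  ∀ k i, (∀ k', nbr (t (some k)) i ≠ t k') → y k i = y' k i

theorem agreeOpen_option (y y' : Option κ → Fin 5 → ZMod 2) : AgreeOpen t y y' ↔
    AgreeRest t (y ∘ some) (y' ∘ some) ∧ ∀ i, i ∉ inLegs t → y none i = y' none i := by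
  constructor
  · refine fun h => ⟨fun k i => h (some k) i, fun i hi => h none i fun k' hk => ?_⟩
    rcases k' with _ | k'
    · exact nbr_ne _ _ hk
    · exact hi (mem_inLegs.2 ⟨k', hk⟩)
  · rintro ⟨h1, h2⟩ (_ | k) i h
    · exact h2 i fun hi => by
        obtain ⟨k, hk⟩ := mem_inLegs.1 hi
        exact h _ hk
    · exact h1 k i h

theorem agreeRest_and (ht : Function.Injective t) (y y' : κ → Fin 5 → ZMod 2) :
    (AgreeRest t y y' ∧ ∀ i ∈ inLegs t, inValue t y i = inValue t y' i) ↔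
      AgreeOpen (t ∘ some) y y' := by
  constructor
  · rintro ⟨h1, h2⟩ k i h
    by_cases h3 : nbr (t (some k)) i = t none
    · have h4 : nbr (t none) i = t (some k) := by rw [← h3, nbr_nbr]
      rw [← inValue_eq ht y h4, ← inValue_eq ht y' h4]
      exact h2 i (mem_inLegs.2 ⟨k, h4⟩)
    · refine h1 k i fun k' => ?_
      rcases k' with _ | k'
      · exact h3
      · exact h k'
  · refine fun h => ⟨fun k i h' => h k i fun k' => h' (some k'), fun i hi => ?_⟩
    obtain ⟨k, hk⟩ := mem_inLegs.1 hi
    rw [inValue_eq ht y hk, inValue_eq ht y' hk]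
    refine h k i fun k' h' => ?_
    have h5 : nbr (t (some k)) i = t none := by rw [← hk, nbr_nbr]
    exact Option.some_ne_none k' (ht (h'.symm.trans h5))

open Classical in
-- Agreement on the free legs determines `x'` from `x` and the imposed values, so the double sum
-- collapses to the contraction in `codeword_contract`.
theorem sum_last_tile
    (hD : ∀ i ∈ inLegs t, ∀ j ∈ inLegs t, i ≠ j → Adj i j) (b : ZMod 2)
    (y y' : κ → Fin 5 → ZMod 2) :
    ∑ x : Fin 5 → ZMod 2, ∑ x' : Fin 5 → ZMod 2,
      (if (∀ i ∈ inLegs t, x i = inValue t y i) ∧ (∀ i ∈ inLegs t, x' i = inValue t y' i) ∧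
        ∀ i, i ∉ inLegs t → x i = x' i then codeword b x * codeword b x' else 0) =
      if ∀ i ∈ inLegs t, inValue t y i = inValue t y' i then (1 / 2 : ℂ) ^ (inLegs t).card
        else 0 := by
  rw [← codeword_contract (inLegs t) hD b]
  refine Finset.sum_congr rfl fun x _ => ?_
  rw [Finset.sum_eq_single fun i => if i ∈ inLegs t then inValue t y' i else x i]
  · refine if_congr ⟨fun h => h.1, fun h => ⟨h, fun i hi => if_pos hi, fun i hi => (if_neg hi).symm⟩⟩
      rfl rfl
  · intro x' _ hx'
    rw [if_neg]
    rintro ⟨-, h2, h3⟩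
    refine hx' (funext fun i => ?_)
    split_ifs with hi
    · exact h2 i hi
    · exact (h3 i hi).symm
  · exact fun h => absurd (Finset.mem_univ _) h

theorem sum_option {β M : Type*} [Fintype β] [Fintype (κ → β)] [Fintype (Option κ → β)]
    [AddCommMonoid M] (f : (Option κ → β) → M) :
    ∑ y, f y = ∑ y : κ → β, ∑ x : β, f fun k => k.elim x y := by
  rw [Finset.sum_comm, ← Fintype.sum_prod_type' (f := fun x y => f fun k => Option.elim k x y)]
  refine (Fintype.sum_equiv (Equiv.piOptionEquivProd (α := κ) (β := fun _ => β)).symm _ _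
    fun p => congrArg f (funext fun k => ?_)).symm
  cases k <;> rfl

/-- Contracting the last tile forces the values that the two copies impose on its inner legs to
coincide. This is agreement on the legs that become open when the tile is removed. -/
theorem overlap_option (ht : Function.Injective t)
    (hD : ∀ i ∈ inLegs t, ∀ j ∈ inLegs t, i ≠ j → Adj i j) (b : Option κ → ZMod 2) :
    overlap t b = (1 / 2 : ℂ) ^ (inLegs t).card * overlap (t ∘ some) (b ∘ some) := by
  classical
  unfold overlap
  rw [sum_option, Finset.mul_sum]
  refine Finset.sum_congr rfl fun y _ => ?_
  rw [Finset.sum_congr rfl fun x _ => sum_option (fun y' : Option κ → Fin 5 → ZMod 2 => ite _ _ _),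
    Finset.sum_comm, Finset.mul_sum]
  refine Finset.sum_congr rfl fun y' _ => ?_
  have key : ∀ x x' : Fin 5 → ZMod 2,
      (Matches t (fun k => k.elim x y) ∧ Matches t (fun k => k.elim x' y') ∧
        AgreeOpen t (fun k => k.elim x y) (fun k => k.elim x' y')) ↔
      ((Matches (t ∘ some) y ∧ Matches (t ∘ some) y' ∧ AgreeRest t y y') ∧
        ((∀ i ∈ inLegs t, x i = inValue t y i) ∧ (∀ i ∈ inLegs t, x' i = inValue t y' i) ∧
        ∀ i, i ∉ inLegs t → x i = x' i)) := fun x x' => by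
    rw [matches_option, matches_option, agreeOpen_option, ← forall_inLegs ht y,
      ← forall_inLegs ht y']
    simp only [Option.elim, Function.comp_def]
    tauto
  simp only [key]
  simp only [Fintype.prod_option, Option.elim]
  by_cases h : Matches (t ∘ some) y ∧ Matches (t ∘ some) y' ∧ AgreeRest t y y'
  · have h1 : (Matches (t ∘ some) y ∧ Matches (t ∘ some) y' ∧ AgreeOpen (t ∘ some) y y') ↔
        ∀ i ∈ inLegs t, inValue t y i = inValue t y' i := by
      rw [← agreeRest_and ht]; tauto
    rw [if_congr h1 rfl rfl]
    simp only [h, true_and]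
    have h2 := sum_last_tile hD (b none) y y'
    have h3 : ∀ (P : Prop) [Decidable P] (a a' c c' : ℂ),
        (if P then a * c * (a' * c') else 0) = (if P then a * a' else 0) * (c * c') := by
      intro P _ a a' c c'
      split_ifs
      · ring
      · simp
    simp only [h3, ← Finset.sum_mul]
    refine (congrArg (· * ((∏ k, codeword (b (some k)) (y k)) *
      ∏ k, codeword (b (some k)) (y' k))) (Eq.trans ?_ h2)).trans ?_
    · congr!
    · simp only [Function.comp_apply]
      split_ifs <;> simp
  · have h1 : ¬ (Matches (t ∘ some) y ∧ Matches (t ∘ some) y' ∧ AgreeOpen (t ∘ some) y y') := by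
      rw [← agreeRest_and ht]; tauto
    simp [h, h1]

theorem bondCount_option (ht : Function.Injective t) :
    bondCount t = bondCount (t ∘ some) + 2 * (inLegs t).card := by
  classical
  unfold bondCount
  rw [Fintype.sum_option]
  have h1 : ∑ i, (if ∃ k', nbr (t none) i = t k' then 1 else 0) = (inLegs t).card := by
    rw [inLegs, Finset.card_filter]
    refine Finset.sum_congr rfl fun i _ => if_congr ?_ rfl rfl
    rw [Option.exists]
    exact or_iff_right (nbr_ne _ _)
  have h2 : ∀ k i, (if ∃ k', nbr (t (some k)) i = t k' then 1 else 0) =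
      (if ∃ k', nbr ((t ∘ some) k) i = (t ∘ some) k' then 1 else 0) +
        if nbr (t none) i = t (some k) then 1 else 0 := fun k i => by
    have e : nbr (t (some k)) i = t none ↔ nbr (t none) i = t (some k) :=
      ⟨fun h => by rw [← h, nbr_nbr], fun h => by rw [← h, nbr_nbr]⟩
    rw [if_congr Option.exists rfl rfl, if_congr (or_congr_left e) rfl rfl]
    by_cases h3 : nbr (t none) i = t (some k)
    · rw [if_pos (.inl h3), if_pos h3, if_neg]
      rintro ⟨k', hk'⟩
      exact Option.some_ne_none k' (ht (hk'.symm.trans (e.2 h3)))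
    · rw [if_neg h3, add_zero]
      exact if_congr (or_iff_right h3) rfl rfl
  have h4 : ∑ k : κ, ∑ i, (if nbr (t none) i = t (some k) then 1 else 0) = (inLegs t).card := by
    rw [Finset.sum_comm, inLegs, Finset.card_filter]
    refine Finset.sum_congr rfl fun i _ => ?_
    by_cases h : ∃ k, nbr (t none) i = t (some k)
    · obtain ⟨k, hk⟩ := h
      rw [if_pos ⟨k, hk⟩, Finset.sum_eq_single k, if_pos hk]
      · intro k' _ hne
        rw [if_neg]
        intro hk'
        exact hne (Option.some_injective _ (ht (hk'.symm.trans hk)))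
      · exact fun h => absurd (Finset.mem_univ _) h
    · rw [if_neg h]
      exact Finset.sum_eq_zero fun k _ => if_neg fun hk => h ⟨k, hk⟩
  rw [h1]
  simp only [h2, Finset.sum_add_distrib]
  rw [h4]; ring

theorem overlap_equiv {κ' : Type} [Fintype κ'] [DecidableEq κ'] (σ : κ' ≃ κ) (t : κ → Tile) (b : κ → ZMod 2) :
    overlap (t ∘ σ) (b ∘ σ) = overlap t b ∧ bondCount (t ∘ σ) = bondCount t := by
  classical
  constructor
  · unfold overlap
    refine (Fintype.sum_equiv (Equiv.arrowCongr σ (Equiv.refl _)) _ _ fun y => ?_)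
    refine (Fintype.sum_equiv (Equiv.arrowCongr σ (Equiv.refl _)) _ _ fun y' => ?_)
    have e : ∀ (y : κ' → Fin 5 → ZMod 2) k, (Equiv.arrowCongr σ (Equiv.refl _)) y (σ k) = y k := by
      intro y k; simp
    refine if_congr (and_congr ?_ (and_congr ?_ ?_)) ?_ rfl
    · unfold Matches
      rw [← σ.forall_congr_right]
      refine forall_congr' fun k => ?_
      rw [← σ.forall_congr_right]
      simp only [e]; rfl
    · unfold Matches
      rw [← σ.forall_congr_right]
      refine forall_congr' fun k => ?_
      rw [← σ.forall_congr_right]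
      simp only [e]; rfl
    · unfold AgreeOpen
      rw [← σ.forall_congr_right]
      refine forall_congr' fun k => ?_
      simp only [e]
      refine forall_congr' fun i => ?_
      rw [← σ.forall_congr_right]; rfl
    · rw [← Equiv.prod_comp σ fun k => codeword (b k) (Equiv.arrowCongr σ (Equiv.refl _) y k),
        ← Equiv.prod_comp σ fun k => codeword (b k) (Equiv.arrowCongr σ (Equiv.refl _) y' k)]
      simp only [e]; rfl
  · unfold bondCount
    rw [← Equiv.sum_comp σ]
    refine Finset.sum_congr rfl fun k _ => Finset.sum_congr rfl fun i _ => if_congr ?_ rfl rfl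
    rw [← σ.exists_congr_right]; rfl

/-- A network on a set of tiles that is closed under moving towards the centre has norm one. -/
theorem exists_overlap_eq : ∀ (n : ℕ) (κ : Type) [Fintype κ] [DecidableEq κ] (t : κ → Tile), Fintype.card κ = n →
    Function.Injective t →
    (∀ k i, depth (nbr (t k) i) < depth (t k) → ∃ k', nbr (t k) i = t k') → ∀ b : κ → ZMod 2,
    ∃ d : ℕ, bondCount t = 2 * d ∧ overlap t b = (1 / 2 : ℂ) ^ d := by
  classical
  intro n
  induction n with
  | zero =>
    intro κ _ _ t hn _ _ b
    have : IsEmpty κ := Fintype.card_eq_zero_iff.1 hn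
    refine ⟨0, by simp [bondCount], ?_⟩
    unfold overlap
    simp [Matches, AgreeOpen]
  | succ n ih =>
    intro κ _ _ t hn ht hd b
    have : Nonempty κ := Fintype.card_pos_iff.1 (by omega)
    -- Remove a deepest tile. All its bonds lead towards the centre, so its contracted legs are
    -- pairwise adjacent, and the remaining tiles are still closed under moving inwards.
    obtain ⟨k₀, hk₀⟩ := Finite.exists_max fun k => depth (t k)
    let σ : Option {k // k ≠ k₀} ≃ κ := Equiv.optionSubtypeNe k₀
    obtain ⟨h1, h2⟩ := overlap_equiv σ t b
    have ht' : Function.Injective (t ∘ σ) := ht.comp σ.injective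
    have hσ : ∀ k, σ (some k) = k.1 := fun k => by simp [σ]
    have hσ0 : σ none = k₀ := by simp [σ]
    have hleg : ∀ i ∈ inLegs (t ∘ σ), height (t k₀) i < 0 := fun i hi => by
      obtain ⟨k, hk⟩ := mem_inLegs.1 hi
      simp only [Function.comp_apply, hσ0] at hk
      rw [← depth_nbr_lt_iff]
      have : depth (t (σ (some k))) ≤ depth (t k₀) := hk₀ _
      rw [← hk] at this
      rcases depth_nbr (t k₀) i with h | h <;> omega
    have hadj : ∀ i ∈ inLegs (t ∘ σ), ∀ j ∈ inLegs (t ∘ σ), i ≠ j → Adj i j :=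
      fun i hi j hj hij => adj_of_height_neg hij (hleg i hi) (hleg j hj)
    have hcard : Fintype.card {k // k ≠ k₀} = n := by
      have := Fintype.card_congr σ
      rw [Fintype.card_option] at this
      omega
    obtain ⟨d, h3, h4⟩ := ih {k // k ≠ k₀} ((t ∘ σ) ∘ some) hcard
      (ht'.comp (Option.some_injective _)) (fun k i hki => by
        simp only [Function.comp_apply, hσ] at hki ⊢
        obtain ⟨k', hk'⟩ := hd k.1 i hki
        refine ⟨⟨k', ?_⟩, hk'⟩
        rintro rfl
        have : depth (t k.1) ≤ depth (t k') := hk₀ k.1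
        rw [hk'] at hki
        omega) ((b ∘ σ) ∘ some)
    refine ⟨d + (inLegs (t ∘ σ)).card, ?_, ?_⟩
    · rw [← h2, bondCount_option ht', h3]; ring
    · rw [← h1, overlap_option ht' hadj, h4, ← pow_add, add_comm]

end Network

theorem star_codeword (b : ZMod 2) (x : Fin 5 → ZMod 2) : star (codeword b x) = codeword b x := by
  simp [codeword]

/-- The amplitudes are real, so the squared norm is the contraction of two copies. There the two
factors `√2` of a bond compensate the factor 1/2 from contracting it. -/
theorem encoding_norm {Λ : Finset Tile} (hΛ : IsPatch Λ) (b : ↥Λ → ZMod 2) :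
    ∑ x, ‖encoding Λ x b‖ ^ 2 = 1 := by
  classical
  obtain ⟨d, hd, ho⟩ := exists_overlap_eq _ ↥Λ (fun w => w.1) rfl Subtype.val_injective
    (fun w i h => ⟨⟨_, hΛ.2 w.1 w.2 i h⟩, rfl⟩) b
  have hbond : (bondLegs Λ).card = 2 * d := by
    rw [← hd, bondCount, bondLegs, Finset.card_filter, Finset.sum_product,
      ← Finset.sum_coe_sort Λ]
    refine Finset.sum_congr rfl fun w _ => Finset.sum_congr rfl fun i _ => if_congr ?_ rfl rfl
    exact ⟨fun h => ⟨⟨_, h⟩, rfl⟩, fun ⟨k, hk⟩ => hk ▸ k.2⟩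
  let f : (↥Λ → Fin 5 → ZMod 2) → (↥(openLegs Λ) → ZMod 2) := fun y l =>
    y ⟨l.1.1, (mem_openLegs.1 l.2).1⟩ l.1.2
  have hV : ∀ x, encoding Λ x b = ((Real.sqrt 2 : ℝ) : ℂ) ^ d *
      ∑ y : ↥Λ → Fin 5 → ZMod 2, if Matches (fun w : ↥Λ => w.1) y ∧ x = f y then
        ∏ w, codeword (b w) (y w) else 0 := by
    intro x
    simp only [encoding, Matrix.of_apply, hbond, Nat.mul_div_cancel_left d two_pos]
    congr 1
    refine Finset.sum_congr rfl fun y _ => if_congr (and_congr Iff.rfl ?_) rfl rfl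
    constructor
    · exact fun h => funext fun l => (h l ⟨_, (mem_openLegs.1 l.2).1⟩ rfl).symm
    · rintro rfl l w h
      rw [show w = ⟨l.1.1, (mem_openLegs.1 l.2).1⟩ from Subtype.ext h]
  have hagree : ∀ y y', AgreeOpen (fun w : ↥Λ => w.1) y y' ↔ f y = f y' := by
    intro y y'
    constructor
    · exact fun h => funext fun l => h _ _ fun k' hk' => (mem_openLegs.1 l.2).2 (hk' ▸ k'.2)
    · intro h k i hk
      exact congrFun h ⟨(k.1, i), mem_openLegs.2 ⟨k.2, fun h' => hk ⟨_, h'⟩ rfl⟩⟩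
  have hstar : ∀ x, star (encoding Λ x b) = encoding Λ x b := by
    intro x
    rw [hV, star_mul', star_pow, star_sum]
    congr 1
    · simp
    · refine Finset.sum_congr rfl fun y _ => ?_
      split_ifs
      · rw [star_prod]
        exact Finset.prod_congr rfl fun w _ => star_codeword _ _
      · simp
  have hsq : ((∑ x, ‖encoding Λ x b‖ ^ 2 : ℝ) : ℂ) = ∑ x, encoding Λ x b * encoding Λ x b := by
    push_cast
    refine Finset.sum_congr rfl fun x _ => ?_
    nth_rewrite 3 [← hstar x]
    rw [← Complex.mul_conj']; rfl
  have h2 : ((Real.sqrt 2 : ℝ) : ℂ) ^ d * ((Real.sqrt 2 : ℝ) : ℂ) ^ d = 2 ^ d := by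
    rw [← mul_pow, ← Complex.ofReal_mul, Real.mul_self_sqrt (by norm_num)]; norm_num
  have hfin : ∑ x, encoding Λ x b * encoding Λ x b = 2 ^ d * overlap (fun w : ↥Λ => w.1) b := by
    simp only [hV]
    simp only [mul_mul_mul_comm _ _ (((Real.sqrt 2 : ℝ) : ℂ) ^ d), h2]
    rw [← Finset.mul_sum, overlap]
    congr 1
    simp only [Finset.sum_mul_sum]
    rw [Finset.sum_comm]
    refine Finset.sum_congr rfl fun y _ => ?_
    rw [Finset.sum_comm]
    refine Finset.sum_congr rfl fun y' _ => ?_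
    rw [Finset.sum_eq_single (f y)]
    · simp only [hagree, and_true]
      by_cases h1 : Matches (fun w : ↥Λ => w.1) y <;>
        by_cases h2 : Matches (fun w : ↥Λ => w.1) y' <;> by_cases h3 : f y = f y' <;>
        simp [h1, h2, h3]
    · intro x _ hx
      simp [hx]
    · exact fun h => absurd (Finset.mem_univ _) h
  rw [ho, ← mul_pow] at hfin
  norm_num at hfin
  rw [hfin] at hsq
  exact_mod_cast hsq

end

end HaPPY

namespace HaPPY

noncomputable section

set_option linter.unusedSectionVars false

/-! ### Recoverable algebras -/

section Recovery

variable {ι : Type} [Fintype ι] [DecidableEq ι] {β : Type} [Fintype β] [DecidableEq β]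
  {V : Matrix (ι → ZMod 2) (β → ZMod 2) ℂ} {a c : Finset β} {A C : Finset ι}

/-- The encoded basis states. -/
def col (V : Matrix (ι → ZMod 2) (β → ZMod 2) ℂ) (b : β → ZMod 2) : (ι → ZMod 2) → ℂ :=
  fun x => V x b

/-- The operator recovers the matrix unit `|i'⟩⟨i|`. Recoverability is used only through these
operators, which flip or test bulk qubits from the boundary. -/
theorem Recoverable.exists_single (h : Recoverable V a A) (i i' : ↥a → ZMod 2) :
    ∃ M, IsLocal A M ∧ ∀ b, M *ᵥ col V b = if (fun l : ↥a => b l) = i then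
      col V (glue a i' fun l => b l) else 0 := by
  obtain ⟨f, -, hf⟩ := h
  refine ⟨localOp A (f (Matrix.single i' i 1)), ⟨_, rfl⟩, fun b => ?_⟩
  have h1 := congrArg (fun M => M *ᵥ Pi.single b 1) (hf (Matrix.single i' i 1))
  simp only [← Matrix.mulVec_mulVec] at h1
  have h2 : V *ᵥ Pi.single b 1 = col V b := by
    funext x; simp [col]
  rw [h2] at h1
  rw [h1]
  have h3 : localOp a (Matrix.single i' i (1 : ℂ)) *ᵥ Pi.single b 1 =
      if (fun l : ↥a => b l) = i then Pi.single (glue a i' fun l => b l) 1 else 0 := by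
    funext x
    rw [Matrix.mulVec_single_one, Matrix.col_apply, localOp_apply, Matrix.single_apply]
    by_cases hb : (fun l : ↥a => b l) = i
    · rw [if_pos hb, Pi.single_apply]
      by_cases hx : x = glue a i' fun l => b l
      · have h4 : ∀ l, l ∉ a → x l = b l := fun l hl => by rw [hx, glue_not_mem _ _ hl]
        have h5 : i' = fun l : ↥a => x l := funext fun l => by rw [hx, glue_mem _ _ l.2]
        rw [if_pos h4, if_pos ⟨h5, hb.symm⟩, if_pos hx]
      · rw [if_neg hx]
        split_ifs with h4 h5
        · refine absurd ?_ hx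
          rw [← glue_restrict a x, h5.1]
          congr 1
          exact funext fun l => h4 l (Finset.mem_compl.1 l.2)
        · rfl
        · rfl
    · rw [if_neg hb]
      split_ifs with h4 h5
      · exact absurd h5.2.symm hb
      · rfl
      · rfl
  rw [h3]
  split_ifs
  · funext x; simp [col]
  · exact Matrix.mulVec_zero V

theorem Recoverable.exists_transfer (h : Recoverable V a A) {b b' : β → ZMod 2}
    (hb : ∀ l, l ∉ a → b l = b' l) : ∃ M, IsLocal A M ∧ M *ᵥ col V b = col V b' := by
  obtain ⟨M, hM, h1⟩ := h.exists_single (fun l => b l) (fun l => b' l)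
  refine ⟨M, hM, ?_⟩
  rw [h1, if_pos rfl]
  congr 1
  conv_rhs => rw [← glue_restrict a b']
  congr 1
  exact funext fun l => hb l (Finset.mem_compl.1 l.2)

theorem Recoverable.exists_separate (h : Recoverable V a A) {b b' : β → ZMod 2} {l : β} (hl : l ∈ a)
    (hb : b l ≠ b' l) : ∃ M, IsLocal A M ∧ M *ᵥ col V b = col V b ∧ M *ᵥ col V b' = 0 := by
  obtain ⟨M, hM, h1⟩ := h.exists_single (fun l => b l) (fun l => b l)
  refine ⟨M, hM, ?_, ?_⟩
  · rw [h1, if_pos rfl, glue_restrict]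
  · rw [h1, if_neg]
    exact fun h => hb (congrFun h ⟨l, hl⟩).symm

/-- Operators on `A` do not distinguish bulk states that differ on qubits recoverable elsewhere. -/
theorem Recoverable.eigenvalue_eq (h : Recoverable V c C) (hd : Disjoint A C)
    {M : Matrix (ι → ZMod 2) (ι → ZMod 2) ℂ} (hM : IsLocal A M) {b b' : β → ZMod 2}
    (hb : ∀ l, l ∉ c → b l = b' l) {r r' : ℂ} (h1 : M *ᵥ col V b = r • col V b)
    (h2 : M *ᵥ col V b' = r' • col V b') (h0 : col V b' ≠ 0) : r = r' := by
  obtain ⟨T, hT, hTb⟩ := h.exists_transfer hb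
  have h3 : M *ᵥ col V b' = r • col V b' := by
    rw [← hTb, Matrix.mulVec_mulVec, hM.comm hT hd, ← Matrix.mulVec_mulVec, h1, Matrix.mulVec_smul]
  rw [h2] at h3
  exact (smul_left_injective ℂ h0 h3).symm

/-- Operators elsewhere do not change bulk qubits that are recoverable from `A`. -/
theorem Recoverable.eq_zero_of_mulVec (h : Recoverable V a A) (hd : Disjoint A C)
    {Q : Matrix (ι → ZMod 2) (ι → ZMod 2) ℂ} (hQ : IsLocal C Q) {b b' : β → ZMod 2} {l : β}
    (hl : l ∈ a) (hb : b l ≠ b' l) {r : ℂ} (h1 : Q *ᵥ col V b = r • col V b')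
    (h0 : col V b' ≠ 0) : r = 0 := by
  obtain ⟨M, hM, h2, h3⟩ := h.exists_separate hl hb
  have h4 : r • col V b' = 0 := by
    rw [← h1, ← h2, Matrix.mulVec_mulVec, ← hM.comm hQ hd, ← Matrix.mulVec_mulVec, h1,
      Matrix.mulVec_smul, h3, smul_zero]
  exact (smul_eq_zero.1 h4).resolve_right h0

theorem col_ne_zero (hV : ∀ b, ∑ x, ‖V x b‖ ^ 2 = 1) (b : β → ZMod 2) : col V b ≠ 0 := fun h => by
  have h1 := hV b
  have h2 : ∀ x, V x b = 0 := fun x => congrFun h x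
  simp [h2] at h1

end Recovery

/-! ### From complementary recovery to a two-colouring of the patch. -/

/-- The strip operator acts on `A`, and its eigenvalue changes when the qubit of `w` is flipped. If
an operator on `C` could flip this qubit, it would commute with the strip operator and preserve the
eigenvalue. -/
theorem notMem_of_legBehind {Λ : Finset Tile} (hΛ : IsPatch Λ) {c : Finset ↥Λ}
    {A C : Finset ↥(openLegs Λ)} (hd : Disjoint A C) (hrec : Recoverable (encoding Λ) c C) {w : ↥Λ}
    {i : Fin 5} (h : ∀ p : ↥(openLegs Λ), LegBehind w i p.1 → p ∈ A) : w ∉ c := by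
  intro hw
  have hs := stripStart_spec hΛ w.2 i
  have he := stripEnd_spec hΛ w.2 i
  have key := strip_mulVec_encoding hΛ w.2 i (p := ⟨_, hs.1⟩) (q := ⟨_, he.1⟩) rfl rfl
  have hsA := h ⟨_, hs.1⟩ (legBehind_rayEnd hΛ w.2 (opp_turn w i).symm).1
  have heA := h ⟨_, he.1⟩ (legBehind_rayEnd hΛ w.2 (opp_turn w i)).1
  have hM : IsLocal A (pauli (Pi.single (⟨_, hs.1⟩ : ↥(openLegs Λ)) 1 + Pi.single ⟨_, he.1⟩ 1)
      (fun l => ind (LegBehind w i l.1))) := by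
    refine isLocal_pauli (fun l hl => ?_) fun l hl => ind_of_not fun h' => hl (h l h')
    have h1 : l ≠ ⟨_, hs.1⟩ := fun h => hl (h ▸ hsA)
    have h2 : l ≠ ⟨_, he.1⟩ := fun h => hl (h ▸ heA)
    rw [Pi.add_apply, Pi.single_eq_of_ne h1, Pi.single_eq_of_ne h2, add_zero]
  have h1 := hrec.eigenvalue_eq hd hM (b := 0) (b' := Pi.single w 1)
    (fun l hl => by rw [Pi.single_eq_of_ne (fun h : l = w => hl (h.symm ▸ hw)), Pi.zero_apply]) (key _) (key _)
    (col_ne_zero (encoding_norm hΛ) _)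
  have h2 := sgn_injective h1
  simp [stripTiles_self, Pi.single_apply] at h2

theorem mem_initialSegment {ι : Type} [Fintype ι] {N : ℕ} (e : Fin N ≃ ι) (m : ℕ) (l : ι) :
    l ∈ initialSegment e m ↔ (e.symm l : ℕ) < m := by
  simp [initialSegment]

theorem mem_map_subtype {α : Type*} {s : Finset α} {t : Finset ↥s} {x : α} (hx : x ∈ s) :
    x ∈ t.map (Function.Embedding.subtype _) ↔ (⟨x, hx⟩ : ↥s) ∈ t := by
  simp [hx]

/-- Complementary recovery for an interval of the boundary colours the network. -/
theorem colouring_of_recovery {Λ : Finset Tile} (hΛ : IsPatch Λ) {N : ℕ}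
    (e : Fin N ≃ ↥(openLegs Λ)) (he : ∀ k, (e (finRotate N k)).1 = nextLeg Λ (e k).1) (m : ℕ)
    (a : Finset ↥Λ) (hrec : ComplementaryRecovery (encoding Λ) a (initialSegment e m)) :
    Colouring Λ (fun p => p ∈ (initialSegment e m).map (Function.Embedding.subtype _))
      (fun w => w ∈ a.map (Function.Embedding.subtype _)) := by
  have hnext : ∀ p ∈ openLegs Λ, nextLeg Λ p ∈ openLegs Λ := fun p hp => by
    have := he (e.symm ⟨p, hp⟩)
    rw [Equiv.apply_symm_apply] at this
    exact this ▸ (e _).2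
  have hL : ∀ k, (e k).1 ∈ (initialSegment e m).map (Function.Embedding.subtype _) ↔
      (k : ℕ) < m := fun k => by
    rw [mem_map_subtype (e k).2, mem_initialSegment, Subtype.coe_eta, Equiv.symm_apply_apply]
  have hex : ∀ p ∈ openLegs Λ, ∃ k, (e k).1 = p := fun p hp =>
    ⟨e.symm ⟨p, hp⟩, by rw [Equiv.apply_symm_apply]⟩
  have hwalk : ∀ w ∈ Λ, ∀ i s t, (e s).1 = stripStart Λ w i → (e t).1 = stripEnd Λ w i → ∀ k,
      ind (LegBehind w i (e (finRotate N k)).1) + ind (LegBehind w i (e k).1) =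
        ind (finRotate N k = s) + ind (k = t) := by
    intro w hw i s t hs ht k
    rw [he, ind_nextLeg hw hΛ i (e k).2 (hnext _ (e k).2), ← he, ← hs, ← ht, ← Subtype.ext_iff,
      ← Subtype.ext_iff, e.apply_eq_iff_eq, e.apply_eq_iff_eq]
  refine ⟨hnext, ?_, ?_, ?_, ?_, ?_, ?_⟩
  · intro w hw i C hC z hz hIz hCz
    obtain ⟨s, hs⟩ := hex _ (stripStart_spec hΛ hw i).1
    obtain ⟨t, ht⟩ := hex _ (stripEnd_spec hΛ hw i).1
    obtain ⟨k, rfl⟩ := hex z hz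
    obtain ⟨k', h1, h2, h3, h4⟩ := exists_step_of_start (I := fun k => LegBehind w i (e k).1)
      (hwalk w hw i s t hs ht)
      (by rw [hs]; exact (legBehind_rayEnd hΛ hw (opp_turn w i).symm).1)
      (by rw [ht]; exact (legBehind_rayEnd hΛ hw (opp_turn w i)).1)
      (C := fun k => C (e k).1) (by rw [hs]; exact hC) hIz hCz
    rw [he] at h2 h4
    exact ⟨_, (e k').2, h1, h2, h3, h4⟩
  · intro w hw i C hC z hz hIz hCz
    obtain ⟨s, hs⟩ := hex _ (stripStart_spec hΛ hw i).1
    obtain ⟨t, ht⟩ := hex _ (stripEnd_spec hΛ hw i).1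
    obtain ⟨k, rfl⟩ := hex z hz
    obtain ⟨k', h1, h2, h3, h4⟩ := exists_step_of_end (I := fun k => LegBehind w i (e k).1)
      (hwalk w hw i s t hs ht)
      (by rw [hs]; exact (legBehind_rayEnd hΛ hw (opp_turn w i).symm).1)
      (by rw [ht]; exact (legBehind_rayEnd hΛ hw (opp_turn w i)).1)
      (C := fun k => C (e k).1) (by rw [ht]; exact hC) hIz hCz
    rw [he] at h2 h4
    exact ⟨_, (e k').2, h1, h2, h3, h4⟩
  · intro p hp q hq h1 h2 h3 h4
    obtain ⟨k, rfl⟩ := hex p hp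
    obtain ⟨k', rfl⟩ := hex q hq
    rw [← he, hL] at h2 h4
    rw [hL] at h1 h3
    have e1 := finRotate_leave h1 h2
    have e2 := finRotate_leave h3 h4
    rw [Fin.ext (show (k : ℕ) = k' by omega)]
  · intro p hp q hq h1 h2 h3 h4
    obtain ⟨k, rfl⟩ := hex p hp
    obtain ⟨k', rfl⟩ := hex q hq
    rw [← he, hL] at h2 h4
    rw [hL] at h1 h3
    have e1 := finRotate_enter h1 h2
    have e2 := finRotate_enter h3 h4
    rw [Fin.ext (show (k : ℕ) = k' by omega)]
  · intro w hw i h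
    rw [mem_map_subtype hw]
    by_contra hne
    exact notMem_of_legBehind hΛ disjoint_compl_right hrec.2 (w := ⟨w, hw⟩) (i := i)
      (fun p hp => (mem_map_subtype p.2).1 (h p.1 p.2 hp)) (Finset.mem_compl.2 hne)
  · intro w hw i h
    rw [mem_map_subtype hw]
    exact notMem_of_legBehind hΛ disjoint_compl_left hrec.1 (w := ⟨w, hw⟩) (i := i)
      (fun p hp => Finset.mem_compl.2 fun hA => h p.1 p.2 hp ((mem_map_subtype p.2).2 hA))

end

end HaPPY

namespace HaPPY

noncomputable section

set_option linter.unusedSectionVars false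

/-! ### Even permutations of nodes as products of swaps -/

/-- A node of a subsystem as a node of the whole system. -/
def upNode {ι X : Type} (φ : X → ι) (n : X × ZMod 2) : ι × ZMod 2 := (φ n.1, n.2)

theorem upNode_injective {ι X : Type} {φ : X → ι} (hφ : Function.Injective φ) :
    Function.Injective (upNode φ) := fun _ _ h =>
  Prod.ext (hφ (Prod.ext_iff.1 h).1) (Prod.ext_iff.1 h).2

/-- One swap is used for each transposition, so the parity of the number of swaps is the sign of the
permutation. -/
theorem exists_swaps {ι : Type} [DecidableEq ι] (A : Finset ι) (f : Equiv.Perm (↥A × ZMod 2)) :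
    ∃ S : List ((ι × ZMod 2) × (ι × ZMod 2)), SwapsIn A S ∧
      (∀ n, nodePerm S (upNode Subtype.val n) = upNode Subtype.val (f n)) ∧
      (∀ n : ι × ZMod 2, n.1 ∉ A → nodePerm S n = n) ∧ (-1) ^ S.length = Equiv.Perm.sign f := by
  have hinj : Function.Injective (upNode (Subtype.val : ↥A → ι)) :=
    upNode_injective Subtype.val_injective
  refine Equiv.Perm.swap_induction_on f ⟨[], ?_, ?_, ?_, ?_⟩ ?_
  · intro p hp; simp at hp
  · intro n; rfl
  · intro n _; rfl
  · simp
  · rintro f x y hxy ⟨S, h1, h2, h3, h4⟩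
    refine ⟨(upNode Subtype.val x, upNode Subtype.val y) :: S, ?_, ?_, ?_, ?_⟩
    · intro p hp
      rcases List.mem_cons.1 hp with rfl | hp
      · exact ⟨fun h => hxy (hinj h), x.1.2, y.1.2⟩
      · exact h1 p hp
    · intro n
      have : nodePerm ((upNode Subtype.val x, upNode Subtype.val y) :: S)
          (upNode Subtype.val n) = Equiv.swap (upNode Subtype.val x) (upNode Subtype.val y)
            (nodePerm S (upNode Subtype.val n)) := rfl
      rw [this, h2, hinj.swap_apply]; rfl
    · intro n hn
      have : nodePerm ((upNode Subtype.val x, upNode Subtype.val y) :: S) n =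
        Equiv.swap (upNode Subtype.val x) (upNode Subtype.val y) (nodePerm S n) := rfl
      rw [this, h3 n hn, Equiv.swap_apply_of_ne_of_ne]
      · rintro rfl; exact hn x.1.2
      · rintro rfl; exact hn y.1.2
    · rw [List.length_cons, pow_succ, h4, Equiv.Perm.sign_mul, Equiv.Perm.sign_swap hxy, mul_comm]

theorem exists_even_swaps {ι : Type} [DecidableEq ι] (A : Finset ι)
    {f : Equiv.Perm (↥A × ZMod 2)} (hf : Equiv.Perm.sign f = 1) :
    ∃ S : List ((ι × ZMod 2) × (ι × ZMod 2)), SwapsIn A S ∧ Even S.length ∧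
      (∀ n, nodePerm S (upNode Subtype.val n) = upNode Subtype.val (f n)) ∧
      (∀ n : ι × ZMod 2, n.1 ∉ A → nodePerm S n = n) := by
  obtain ⟨S, h1, h2, h3, h4⟩ := exists_swaps A f
  refine ⟨S, h1, ?_, h2, h3⟩
  rw [hf] at h4
  by_contra h
  rw [(Nat.not_even_iff_odd.1 h).neg_one_pow] at h4
  exact absurd h4 (by decide)

/-! ### Arranging the dimers of two halves of a system -/

/-- The permutation that exchanges the two nodes of a qubit. -/
def flipNode {X : Type} [DecidableEq X] (k : X) : Equiv.Perm (X × ZMod 2) :=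
  Equiv.swap (k, 0) (k, 1)

theorem flipNode_self {X : Type} [DecidableEq X] (k : X) (c : ZMod 2) :
    flipNode k (k, c) = (k, c + 1) := by
  rcases zmod_two_cases c with rfl | rfl
  · exact Equiv.swap_apply_left _ _
  · exact Equiv.swap_apply_right _ _

theorem flipNode_of_ne {X : Type} [DecidableEq X] {k l : X} (h : l ≠ k) (c : ZMod 2) :
    flipNode k (l, c) = (l, c) :=
  Equiv.swap_apply_of_ne_of_ne (fun h' => h (congrArg Prod.fst h'))
    fun h' => h (congrArg Prod.fst h')

theorem sign_flipNode {X : Type} [DecidableEq X] [Fintype X] (k : X) :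
    Equiv.Perm.sign (flipNode k) = -1 :=
  Equiv.Perm.sign_swap fun h => zero_ne_one (congrArg Prod.snd h)

section Arranged

variable {ι X Y L L' R : Type} [DecidableEq X] [DecidableEq Y] [Fintype X] [Fintype Y]

/-- The nodes are moved such that, with respect to the pairing `M` of the nodes, local qubits carry
the two nodes of a pair, and the two nodes of a link in one half are paired with those in the other
half. -/
structure Arranged (M : ι × ZMod 2 → ι × ZMod 2) (φ : X → ι) (ψ : Y → ι) (P : L ⊕ R ≃ X)
    (Q : L' ⊕ R ≃ Y) (f : Equiv.Perm (X × ZMod 2)) (g : Equiv.Perm (Y × ZMod 2)) : Prop where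
  left : ∀ d, M (upNode φ (f.symm (P (.inl d), 0))) = upNode φ (f.symm (P (.inl d), 1))
  right : ∀ d, M (upNode ψ (g.symm (Q (.inl d), 0))) = upNode ψ (g.symm (Q (.inl d), 1))
  cross : ∀ r c, M (upNode φ (f.symm (P (.inr r), c))) = upNode ψ (g.symm (Q (.inr r), c + 1))

namespace Arranged

variable {M : ι × ZMod 2 → ι × ZMod 2} {φ : X → ι} {ψ : Y → ι} {P : L ⊕ R ≃ X} {Q : L' ⊕ R ≃ Y}
  {f : Equiv.Perm (X × ZMod 2)} {g : Equiv.Perm (Y × ZMod 2)}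

theorem symm (h : Arranged M φ ψ P Q f g) (hM : Function.Involutive M) :
    Arranged M ψ φ Q P g f where
  left := h.right
  right := h.left
  cross r c := by
    have := congrArg M (h.cross r (c + 1))
    rw [hM, add_assoc, zadd_self, add_zero] at this
    exact this.symm

theorem flip_local (h : Arranged M φ ψ P Q f g) (hM : Function.Involutive M) (d : L) :
    Arranged M φ ψ P Q (flipNode (P (.inl d)) * f) g where
  left d' := by
    have e : ∀ n, (flipNode (P (.inl d)) * f).symm n = f.symm (flipNode (P (.inl d)) n) :=
      fun n => rfl
    rw [e, e]
    by_cases hd : d' = d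
    · subst hd
      rw [flipNode_self, flipNode_self, zero_add, zadd_self, ← h.left, hM]
    · have : P (.inl d') ≠ P (.inl d) := fun h' => hd (Sum.inl_injective (P.injective h'))
      rw [flipNode_of_ne this, flipNode_of_ne this, h.left]
  right := h.right
  cross r c := by
    have e : ∀ n, (flipNode (P (.inl d)) * f).symm n = f.symm (flipNode (P (.inl d)) n) :=
      fun n => rfl
    rw [e, flipNode_of_ne (fun h' => Sum.inr_ne_inl (P.injective h')), h.cross]

theorem flip_link (h : Arranged M φ ψ P Q f g) (r : R) :
    Arranged M φ ψ P Q (flipNode (P (.inr r)) * f) (flipNode (Q (.inr r)) * g) := by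
  have e : ∀ n, (flipNode (P (.inr r)) * f).symm n = f.symm (flipNode (P (.inr r)) n) :=
    fun n => rfl
  have e' : ∀ n, (flipNode (Q (.inr r)) * g).symm n = g.symm (flipNode (Q (.inr r)) n) :=
    fun n => rfl
  refine ⟨fun d => ?_, fun d => ?_, fun r' c => ?_⟩
  · have : P (.inl d) ≠ P (.inr r) := fun h' => Sum.inl_ne_inr (P.injective h')
    rw [e, e, flipNode_of_ne this, flipNode_of_ne this, h.left]
  · have : Q (.inl d) ≠ Q (.inr r) := fun h' => Sum.inl_ne_inr (Q.injective h')
    rw [e', e', flipNode_of_ne this, flipNode_of_ne this, h.right]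
  · rw [e, e']
    by_cases hr : r' = r
    · subst hr
      rw [flipNode_self, flipNode_self, h.cross]
    · rw [flipNode_of_ne fun h' => hr (Sum.inr_injective (P.injective h')),
        flipNode_of_ne fun h' => hr (Sum.inr_injective (Q.injective h')), h.cross]

/-- Exchanging the two nodes of a local qubit flips one sign, and doing so at both qubits of a link
flips both. The sign of `g` is corrected first, by whichever is available; with neither, there are
no nodes and the sign is already one. The local qubit `d` then corrects `f` alone. -/
theorem exists_even_aux (h : Arranged M φ ψ P Q f g) (hM : Function.Involutive M) (d : L) :
    ∃ f g, Arranged M φ ψ P Q f g ∧ Equiv.Perm.sign f = 1 ∧ Equiv.Perm.sign g = 1 := by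
  have hg : ∃ f g, Arranged M φ ψ P Q f g ∧ Equiv.Perm.sign g = 1 := by
    rcases Int.units_eq_one_or (Equiv.Perm.sign g) with hs | hs
    · exact ⟨f, g, h, hs⟩
    by_cases hL : Nonempty L'
    · obtain ⟨d'⟩ := hL
      refine ⟨f, _, ((h.symm hM).flip_local hM d').symm hM, ?_⟩
      rw [Equiv.Perm.sign_mul, sign_flipNode, hs]; rfl
    by_cases hR : Nonempty R
    · obtain ⟨r⟩ := hR
      refine ⟨_, _, h.flip_link r, ?_⟩
      rw [Equiv.Perm.sign_mul, sign_flipNode, hs]; rfl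
    · have : IsEmpty Y := ⟨fun y => by
        rcases Q.symm y with d' | r
        exacts [hL ⟨d'⟩, hR ⟨r⟩]⟩
      rw [Subsingleton.elim g 1, Equiv.Perm.sign_one] at hs
      exact absurd hs (by decide)
  obtain ⟨f, g, h, hs⟩ := hg
  rcases Int.units_eq_one_or (Equiv.Perm.sign f) with hf | hf
  · exact ⟨f, g, h, hf, hs⟩
  · refine ⟨_, g, h.flip_local hM d, ?_, hs⟩
    rw [Equiv.Perm.sign_mul, sign_flipNode, hf]; rfl

theorem exists_even (h : Arranged M φ ψ P Q f g) (hM : Function.Involutive M)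
    (hL : Nonempty (L ⊕ L')) :
    ∃ f g, Arranged M φ ψ P Q f g ∧ Equiv.Perm.sign f = 1 ∧ Equiv.Perm.sign g = 1 := by
  obtain ⟨d | d⟩ := hL
  · exact h.exists_even_aux hM d
  · obtain ⟨g, f, h', h1, h2⟩ := (h.symm hM).exists_even_aux hM d
    exact ⟨f, g, h'.symm hM, h2, h1⟩

end Arranged

end Arranged

/-- The pairing of the nodes of an oriented pairing of the qubits. -/
def pairing {ι : Type} (μ : Equiv.Perm ι) (n : ι × ZMod 2) : ι × ZMod 2 :=
  if n.2 = 0 then (μ n.1, 1) else (μ.symm n.1, 0)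

theorem pairing_zero {ι : Type} (μ : Equiv.Perm ι) (p : ι) : pairing μ (p, 0) = (μ p, 1) := rfl

theorem pairing_one {ι : Type} (μ : Equiv.Perm ι) (p : ι) : pairing μ (p, 1) = (μ.symm p, 0) := rfl

theorem pairing_involutive {ι : Type} (μ : Equiv.Perm ι) : Function.Involutive (pairing μ) := by
  rintro ⟨p, c⟩
  rcases zmod_two_cases c with rfl | rfl
  · rw [pairing_zero, pairing_one, Equiv.symm_apply_apply]
  · rw [pairing_one, pairing_zero, Equiv.apply_symm_apply]

theorem pairing_ne {ι : Type} (μ : Equiv.Perm ι) (n : ι × ZMod 2) : n ≠ pairing μ n := by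
  obtain ⟨p, c⟩ := n
  rcases zmod_two_cases c with rfl | rfl
  · exact fun h => zero_ne_one (congrArg Prod.snd h)
  · exact fun h => one_ne_zero (congrArg Prod.snd h)

/-! ### Listing the nodes of one half by the pairs to which they belong. -/

section Nodes

variable {ι : Type} [Fintype ι] [DecidableEq ι] {R : Type}

/-- The pairs inside a subsystem. -/
abbrev InnerPair (μ : Equiv.Perm ι) (C : Finset ι) : Type := {p : ι // p ∈ C ∧ μ p ∈ C}

/-- The nodes of a subsystem in terms of the pairs of nodes inside it and the pairs that lead out of
it. -/
def nodeOf {μ : Equiv.Perm ι} {C : Finset ι} (out : R → {p // p ∈ C ∧ μ p ∉ C})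
    (inn : R → {p // p ∉ C ∧ μ p ∈ C}) (n : (InnerPair μ C ⊕ R) × ZMod 2) : ↥C × ZMod 2 :=
  if n.2 = 0 then (n.1.elim (fun d => ⟨d.1, d.2.1⟩) (fun r => ⟨(out r).1, (out r).2.1⟩), 0)
  else (n.1.elim (fun d => ⟨μ d.1, d.2.2⟩) (fun r => ⟨μ (inn r).1, (inn r).2.2⟩), 1)

theorem nodeOf_bijective {μ : Equiv.Perm ι} {C : Finset ι} {out : R → {p // p ∈ C ∧ μ p ∉ C}}
    {inn : R → {p // p ∉ C ∧ μ p ∈ C}} (ho : Function.Bijective out)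
    (hi : Function.Bijective inn) : Function.Bijective (nodeOf out inn) := by
  have e0 : ∀ k, nodeOf out inn (k, 0) =
    (k.elim (fun d => ⟨d.1, d.2.1⟩) (fun r => ⟨(out r).1, (out r).2.1⟩), 0) := fun k => rfl
  have e1 : ∀ k, nodeOf out inn (k, 1) =
    (k.elim (fun d => ⟨μ d.1, d.2.2⟩) (fun r => ⟨μ (inn r).1, (inn r).2.2⟩), 1) := fun k => rfl
  constructor
  · rintro ⟨k, c⟩ ⟨k', c'⟩ h
    rcases zmod_two_cases c with rfl | rfl <;> rcases zmod_two_cases c' with rfl | rfl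
    · rw [e0, e0] at h
      have h := congrArg (fun n : ↥C × ZMod 2 => n.1.1) h
      rcases k with d | r <;> rcases k' with d' | r' <;> simp only [Sum.elim_inl, Sum.elim_inr] at h
      · rw [Subtype.ext h]
      · exact absurd d.2.2 (h ▸ (out r').2.2)
      · exact absurd d'.2.2 (h ▸ (out r).2.2)
      · rw [ho.1 (Subtype.ext h)]
    · rw [e0, e1] at h
      exact absurd (congrArg Prod.snd h) zero_ne_one
    · rw [e0, e1] at h
      exact absurd (congrArg Prod.snd h) one_ne_zero
    · rw [e1, e1] at h
      have h := congrArg (fun n : ↥C × ZMod 2 => n.1.1) h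
      rcases k with d | r <;> rcases k' with d' | r' <;>
        simp only [Sum.elim_inl, Sum.elim_inr] at h <;> have h := μ.injective h
      · rw [Subtype.ext h]
      · exact absurd d.2.1 (h ▸ (inn r').2.1)
      · exact absurd d'.2.1 (h ▸ (inn r).2.1)
      · rw [hi.1 (Subtype.ext h)]
  · rintro ⟨p, c⟩
    rcases zmod_two_cases c with rfl | rfl
    · by_cases h : μ p ∈ C
      · exact ⟨(.inl ⟨p, p.2, h⟩, 0), rfl⟩
      · obtain ⟨r, hr⟩ := ho.2 ⟨p, p.2, h⟩
        exact ⟨(.inr r, 0), by rw [e0, Sum.elim_inr, Prod.mk.injEq]; exact ⟨by simp [hr], rfl⟩⟩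
    · by_cases h : μ.symm p ∈ C
      · exact ⟨(.inl ⟨μ.symm p, h, by rw [Equiv.apply_symm_apply]; exact p.2⟩, 1), by
          rw [e1]; simp⟩
      · obtain ⟨r, hr⟩ := hi.2 ⟨μ.symm p, h, by rw [Equiv.apply_symm_apply]; exact p.2⟩
        exact ⟨(.inr r, 1), by rw [e1]; simp [hr]⟩

/-- The nodes of the two halves can be arranged such that the qubits in given places are local, and
the others are linked in a given way. -/
theorem exists_arranged (μ : Equiv.Perm ι) (A : Finset ι)
    {out : R → {p // p ∈ A ∧ μ p ∉ A}} (ho : Function.Bijective out)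
    {inn : R → {p // p ∉ A ∧ μ p ∈ A}} (hi : Function.Bijective inn)
    (P : InnerPair μ A ⊕ R ≃ ↥A) (Q : InnerPair μ Aᶜ ⊕ R ≃ ↥Aᶜ) :
    ∃ f g, Arranged (pairing μ) (Subtype.val : ↥A → ι) (Subtype.val : ↥Aᶜ → ι) P Q f g := by
  -- Seen from the complement, the pairs leading out and those leading in exchange their roles, so
  -- that each link is one pair in each direction.
  let out' : R → {p // p ∈ Aᶜ ∧ μ p ∉ Aᶜ} := fun r =>
    ⟨(inn r).1, Finset.mem_compl.2 (inn r).2.1, fun h => Finset.mem_compl.1 h (inn r).2.2⟩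
  let inn' : R → {p // p ∉ Aᶜ ∧ μ p ∈ Aᶜ} := fun r =>
    ⟨(out r).1, fun h => Finset.mem_compl.1 h (out r).2.1, Finset.mem_compl.2 (out r).2.2⟩
  have ho' : Function.Bijective out' := by
    constructor
    · exact fun r r' h => hi.1 (by have h3 := Subtype.ext_iff.1 h; exact Subtype.ext h3)
    · rintro ⟨p, h1, h2⟩
      obtain ⟨r, hr⟩ := hi.2 ⟨p, Finset.mem_compl.1 h1, by simpa using h2⟩
      exact ⟨r, by have h3 := Subtype.ext_iff.1 hr; exact Subtype.ext h3⟩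
  have hi' : Function.Bijective inn' := by
    constructor
    · exact fun r r' h => ho.1 (by have h3 := Subtype.ext_iff.1 h; exact Subtype.ext h3)
    · rintro ⟨p, h1, h2⟩
      obtain ⟨r, hr⟩ := ho.2 ⟨p, by simpa using h1, Finset.mem_compl.1 h2⟩
      exact ⟨r, by have h3 := Subtype.ext_iff.1 hr; exact Subtype.ext h3⟩
  let F := Equiv.ofBijective _ (nodeOf_bijective ho hi)
  let G := Equiv.ofBijective _ (nodeOf_bijective ho' hi')
  refine ⟨F.symm.trans (P.prodCongr (Equiv.refl _)), G.symm.trans (Q.prodCongr (Equiv.refl _)), ?_⟩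
  have eF : ∀ k c, (F.symm.trans (P.prodCongr (Equiv.refl _))).symm (P k, c) =
      nodeOf out inn (k, c) := fun k c => by
    rw [Equiv.symm_apply_eq]
    change _ = (P.prodCongr (Equiv.refl _)) (F.symm (F (k, c)))
    rw [Equiv.symm_apply_apply]; rfl
  have eG : ∀ k c, (G.symm.trans (Q.prodCongr (Equiv.refl _))).symm (Q k, c) =
      nodeOf out' inn' (k, c) := fun k c => by
    rw [Equiv.symm_apply_eq]
    change _ = (Q.prodCongr (Equiv.refl _)) (G.symm (G (k, c)))
    rw [Equiv.symm_apply_apply]; rfl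
  refine ⟨fun d => ?_, fun d => ?_, fun r c => ?_⟩
  · rw [eF, eF]; rfl
  · rw [eG, eG]; rfl
  · rw [eF, eG]
    rcases zmod_two_cases c with rfl | rfl
    · rfl
    · rw [zadd_self]
      change pairing μ (μ (inn r).1, 1) = ((inn r).1, 0)
      rw [pairing_one, Equiv.symm_apply_apply]

end Nodes

end

end HaPPY

namespace HaPPY

noncomputable section

set_option linter.unusedSectionVars false

/-! ### Products of basis states and Bell pairs -/

variable {ι L R : Type} [Fintype ι] [DecidableEq ι] [Fintype L] [Fintype R]
  [DecidableEq R]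

/-- `ψ` is an eigenvector of `M` with eigenvalue `(-1) ^ s`. -/
def Eig (M : Matrix (ι → ZMod 2) (ι → ZMod 2) ℂ) (ψ : (ι → ZMod 2) → ℂ) (s : ZMod 2) : Prop :=
  M *ᵥ ψ = sgn s • ψ

theorem Eig.mul {M M' : Matrix (ι → ZMod 2) (ι → ZMod 2) ℂ} {ψ : (ι → ZMod 2) → ℂ} {s s' : ZMod 2}
    (h : Eig M ψ s) (h' : Eig M' ψ s') : Eig (M * M') ψ (s + s') := by
  unfold Eig at *
  rw [← Matrix.mulVec_mulVec, h', Matrix.mulVec_smul, h, smul_smul, sgn_add, mul_comm]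

theorem Eig.smul_sgn {M : Matrix (ι → ZMod 2) (ι → ZMod 2) ℂ} {ψ : (ι → ZMod 2) → ℂ} {s t : ZMod 2}
    (h : Eig (sgn t • M) ψ s) : Eig M ψ (t + s) := by
  unfold Eig at *
  rw [sgn_add, ← smul_smul, ← h, Matrix.smul_mulVec, smul_smul, sgn_mul_self, one_smul]

theorem Eig.pauli_mulVec {u v : ι → ZMod 2} {ψ : (ι → ZMod 2) → ℂ} {s : ZMod 2}
    (h : Eig (pauli u v) ψ s) (u' v' : ι → ZMod 2) :
    Eig (pauli u v) (pauli u' v' *ᵥ ψ) (v ⬝ᵥ u' + v' ⬝ᵥ u + s) := by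
  unfold Eig at *
  rw [Matrix.mulVec_mulVec, pauli_comm, Matrix.smul_mulVec, ← Matrix.mulVec_mulVec, h,
    Matrix.mulVec_smul, smul_smul, ← sgn_add]

/-- The product of the state `|0⋯0⟩` of some qubits and of Bell pairs of the others. -/
def modelState (P : L ⊕ (R ⊕ R) ≃ ι) (x : ι → ZMod 2) : ℂ :=
  (if ∀ l, x (P (.inl l)) = 0 then 1 else 0) *
    ∏ r, bell (x (P (.inr (.inl r)))) (x (P (.inr (.inr r))))

/-- The configurations in the support of the model state. -/
def modelPoint (P : L ⊕ (R ⊕ R) ≃ ι) (s : R → ZMod 2) (k : ι) : ZMod 2 :=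
  (P.symm k).elim 0 (Sum.elim s s)

section Model

variable {P : L ⊕ (R ⊕ R) ≃ ι}

theorem modelPoint_local (s : R → ZMod 2) (l : L) : modelPoint P s (P (.inl l)) = 0 := by
  simp [modelPoint]

theorem modelPoint_left (s : R → ZMod 2) (r : R) : modelPoint P s (P (.inr (.inl r))) = s r := by
  simp [modelPoint]

theorem modelPoint_right (s : R → ZMod 2) (r : R) : modelPoint P s (P (.inr (.inr r))) = s r := by
  simp [modelPoint]

theorem eq_modelPoint {x : ι → ZMod 2} (h1 : ∀ l, x (P (.inl l)) = 0)
    (h2 : ∀ r, x (P (.inr (.inl r))) = x (P (.inr (.inr r)))) :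
    modelPoint P (fun r => x (P (.inr (.inl r)))) = x := by
  funext k
  obtain ⟨k, rfl⟩ := P.surjective k
  rcases k with l | r | r
  · rw [modelPoint_local, h1]
  · rw [modelPoint_left]
  · rw [modelPoint_right, h2]

theorem modelState_modelPoint (s : R → ZMod 2) :
    modelState P (modelPoint P s) = ((Real.sqrt 2 : ℝ) : ℂ)⁻¹ ^ Fintype.card R := by
  simp [modelState, modelPoint_local, modelPoint_left, modelPoint_right, bell]

theorem eq_modelPoint_of_ne_zero {x : ι → ZMod 2} (h : modelState P x ≠ 0) :
    modelPoint P (fun r => x (P (.inr (.inl r)))) = x := by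
  unfold modelState at h
  refine eq_modelPoint ?_ ?_
  · by_contra h1
    rw [if_neg h1, zero_mul] at h
    exact h rfl
  · intro r
    by_contra h1
    refine h (mul_eq_zero_of_right _ (Finset.prod_eq_zero (Finset.mem_univ r) ?_))
    rw [bell, if_neg h1]

theorem modelState_norm : ∑ x, ‖modelState P x‖ ^ 2 = 1 := by
  classical
  have hinj : Function.Injective (modelPoint P) := fun s s' h => funext fun r => by
    rw [← modelPoint_left (P := P) s r, h, modelPoint_left]
  rw [← Finset.sum_subset (Finset.subset_univ (Finset.univ.image (modelPoint P)))]
  · rw [Finset.sum_image fun s _ s' _ h => hinj h]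
    have h2 : (‖((Real.sqrt 2 : ℝ) : ℂ)⁻¹‖) ^ 2 = 1 / 2 := by
      rw [norm_inv, Complex.norm_real, Real.norm_of_nonneg (Real.sqrt_nonneg 2), inv_pow,
        Real.sq_sqrt (by norm_num)]; norm_num
    simp only [modelState_modelPoint, norm_pow]
    rw [Finset.sum_const, Finset.card_univ, ← pow_mul, mul_comm _ 2, pow_mul, h2, nsmul_eq_mul,
      Fintype.card_fun, ZMod.card]
    push_cast
    rw [← mul_pow]; norm_num
  · intro x _ hx
    by_contra h
    refine hx (Finset.mem_image.2 ⟨_, Finset.mem_univ _, eq_modelPoint_of_ne_zero (P := P) ?_⟩)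
    intro h0
    rw [h0] at h
    simp at h

/-- The two qubits of a link. -/
def linkPair (P : L ⊕ (R ⊕ R) ≃ ι) (r : R) : ι → ZMod 2 :=
  Pi.single (P (.inr (.inl r))) 1 + Pi.single (P (.inr (.inr r))) 1

theorem dotProduct_linkPair (x : ι → ZMod 2) (r : R) :
    x ⬝ᵥ linkPair P r = x (P (.inr (.inl r))) + x (P (.inr (.inr r))) := by
  rw [linkPair, dotProduct_add, dotProduct_single, dotProduct_single, mul_one, mul_one]

theorem modelPoint_add (s : R → ZMod 2) (r : R) :
    modelPoint P (s + Pi.single r 1) = modelPoint P s + linkPair P r := by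
  funext k
  obtain ⟨k, rfl⟩ := P.surjective k
  rw [Pi.add_apply, linkPair, Pi.add_apply]
  rcases k with l | r' | r'
  · rw [modelPoint_local, modelPoint_local, Pi.single_eq_of_ne (by simp), Pi.single_eq_of_ne (by simp)]
    simp
  · rw [modelPoint_left, modelPoint_left, Pi.add_apply, Pi.single_eq_of_ne (i := P (.inr (.inr r)))
      (by simp), add_zero]
    congr 1
    simp [Pi.single_apply]
  · rw [modelPoint_right, modelPoint_right, Pi.add_apply,
      Pi.single_eq_of_ne (i := P (.inr (.inl r))) (by simp), zero_add]
    congr 1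
    simp [Pi.single_apply]

/-- The Z and ZZ conditions confine the support to the configurations `modelPoint P s`, and the XX
conditions make the amplitude the same on all of them. -/
theorem exists_eq_smul_modelState {ψ : (ι → ZMod 2) → ℂ}
    (hZ : ∀ l, Eig (pauli 0 (Pi.single (P (.inl l)) 1)) ψ 0)
    (hZZ : ∀ r, Eig (pauli 0 (linkPair P r)) ψ 0) (hXX : ∀ r, Eig (pauli (linkPair P r) 0) ψ 0) :
    ∃ c : ℂ, ψ = c • modelState P := by
  have hpt : ∀ s, ψ (modelPoint P s) = ψ (modelPoint P 0) := by
    have hstep : ∀ s r, ψ (modelPoint P (s + Pi.single r 1)) = ψ (modelPoint P s) := by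
      intro s r
      have := congrFun (hXX r) (modelPoint P s)
      rw [pauli_act, zero_dotProduct, sgn_zero, one_mul, one_smul] at this
      rw [modelPoint_add, this]
    have key : ∀ F : Finset R, ∀ s : R → ZMod 2, (∀ r, r ∉ F → s r = 0) →
        ψ (modelPoint P s) = ψ (modelPoint P 0) := by
      intro F
      induction F using Finset.induction_on with
      | empty =>
        intro s hs
        rw [show s = 0 from funext fun r => hs r (Finset.notMem_empty r)]
      | insert r F hr ih =>
        intro s hs
        rcases zmod_two_cases (s r) with h0 | h1
        · refine ih s fun r' hr' => ?_
          by_cases h : r' = r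
          · rw [h, h0]
          · exact hs r' (by simp [h, hr'])
        · rw [← hstep s r]
          refine ih _ fun r' hr' => ?_
          by_cases h : r' = r
          · rw [h, Pi.add_apply, h1, Pi.single_eq_same, zadd_self]
          · rw [Pi.add_apply, Pi.single_eq_of_ne h, add_zero]
            exact hs r' (by simp [h, hr'])
    exact fun s => key Finset.univ s fun r hr => absurd (Finset.mem_univ r) hr
  have hzero : ∀ (v x : ι → ZMod 2), Eig (pauli 0 v) ψ 0 → ψ x ≠ 0 → v ⬝ᵥ x = 0 := by
    intro v x h hx
    have := congrFun h x
    rw [pauli_act, add_zero, Pi.smul_apply, smul_eq_mul] at this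
    exact sgn_injective (mul_right_cancel₀ hx this)
  refine ⟨ψ (modelPoint P 0) * ((Real.sqrt 2 : ℝ) : ℂ) ^ Fintype.card R, funext fun x => ?_⟩
  rw [Pi.smul_apply, smul_eq_mul]
  by_cases hx : modelPoint P (fun r => x (P (.inr (.inl r)))) = x
  · rw [← hx, hpt, modelState_modelPoint, mul_assoc, ← mul_pow, mul_inv_cancel₀ (by simp), one_pow,
      mul_one]
  · have h1 : modelState P x = 0 := by
      by_contra h; exact hx (eq_modelPoint_of_ne_zero h)
    rw [h1, mul_zero]
    by_contra h
    refine hx (eq_modelPoint (fun l => ?_) fun r => ?_)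
    · have := hzero _ x (hZ l) h
      rwa [single_dotProduct, one_mul] at this
    · have := hzero _ x (hZZ r) h
      rw [dotProduct_comm, dotProduct_linkPair] at this
      exact CharTwo.add_eq_zero.1 this

theorem pauli_mulVec_norm (u v : ι → ZMod 2) (ψ : (ι → ZMod 2) → ℂ) :
    ∑ x, ‖(pauli u v *ᵥ ψ) x‖ ^ 2 = ∑ x, ‖ψ x‖ ^ 2 := by
  simp only [pauli_act, norm_mul, norm_sgn, one_mul]
  exact Equiv.sum_comp (Equiv.addRight u) fun x => ‖ψ x‖ ^ 2

/-- A state that is stabilized up to signs by the stabilizers of the model state is the model state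
up to a Pauli string and a phase. -/
theorem exists_pauli_mulVec_eq {ψ : (ι → ZMod 2) → ℂ} (hψ : ∑ x, ‖ψ x‖ ^ 2 = 1) {lam : L → ZMod 2}
    {ζ ξ : R → ZMod 2} (hZ : ∀ l, Eig (pauli 0 (Pi.single (P (.inl l)) 1)) ψ (lam l))
    (hZZ : ∀ r, Eig (pauli 0 (linkPair P r)) ψ (ζ r))
    (hXX : ∀ r, Eig (pauli (linkPair P r) 0) ψ (ξ r)) {u v : ι → ZMod 2}
    (hu : ∀ l, u (P (.inl l)) = lam l)
    (hζ : ∀ r, u (P (.inr (.inl r))) + u (P (.inr (.inr r))) = ζ r)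
    (hξ : ∀ r, v (P (.inr (.inl r))) + v (P (.inr (.inr r))) = ξ r) :
    ∃ c : ℂ, ‖c‖ = 1 ∧ pauli u v *ᵥ ψ = c • modelState P := by
  obtain ⟨c, hc⟩ := exists_eq_smul_modelState (P := P) (ψ := pauli u v *ᵥ ψ)
    (fun l => by
      have := (hZ l).pauli_mulVec u v
      rwa [dotProduct_zero, single_dotProduct, one_mul, hu, add_zero, zadd_self] at this)
    (fun r => by
      have := (hZZ r).pauli_mulVec u v
      rwa [dotProduct_zero, dotProduct_comm, dotProduct_linkPair, hζ, add_zero, zadd_self] at this)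
    (fun r => by
      have := (hXX r).pauli_mulVec u v
      rwa [zero_dotProduct, dotProduct_linkPair, hξ, zero_add, zadd_self] at this)
  refine ⟨c, ?_, hc⟩
  have h1 := pauli_mulVec_norm u v ψ
  rw [hψ, hc] at h1
  simp only [Pi.smul_apply, smul_eq_mul, norm_mul, mul_pow] at h1
  rw [← Finset.mul_sum, modelState_norm, mul_one] at h1
  exact (pow_eq_one_iff_of_nonneg (norm_nonneg c) two_ne_zero).1 h1

end Model

/-! ### Dimers as stabilizers -/

section Dimers

variable {N : ℕ} {e : Fin N ≃ ι} {ψ : (ι → ZMod 2) → ℂ}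

/-- A dimer as the eigenvalue of a Pauli string. -/
theorem HasDimer.eig {k l : ι × ZMod 2} {p : ZMod 2} (h : HasDimer e ψ k l p) (hkl : l.2 = k.2 + 1) :
    Eig (pauli (Pi.single k.1 1 + Pi.single l.1 1) (jw e k + jw e l)) ψ (jw e k l.1 + p) := by
  have hne : k ≠ l := fun h => by
    rw [h] at hkl
    exact one_ne_zero (left_eq_add.1 hkl)
  rw [hasDimer_iff_mul hne, majorana_eq, majorana_eq, smul_mul_smul_comm, pauli_mul,
    dotProduct_single, mul_one] at h
  have hI : jwPhase k * jwPhase l = I := by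
    rcases zmod_two_cases k.2 with h0 | h0
    · simp [jwPhase, h0, hkl]
    · simp [jwPhase, h0, hkl, zadd_self]
  rw [hI, Matrix.smul_mulVec, ← smul_smul] at h
  have h' : Eig (sgn (jw e k l.1) • pauli (Pi.single k.1 1 + Pi.single l.1 1) (jw e k + jw e l)) ψ
      p := smul_right_injective _ I_ne_zero h
  exact h'.smul_sgn

theorem jw_add_jw_same (e : Fin N ≃ ι) (k : ι) : jw e (k, 0) + jw e (k, 1) = Pi.single k 1 := by
  funext l
  rw [Pi.add_apply]
  by_cases hl : l = k
  · subst hl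
    rw [jw_self e (l, 0), jw_self e (l, 1), Pi.single_eq_same, zero_add]
  · rw [Pi.single_eq_of_ne hl]
    unfold jw
    simp only [hl, false_and, or_false]
    exact zadd_self _

theorem HasDimer.eig_local {k : ι} {p : ZMod 2} (h : HasDimer e ψ (k, 0) (k, 1) p) :
    Eig (pauli 0 (Pi.single k 1)) ψ p := by
  have h1 := h.eig (zero_add 1).symm
  rwa [jw_add_jw_same, fadd_self, jw_self e (k, 0), zero_add] at h1

/-- The qubits strictly between two qubits. -/
def between (e : Fin N ≃ ι) (k l : ι) (n : ι) : ZMod 2 :=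
  if e.symm k < e.symm n ∧ e.symm n < e.symm l then 1 else 0

/-- The two dimers of a link are Pauli strings with the same X part, whose Z parts differ by Z at
its two qubits. Their product is ZZ, while one of them is XX times the Z string between the two
qubits. -/
theorem HasDimer.eig_link {k l : ι} (hkl : e.symm k < e.symm l) {p q : ZMod 2}
    (h0 : HasDimer e ψ (k, 0) (l, 1) p) (h1 : HasDimer e ψ (k, 1) (l, 0) q) :
    Eig (pauli 0 (Pi.single k 1 + Pi.single l 1)) ψ (p + q) ∧
      Eig (pauli (Pi.single k 1 + Pi.single l 1) (between e k l)) ψ q := by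
  have hne : k ≠ l := fun h => absurd hkl (by rw [h]; exact lt_irrefl _)
  have e0 := h0.eig (zero_add 1).symm
  have e1 := h1.eig (zadd_self 1).symm
  have hk0 : jw e (k, 0) l = 0 := by
    unfold jw; simp [not_lt.2 hkl.le]
  have hk1 : jw e (k, 1) l = 0 := by
    unfold jw; simp [not_lt.2 hkl.le, hne.symm]
  have hB : jw e (k, 1) + jw e (l, 0) = between e k l := by
    funext n
    rw [Pi.add_apply]
    unfold jw between
    rcases lt_trichotomy (e.symm n) (e.symm k) with h | h | h
    · simp only [h, h.trans hkl, not_lt.2 h.le, true_or, if_true, false_and, if_false]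
      exact zadd_self 1
    · have : n = k := e.symm.injective h
      subst this
      simp [hkl, zadd_self]
    · have h' : n ≠ k := by rintro rfl; exact lt_irrefl _ h
      simp [h, not_lt.2 h.le, h']
  have hB' : jw e (k, 0) + jw e (l, 1) = (Pi.single k 1 + Pi.single l 1) + between e k l := by
    have a1 := jw_add_jw_same e
    have a2 : ∀ k, jw e (k, 0) = Pi.single k 1 + jw e (k, 1) := fun k => by
      rw [← a1 k, add_assoc, fadd_self, add_zero]
    rw [← hB, a2 k, ← a1 l]
    funext n
    simp only [Pi.add_apply]
    linear_combination -zadd_self (jw e (l, 0) n)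
  simp only [hk0, hk1, zero_add] at e0 e1
  rw [hB] at e1
  rw [hB'] at e0
  refine ⟨?_, e1⟩
  have h2 := e0.mul e1
  rw [pauli_mul, fadd_self, add_assoc (Pi.single k 1 + Pi.single l 1) _ (between e k l), fadd_self,
    add_zero] at h2
  have h3 : (Pi.single k 1 + Pi.single l 1 + between e k l) ⬝ᵥ (Pi.single k 1 + Pi.single l 1) =
      0 := by
    rw [dotProduct_add, dotProduct_single, dotProduct_single]
    have b1 : between e k l k = 0 := by unfold between; simp
    have b2 : between e k l l = 0 := by unfold between; simp
    simp only [Pi.add_apply, b1, b2, Pi.single_eq_same, Pi.single_eq_of_ne hne,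
      Pi.single_eq_of_ne hne.symm]
    decide
  rwa [h3, sgn_zero, one_smul] at h2

theorem eig_pauli_sum {α : Type*} (F : Finset α) (v : α → ι → ZMod 2) (s : α → ZMod 2)
    (h : ∀ r ∈ F, Eig (pauli 0 (v r)) ψ (s r)) :
    Eig (pauli 0 (∑ r ∈ F, v r)) ψ (∑ r ∈ F, s r) := by
  classical
  induction F using Finset.induction_on with
  | empty =>
    rw [Finset.sum_empty, Finset.sum_empty, pauli_zero]
    unfold Eig
    rw [Matrix.one_mulVec, sgn_zero, one_smul]
  | insert r F hr ih =>
    have h1 := (h r (Finset.mem_insert_self r F)).mul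
      (ih fun r' hr' => h r' (Finset.mem_insert_of_mem hr'))
    rwa [pauli_mul, dotProduct_zero, sgn_zero, one_smul, zero_add, ← Finset.sum_insert hr,
      ← Finset.sum_insert hr] at h1

/-- Links are nested if between the two qubits of a link there are exactly the inner links. -/
def Nested (e : Fin N ≃ ι) (P : L ⊕ (R ⊕ R) ≃ ι) (t : R → ℕ) : Prop :=
  ∀ r, e.symm (P (.inr (.inl r))) < e.symm (P (.inr (.inr r))) ∧
    ∀ l, (e.symm (P (.inr (.inl r))) < e.symm l ∧ e.symm l < e.symm (P (.inr (.inr r)))) ↔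
      ∃ r', t r' < t r ∧ (l = P (.inr (.inl r')) ∨ l = P (.inr (.inr r')))

/-- Thus the string inside a link is a product of ZZ operators of inner links, and their known
values reduce the second stabilizer to pure XX. -/
theorem Nested.between_eq {P : L ⊕ (R ⊕ R) ≃ ι} {t : R → ℕ} (h : Nested e P t) (r : R) :
    between e (P (.inr (.inl r))) (P (.inr (.inr r))) =
      ∑ r' ∈ Finset.univ.filter (fun r' => t r' < t r), linkPair P r' := by
  funext n
  rw [Finset.sum_apply, between, if_congr ((h r).2 n) rfl rfl]
  obtain ⟨n, rfl⟩ := P.surjective n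
  simp only [linkPair, Pi.add_apply, Pi.single_apply, P.apply_eq_iff_eq]
  rcases n with l | r' | r'
  · simp
  · simp [Finset.sum_ite_eq]
  · simp [Finset.sum_ite_eq]

/-- A state with dimers on local qubits and on nested links is the model state up to a Pauli string
and a phase. -/
theorem exists_pauli_mulVec_eq_of_dimers {P : L ⊕ (R ⊕ R) ≃ ι} {t : R → ℕ} (hn : Nested e P t)
    (hψ : ∑ x, ‖ψ x‖ ^ 2 = 1) {lam : L → ZMod 2} {σ τ : R → ZMod 2}
    (hl : ∀ l, HasDimer e ψ (P (.inl l), 0) (P (.inl l), 1) (lam l))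
    (hσ : ∀ r, HasDimer e ψ (P (.inr (.inl r)), 0) (P (.inr (.inr r)), 1) (σ r))
    (hτ : ∀ r, HasDimer e ψ (P (.inr (.inl r)), 1) (P (.inr (.inr r)), 0) (τ r))
    {u v : ι → ZMod 2} (hu : ∀ l, u (P (.inl l)) = lam l)
    (hζ : ∀ r, u (P (.inr (.inl r))) + u (P (.inr (.inr r))) = σ r + τ r)
    (hξ : ∀ r, v (P (.inr (.inl r))) + v (P (.inr (.inr r))) =
      τ r + ∑ r' ∈ Finset.univ.filter (fun r' => t r' < t r), (σ r' + τ r')) :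
    ∃ c : ℂ, ‖c‖ = 1 ∧ pauli u v *ᵥ ψ = c • modelState P := by
  have hZZ : ∀ r, Eig (pauli 0 (linkPair P r)) ψ (σ r + τ r) := fun r =>
    (HasDimer.eig_link (hn r).1 (hσ r) (hτ r)).1
  refine exists_pauli_mulVec_eq hψ (fun l => (hl l).eig_local) hZZ (fun r => ?_) hu hζ hξ
  have h1 := (HasDimer.eig_link (hn r).1 (hσ r) (hτ r)).2
  rw [hn.between_eq r] at h1
  have h2 := h1.mul (eig_pauli_sum (Finset.univ.filter fun r' => t r' < t r) _ _
    fun r' _ => hZZ r')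
  rwa [pauli_mul, dotProduct_zero, sgn_zero, one_smul, fadd_self, add_zero] at h2

end Dimers

end

end HaPPY

namespace HaPPY

noncomputable section

set_option linter.unusedSectionVars false

/-! ### Choosing independent coordinates -/

theorem exists_sum_equiv {X Y Z : Type} [Fintype X] [Fintype Y] [Fintype Z] {q : X → Y}
    (hq : Function.Injective q) (h : Fintype.card X + Fintype.card Z = Fintype.card Y) :
    ∃ w : X ⊕ Z ≃ Y, ∀ x, w (.inl x) = q x := by
  classical
  have h1 : Fintype.card Z = Fintype.card ↥(Set.range q)ᶜ := by
    have h2 := Fintype.card_compl_set (Set.range q)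
    rw [Set.card_range_of_injective hq] at h2
    omega
  refine ⟨((Equiv.ofInjective q hq).sumCongr (Fintype.equivOfCardEq h1)).trans
    (Equiv.Set.sumCompl (Set.range q)), fun x => ?_⟩
  simp

/-- An injective affine map is already injective on as many coordinates as its domain has. -/
theorem exists_injective_coordinates {X Y : Type} [Fintype X] [Fintype Y]
    (φ : (X → ZMod 2) → Y → ZMod 2) (hadd : ∀ i i', φ (i + i') + φ 0 = φ i + φ i')
    (hinj : Function.Injective φ) :
    ∃ (n : ℕ) (w : X ⊕ Fin n ≃ Y), Function.Injective fun i v => φ i (w (.inl v)) := by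
  classical
  have : Fact (Nat.Prime 2) := ⟨Nat.prime_two⟩
  let Φ : (X → ZMod 2) →+ (Y → ZMod 2) :=
    { toFun := fun i => φ i + φ 0
      map_zero' := fadd_self _
      map_add' := fun i i' => by
        have := hadd i i'
        rw [this]
        funext y
        simp only [Pi.add_apply]
        linear_combination -zadd_self (φ 0 y) }
  have hΦ : ∀ i, Φ i = φ i + φ 0 := fun _ => rfl
  let F : (X → ZMod 2) →ₗ[ZMod 2] (Y → ZMod 2) := Φ.toZModLinearMap 2
  let row : Y → Module.Dual (ZMod 2) (X → ZMod 2) := fun y => (LinearMap.proj y).comp F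
  have hF : ∀ i, F i = 0 → i = 0 := fun i hi => hinj (by
    have : φ i + φ 0 = 0 := hi
    funext y
    exact CharTwo.add_eq_zero.1 (congrFun this y))
  -- No non-zero vector is annihilated by all coordinate functionals, so these span the dual space.
  -- A basis chosen among them has as many members as `X`.
  have hspan : Submodule.span (ZMod 2) (Set.range row) = ⊤ := by
    have h0 : (Submodule.span (ZMod 2) (Set.range row)).dualCoannihilator = ⊥ := by
      rw [eq_bot_iff]
      intro i hi
      rw [Submodule.mem_dualCoannihilator] at hi
      exact hF i (funext fun y => hi (row y) (Submodule.subset_span ⟨y, rfl⟩))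
    rw [← Subspace.dualCoannihilator_dualAnnihilator_eq
      (W := Submodule.span (ZMod 2) (Set.range row)), h0, Submodule.dualAnnihilator_bot]
  obtain ⟨κ, c, hc, hs, hli⟩ := exists_linearIndependent' (ZMod 2) row
  rw [hspan] at hs
  have : Finite κ := Finite.of_injective c hc
  have : Fintype κ := Fintype.ofFinite κ
  let bas := Module.Basis.mk hli hs.ge
  have hcard : Fintype.card X = Fintype.card κ := by
    have h1 := Module.finrank_eq_card_basis bas
    rw [Subspace.dual_finrank_eq, Module.finrank_fintype_fun_eq_card] at h1
    exact h1
  let q : X → Y := c ∘ Fintype.equivOfCardEq hcard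
  have hq : Function.Injective q := hc.comp (Equiv.injective _)
  obtain ⟨w, hw⟩ := exists_sum_equiv (Z := Fin (Fintype.card Y - Fintype.card X)) hq (by
    have := Fintype.card_le_of_injective q hq
    rw [Fintype.card_fin]; omega)
  refine ⟨_, w, fun i i' h => ?_⟩
  have hker : ∀ j, (∀ v, F j (q v) = 0) → j = 0 := fun j hj => by
    by_contra hne
    have htop : (Submodule.span (ZMod 2) (Set.range (row ∘ c))).dualCoannihilator = ⊥ := by
      rw [hs, Submodule.dualCoannihilator_top]
    have : j ∈ (Submodule.span (ZMod 2) (Set.range (row ∘ c))).dualCoannihilator := by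
      rw [Submodule.mem_dualCoannihilator]
      intro g hg
      induction hg using Submodule.span_induction with
      | mem x hx =>
        obtain ⟨k, rfl⟩ := hx
        have := hj ((Fintype.equivOfCardEq hcard).symm k)
        simpa [q, row] using this
      | zero => rfl
      | add x y _ _ hx hy => rw [LinearMap.add_apply, hx, hy, add_zero]
      | smul r x _ hx => rw [LinearMap.smul_apply, hx, smul_zero]
    rw [htop] at this
    exact hne this
  have h2 : i + i' = 0 := hker _ fun v => by
    have h3 := congrFun h v
    simp only [hw] at h3
    have h4 : F (i + i') (q v) = F i (q v) + F i' (q v) := by rw [map_add]; rfl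
    rw [h4]
    change φ i (q v) + φ 0 (q v) + (φ i' (q v) + φ 0 (q v)) = 0
    rw [h3]; exact zadd_self _
  funext v
  exact CharTwo.add_eq_zero.1 (congrFun h2 v)

/-! ### Controlled Pauli strings -/

section Controlled

variable {κ α : Type} [Fintype κ] [DecidableEq κ] [Fintype α] [DecidableEq α]

theorem ketAt_apply (q : α → κ) (i : α → ZMod 2) (x : κ → ZMod 2) :
    ketAt q i x = if (fun v => x (q v)) = i then 1 else 0 := by
  unfold ketAt
  exact if_congr funext_iff.symm rfl rfl

theorem projAt_mulVec (q : α → κ) (i : α → ZMod 2) (ψ : (κ → ZMod 2) → ℂ) (x : κ → ZMod 2) :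
    (projAt q i *ᵥ ψ) x = ketAt q i x * ψ x := by
  rw [projAt, Matrix.mulVec_diagonal]

theorem projAt_mul_pauli (q : α → κ) (i : α → ZMod 2) (u v : κ → ZMod 2) :
    projAt q i * pauli u v = pauli u v * projAt q (i + fun l => u (q l)) := by
  refine matrix_ext_mulVec fun ψ => funext fun x => ?_
  rw [← Matrix.mulVec_mulVec, ← Matrix.mulVec_mulVec, projAt_mulVec, pauli_act, pauli_act,
    projAt_mulVec]
  have : ketAt q (i + fun l => u (q l)) (x + u) = ketAt q i x := by
    rw [ketAt_apply, ketAt_apply]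
    refine if_congr ?_ rfl rfl
    constructor
    · intro h
      funext l
      have := congrFun h l
      simpa using this
    · rintro rfl; rfl
  rw [this]; ring

theorem projAt_mul_projAt (q : α → κ) (i j : α → ZMod 2) :
    projAt q i * projAt q j = if i = j then projAt q i else 0 := by
  rw [projAt, projAt, Matrix.diagonal_mul_diagonal]
  split_ifs with h
  · subst h
    congr 1
    funext x
    unfold ketAt
    split_ifs <;> simp
  · rw [← Matrix.diagonal_zero]
    congr 1
    funext x
    rw [ketAt_apply, ketAt_apply]
    split_ifs with h1 h2
    · exact absurd (h1.symm.trans h2) h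
    all_goals simp

theorem sum_projAt (q : α → κ) : ∑ i, projAt q i = 1 := by
  refine matrix_ext_mulVec fun ψ => funext fun x => ?_
  rw [Matrix.sum_mulVec, Finset.sum_apply, Matrix.one_mulVec]
  simp only [projAt_mulVec, ketAt_apply]
  rw [← Finset.sum_mul, Finset.sum_ite_eq, if_pos (Finset.mem_univ _), one_mul]

theorem projAt_conjTranspose (q : α → κ) (i : α → ZMod 2) : (projAt q i)ᴴ = projAt q i := by
  rw [projAt, Matrix.diagonal_conjTranspose]
  congr 1
  funext x
  rw [Pi.star_apply]
  unfold ketAt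
  split_ifs <;> simp

theorem star_mul_self_of_norm {c : ℂ} (h : ‖c‖ = 1) : star c * c = 1 := by
  have := Complex.conj_mul' c
  rw [h] at this
  simpa using this

/-- Controlled Pauli strings are unitary if they act injectively on the control qubits. -/
theorem controlled_unitary (q : α → κ) {c : (α → ZMod 2) → ℂ} (hc : ∀ i, ‖c i‖ = 1)
    {u v : (α → ZMod 2) → κ → ZMod 2}
    (hp : Function.Injective fun i => i + fun l => u i (q l)) :
    (∑ i, projAt q i * (c i • pauli (u i) (v i)))ᴴ *
      (∑ i, projAt q i * (c i • pauli (u i) (v i))) = 1 := by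
  have h1 : ∀ i j, (projAt q i * (c i • pauli (u i) (v i)))ᴴ *
      (projAt q j * (c j • pauli (u j) (v j))) =
      if i = j then projAt q (i + fun l => u i (q l)) else 0 := by
    intro i j
    rw [conjTranspose_mul, projAt_conjTranspose, mul_assoc, ← mul_assoc (projAt q i),
      projAt_mul_projAt]
    split_ifs with h
    · subst h
      rw [conjTranspose_smul, mul_smul_comm, smul_mul_smul_comm, star_mul_self_of_norm (hc i),
        one_smul, projAt_mul_pauli, ← mul_assoc, pauli_conjTranspose_mul, one_mul]
    · simp
  rw [conjTranspose_sum, Finset.sum_mul]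
  simp only [Finset.mul_sum, h1]
  simp only [Finset.sum_ite_eq, Finset.mem_univ, if_true]
  -- The shifted labels run through all labels once, so the projectors again sum to the identity.
  have hb := Finite.injective_iff_bijective.1 hp
  exact (hb.sum_comp fun i => projAt q i).trans (sum_projAt q)

variable {ι : Type} [Fintype ι] [DecidableEq ι] {A : Finset ι}

theorem localOp_sum {X : Type} [Fintype X] (f : X → Matrix (↥A → ZMod 2) (↥A → ZMod 2) ℂ) :
    localOp A (∑ i, f i) = ∑ i, localOp A (f i) := by
  let F : Matrix (↥A → ZMod 2) (↥A → ZMod 2) ℂ →+ Matrix (ι → ZMod 2) (ι → ZMod 2) ℂ :=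
    AddMonoidHom.mk' (localOp A) (localOp_add A)
  exact map_sum F f Finset.univ

theorem localOp_projAt (q : α → ↥A) (i : α → ZMod 2) :
    localOp A (projAt q i) = projAt (fun v => (q v : ι)) i := by
  refine matrix_ext_mulVec fun ψ => funext fun x => ?_
  rw [projAt_mulVec, localOp_mulVec, Finset.sum_eq_single fun l : ↥A => x l]
  · rw [projAt, Matrix.diagonal_apply_eq, glue_restrict]; rfl
  · intro z _ hz
    rw [projAt, Matrix.diagonal_apply_ne _ (Ne.symm hz), zero_mul]
  · exact fun h => absurd (Finset.mem_univ _) h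

/-- On a state where the control qubits have definite values only one of the Pauli strings acts. -/
theorem controlled_mulVec (q : α → ↥A) {c : (α → ZMod 2) → ℂ} {u v : (α → ZMod 2) → ι → ZMod 2}
    (hu : ∀ i l, l ∉ A → u i l = 0) (hv : ∀ i l, l ∉ A → v i l = 0)
    (hp : Function.Injective fun i => i + fun l => u i (q l)) {ψ : (ι → ZMod 2) → ℂ}
    (i : α → ZMod 2) (hψ : ∀ x, ψ x ≠ 0 → ∀ l, x (q l) = i l + u i (q l)) :
    localOp A (∑ i, projAt q i * (c i • pauli (fun l : ↥A => u i l) (fun l : ↥A => v i l))) *ᵥ ψ =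
      c i • (pauli (u i) (v i) *ᵥ ψ) := by
  have h1 : ∀ j, localOp A (projAt q j * (c j • pauli (fun l : ↥A => u j l) (fun l : ↥A => v j l))) *ᵥ ψ =
      if i = j then c j • (pauli (u j) (v j) *ᵥ ψ) else 0 := by
    intro j
    rw [localOp_mul, localOp_smul, ← pauli_eq_localOp (hu j) (hv j), localOp_projAt, mul_smul_comm,
      projAt_mul_pauli, Matrix.smul_mulVec, ← Matrix.mulVec_mulVec]
    -- The projector stands after the Pauli string. Before the string, the control qubits have to
    -- show `j + u j`, which holds for one `j` only.
    have h2 : projAt (fun v => (q v : ι)) (j + fun l => u j (q l)) *ᵥ ψ = if i = j then ψ else 0 := by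
      funext x
      rw [projAt_mulVec, ketAt_apply]
      by_cases hx : ψ x = 0
      · rw [hx, mul_zero]; split_ifs <;> simp [hx]
      · have h3 : (fun l => x (q l)) = i + fun l => u i (q l) := funext (hψ x hx)
        rw [h3]
        by_cases hij : i = j
        · subst hij; simp
        · rw [if_neg fun h => hij (hp h), if_neg hij, zero_mul]; rfl
    rw [h2]
    split_ifs <;> simp
  rw [localOp_sum, Matrix.sum_mulVec]
  simp only [h1]
  rw [Finset.sum_ite_eq, if_pos (Finset.mem_univ _)]

end Controlled

end

end HaPPY

namespace HaPPY

noncomputable section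

set_option linter.unusedSectionVars false

/-! ### Disentangling the two halves -/

/-- A function of the bulk configuration that is affine. -/
def IsAff {β : Type} (s : (β → ZMod 2) → ZMod 2) : Prop := ∀ b b', s (b + b') + s 0 = s b + s b'

/-- A bulk configuration from one on a subset. -/
def ext {β : Type} [DecidableEq β] (a : Finset β) (i : ↥a → ZMod 2) (l : β) : ZMod 2 :=
  if h : l ∈ a then i ⟨l, h⟩ else 0

section Ext

variable {β : Type} [DecidableEq β] {a c : Finset β}

theorem ext_mem (i : ↥a → ZMod 2) {l : β} (h : l ∈ a) : ext a i l = i ⟨l, h⟩ := dif_pos h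

theorem ext_not_mem (i : ↥a → ZMod 2) {l : β} (h : l ∉ a) : ext a i l = 0 := dif_neg h

theorem ext_add (i i' : ↥a → ZMod 2) : ext a (i + i') = ext a i + ext a i' := by
  funext l
  by_cases h : l ∈ a
  · rw [Pi.add_apply, ext_mem _ h, ext_mem _ h, ext_mem _ h]; rfl
  · rw [Pi.add_apply, ext_not_mem _ h, ext_not_mem _ h, ext_not_mem _ h, add_zero]

theorem ext_zero : ext a 0 = 0 := by
  funext l
  by_cases h : l ∈ a
  · rw [ext_mem _ h]; rfl
  · rw [ext_not_mem _ h]; rfl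

theorem ext_injective : Function.Injective (ext a) := fun i i' h => funext fun l => by
  rw [← ext_mem i l.2, h, ext_mem]

theorem ext_add_ext [Fintype β] (i : ↥a → ZMod 2) (j : ↥aᶜ → ZMod 2) :
    ext a i + ext aᶜ j = glue a i j := by
  funext l
  by_cases h : l ∈ a
  · rw [Pi.add_apply, ext_mem _ h, ext_not_mem _ (fun h' => Finset.mem_compl.1 h' h), glue_mem _ _ h,
      add_zero]
  · rw [Pi.add_apply, ext_not_mem _ h, ext_mem _ (Finset.mem_compl.2 h), glue_not_mem _ _ h,
      zero_add]

end Ext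

/-- A function on the qubits from its values on local qubits and links. -/
def place {ι L R : Type} (P : L ⊕ (R ⊕ R) ≃ ι) (x : L → ZMod 2) (y z : R → ZMod 2) (k : ι) : ZMod 2 :=
  (P.symm k).elim x (Sum.elim y z)

section Place

variable {ι L R : Type} {P : L ⊕ (R ⊕ R) ≃ ι} (x : L → ZMod 2) (y z : R → ZMod 2)

theorem place_local (l : L) : place P x y z (P (.inl l)) = x l := by simp [place]

theorem place_left (r : R) : place P x y z (P (.inr (.inl r))) = y r := by simp [place]

theorem place_right (r : R) : place P x y z (P (.inr (.inr r))) = z r := by simp [place]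

end Place

variable {ι β LA LC R : Type} [Fintype ι] [DecidableEq ι] [Fintype β] [DecidableEq β] [Fintype LA]
  [Fintype LC] [Fintype R] [DecidableEq R]

/-- Unitaries `S` on `A` and `T` on `C` map the encoded basis states to products of basis states and
Bell pairs, up to Pauli strings that depend affinely on the bulk configuration. -/
structure Frame (V : Matrix (ι → ZMod 2) (β → ZMod 2) ℂ) (A C : Finset ι) (a c : Finset β)
    (P : (LA ⊕ LC) ⊕ (R ⊕ R) ≃ ι) (S T : Matrix (ι → ZMod 2) (ι → ZMod 2) ℂ)
    (lam : LA ⊕ LC → (β → ZMod 2) → ZMod 2) (ζ ξ : R → (β → ZMod 2) → ZMod 2) : Prop where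
  compl : ∀ k, k ∉ A ↔ k ∈ C
  compl_bulk : ∀ l, l ∉ a ↔ l ∈ c
  loc_left : ∀ d, P (.inl (.inl d)) ∈ A
  loc_right : ∀ d, P (.inl (.inr d)) ∈ C
  link_left : ∀ r, P (.inr (.inl r)) ∈ A
  link_right : ∀ r, P (.inr (.inr r)) ∈ C
  isLocal_left : IsLocal A S
  isLocal_right : IsLocal C T
  unitary_left : Sᴴ * S = 1
  unitary_right : Tᴴ * T = 1
  lam_left : ∀ d b b', (∀ l, l ∈ a → b l = b' l) → lam (.inl d) b = lam (.inl d) b'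
  lam_right : ∀ d b b', (∀ l, l ∈ c → b l = b' l) → lam (.inr d) b = lam (.inr d) b'
  aff_lam : ∀ l, IsAff (lam l)
  aff_ζ : ∀ r, IsAff (ζ r)
  aff_ξ : ∀ r, IsAff (ξ r)
  eig : ∀ b l, Eig (pauli 0 (Pi.single (P (.inl l)) 1)) ((T * S) *ᵥ col V b) (lam l b)
  key : ∀ b u v, (∀ l, u (P (.inl l)) = lam l b) →
    (∀ r, u (P (.inr (.inl r))) + u (P (.inr (.inr r))) = ζ r b) →
    (∀ r, v (P (.inr (.inl r))) + v (P (.inr (.inr r))) = ξ r b) →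
    ∃ c : ℂ, ‖c‖ = 1 ∧ pauli u v *ᵥ ((T * S) *ᵥ col V b) = c • modelState P

/-- Exchanging the two halves. -/
def swapHalves (P : (LA ⊕ LC) ⊕ (R ⊕ R) ≃ ι) : (LC ⊕ LA) ⊕ (R ⊕ R) ≃ ι :=
  ((Equiv.sumComm LC LA).sumCongr (Equiv.sumComm R R)).trans P

theorem modelState_swapHalves (P : (LA ⊕ LC) ⊕ (R ⊕ R) ≃ ι) :
    modelState (swapHalves P) = modelState P := by
  funext x
  unfold modelState
  congr 1
  · refine if_congr ?_ rfl rfl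
    constructor
    · rintro h (d | d)
      exacts [h (.inr d), h (.inl d)]
    · rintro h (d | d)
      exacts [h (.inr d), h (.inl d)]
  · refine Finset.prod_congr rfl fun r _ => ?_
    exact if_congr eq_comm rfl rfl

namespace Frame

variable {V : Matrix (ι → ZMod 2) (β → ZMod 2) ℂ} {A C : Finset ι} {a c : Finset β}
  {P : (LA ⊕ LC) ⊕ (R ⊕ R) ≃ ι} {S T : Matrix (ι → ZMod 2) (ι → ZMod 2) ℂ}
  {lam : LA ⊕ LC → (β → ZMod 2) → ZMod 2} {ζ ξ : R → (β → ZMod 2) → ZMod 2}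

theorem disjoint (F : Frame V A C a c P S T lam ζ ξ) : Disjoint A C :=
  Finset.disjoint_left.2 fun k h h' => (F.compl k).2 h' h

theorem comm (F : Frame V A C a c P S T lam ζ ξ) : T * S = S * T :=
  F.isLocal_right.comm F.isLocal_left F.disjoint.symm

theorem symm (F : Frame V A C a c P S T lam ζ ξ) :
    Frame V C A c a (swapHalves P) T S (fun l => lam l.swap) ζ ξ where
  compl k := by rw [← F.compl, not_not]
  compl_bulk l := by rw [← F.compl_bulk, not_not]
  loc_left := F.loc_right
  loc_right := F.loc_left
  link_left := F.link_right
  link_right := F.link_left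
  isLocal_left := F.isLocal_right
  isLocal_right := F.isLocal_left
  unitary_left := F.unitary_right
  unitary_right := F.unitary_left
  lam_left := F.lam_right
  lam_right := F.lam_left
  aff_lam l := F.aff_lam l.swap
  aff_ζ := F.aff_ζ
  aff_ξ := F.aff_ξ
  eig b l := by
    rw [← F.comm]
    rcases l with d | d
    · exact F.eig b (.inr d)
    · exact F.eig b (.inl d)
  key b u v hu hζ hξ := by
    rw [← F.comm, modelState_swapHalves]
    refine F.key b u v ?_ (fun r => ?_) fun r => ?_
    · rintro (d | d)
      · exact hu (.inr d)
      · exact hu (.inl d)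
    · rw [add_comm]; exact hζ r
    · rw [add_comm]; exact hξ r

/-- Suppose the parities do not see the difference. Then all local qubits agree, and the decoded
states differ only by a Pauli string on the links. It can be placed on the link qubits in `C`, so an
operator on `C` would change a bulk qubit that is recoverable from `A`. -/
theorem eq_of_lam_left (F : Frame V A C a c P S T lam ζ ξ) (hV : ∀ b, ∑ x, ‖V x b‖ ^ 2 = 1)
    (hrec : Recoverable V a A) {b b' : β → ZMod 2} (hb : ∀ l, l ∉ a → b l = b' l)
    (h : ∀ d, lam (.inl d) b = lam (.inl d) b') : b = b' := by
  by_contra hne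
  obtain ⟨l, hl⟩ := Function.ne_iff.1 hne
  have hla : l ∈ a := by
    by_contra h'; exact hl (hb l h')
  have hlam : ∀ l, lam l b = lam l b' := by
    rintro (d | d)
    · exact h d
    · exact F.lam_right d b b' fun l hl => hb l ((F.compl_bulk l).2 hl)
  -- All corrections of links are made on their right qubits.
  have hkey : ∀ b, ∃ c : ℂ, ‖c‖ = 1 ∧ pauli (place P (fun l => lam l b) 0 fun r => ζ r b)
      (place P 0 0 fun r => ξ r b) *ᵥ ((T * S) *ᵥ col V b) = c • modelState P := fun b =>
    F.key b _ _ (fun l => place_local _ _ _ l)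
      (fun r => by rw [place_left, place_right, Pi.zero_apply, zero_add])
      (fun r => by rw [place_left, place_right, Pi.zero_apply, zero_add])
  obtain ⟨r, hr, h1⟩ := hkey b
  obtain ⟨r', hr', h2⟩ := hkey b'
  set u := place P (fun l => lam l b) 0 fun r => ζ r b
  set v := place P 0 0 fun r => ξ r b
  set u' := place P (fun l => lam l b') 0 fun r => ζ r b'
  set v' := place P 0 0 fun r => ξ r b'
  have hr0 : r ≠ 0 := fun h0 => by rw [h0, norm_zero] at hr; exact zero_ne_one hr
  have hr0' : r' ≠ 0 := fun h0 => by rw [h0, norm_zero] at hr'; exact zero_ne_one hr'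
  have h3 : ∃ k : ℂ, k ≠ 0 ∧ pauli (u' + u) (v' + v) *ᵥ ((T * S) *ᵥ col V b) =
      k • ((T * S) *ᵥ col V b') := by
    have h4 := congrArg (pauli u' v' *ᵥ ·) h2
    simp only [Matrix.mulVec_smul] at h4
    rw [Matrix.mulVec_mulVec, pauli_mul_pauli_self, Matrix.smul_mulVec, Matrix.one_mulVec] at h4
    have h5 := congrArg (pauli u' v' *ᵥ ·) h1
    simp only [Matrix.mulVec_smul] at h5
    rw [Matrix.mulVec_mulVec, pauli_mul, Matrix.smul_mulVec] at h5
    refine ⟨sgn (v' ⬝ᵥ u) * (r * (r'⁻¹ * sgn (v' ⬝ᵥ u'))), ?_, ?_⟩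
    · simp [sgn_ne_zero, hr0, hr0']
    · have h6 : pauli u' v' *ᵥ modelState P =
          (r'⁻¹ * sgn (v' ⬝ᵥ u')) • ((T * S) *ᵥ col V b') := by
        rw [mul_smul, h4, smul_smul, inv_mul_cancel₀ hr0', one_smul]
      rw [h6] at h5
      rw [mul_smul, mul_smul, ← h5, smul_smul, sgn_mul_self, one_smul]
  obtain ⟨k, hk, h3⟩ := h3
  have hQ : IsLocal C (Tᴴ * pauli (u' + u) (v' + v) * T) := by
    refine (F.isLocal_right.conjTranspose.mul (isLocal_pauli ?_ ?_)).mul F.isLocal_right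
    · intro n hn
      obtain ⟨n, rfl⟩ := P.surjective n
      simp only [Pi.add_apply, u, u']
      rcases n with l | r | r
      · rw [place_local, place_local, hlam, zadd_self]
      · rw [place_left, place_left]; rfl
      · exact absurd (F.link_right r) hn
    · intro n hn
      obtain ⟨n, rfl⟩ := P.surjective n
      simp only [Pi.add_apply, v, v']
      rcases n with l | r | r
      · rw [place_local, place_local]; rfl
      · rw [place_left, place_left]; rfl
      · exact absurd (F.link_right r) hn
  have h4 : (Tᴴ * pauli (u' + u) (v' + v) * T) *ᵥ col V b = k • col V b' := by
    -- The unitary on `A` can be inserted and undone because it commutes with operators on `C`.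
    have h5 : Tᴴ * pauli (u' + u) (v' + v) * T =
        Sᴴ * (Tᴴ * (pauli (u' + u) (v' + v) * (T * S))) := by
      have h6 := hQ.comm F.isLocal_left F.disjoint.symm
      calc Tᴴ * pauli (u' + u) (v' + v) * T
          = Sᴴ * S * (Tᴴ * pauli (u' + u) (v' + v) * T) := by rw [F.unitary_left, one_mul]
        _ = Sᴴ * (Tᴴ * pauli (u' + u) (v' + v) * T * S) := by rw [h6, mul_assoc]
        _ = _ := by simp only [mul_assoc]
    have h7 : Sᴴ * (Tᴴ * (T * S)) = 1 := by
      rw [← mul_assoc Tᴴ, F.unitary_right, one_mul, F.unitary_left]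
    rw [h5, ← Matrix.mulVec_mulVec, ← Matrix.mulVec_mulVec, ← Matrix.mulVec_mulVec, h3,
      Matrix.mulVec_smul, Matrix.mulVec_smul, Matrix.mulVec_mulVec, Matrix.mulVec_mulVec, mul_assoc,
      h7, Matrix.one_mulVec]
  exact hk (hrec.eq_zero_of_mulVec F.disjoint hQ hla hl h4 (col_ne_zero hV b'))

/-- The parities of the local qubits are an injective affine function of the bulk qubits of `a`.
Independent ones among them give the logical qubits, and the others become auxiliary. -/
theorem exists_logical (F : Frame V A C a c P S T lam ζ ξ) (hV : ∀ b, ∑ x, ‖V x b‖ ^ 2 = 1)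
    (hrec : Recoverable V a A) : ∃ (n : ℕ) (w : ↥a ⊕ Fin n ≃ LA),
      Function.Injective fun (i : ↥a → ZMod 2) v => lam (.inl (w (.inl v))) (ext a i) := by
  refine exists_injective_coordinates (fun (i : ↥a → ZMod 2) d => lam (.inl d) (ext a i))
    (fun i i' => funext fun d => ?_) fun i i' h => ext_injective (F.eq_of_lam_left hV hrec
      (fun l hl => by rw [ext_not_mem _ hl, ext_not_mem _ hl]) (congrFun h))
  have := F.aff_lam (.inl d) (ext a i) (ext a i')
  rwa [← ext_add, ← ext_zero (a := a)] at this

/-- Phases that arise from commuting operations on two halves are products. -/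
theorem phase_mul {X Y : Type} [Zero X] [Zero Y] {ω : X → Y → ℂ}
    {K O : X → Matrix (ι → ZMod 2) (ι → ZMod 2) ℂ} {J D : Y → Matrix (ι → ZMod 2) (ι → ZMod 2) ℂ}
    {s t : X → Y → (ι → ZMod 2) → ℂ} (hd : Disjoint A C) (hK : ∀ i, IsLocal A (K i))
    (hO : ∀ i, IsLocal A (O i)) (hJ : ∀ j, IsLocal C (J j)) (hD : ∀ j, IsLocal C (D j))
    (hu : ∀ i, (K i)ᴴ * K i = 1) (h : ∀ i j, (J j * K i) *ᵥ s i j = ω i j • t i j)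
    (hs : ∀ i j, O i *ᵥ s 0 j = s i j) (ht : ∀ i j, D j *ᵥ t i 0 = t i j) (h0 : ∀ i j, t i j ≠ 0)
    (i : X) (j : Y) : ω i j * ω 0 0 = ω i 0 * ω 0 j := by
  -- This operator takes the decoded state with left label 0 to that with label `i`, up to the
  -- phases. Acting on `A`, it commutes with everything done on `C`.
  have hM : IsLocal A (K i * O i * (K 0)ᴴ) := ((hK i).mul (hO i)).mul (hK 0).conjTranspose
  have h1 : ∀ j, ω 0 j • ((K i * O i * (K 0)ᴴ) *ᵥ t 0 j) = ω i j • t i j := fun j => by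
    rw [← Matrix.mulVec_smul, ← h, Matrix.mulVec_mulVec, ← h, ← hs i j, Matrix.mulVec_mulVec]
    congr 1
    calc K i * O i * (K 0)ᴴ * (J j * K 0) = K i * O i * (K 0)ᴴ * J j * K 0 := (mul_assoc _ _ _).symm
      _ = J j * (K i * O i * (K 0)ᴴ) * K 0 := by rw [hM.comm (hJ j) hd]
      _ = J j * (K i * O i * ((K 0)ᴴ * K 0)) := by simp only [mul_assoc]
      _ = _ := by rw [hu, mul_one, mul_assoc]
  have h2 : (ω i j * ω 0 0) • t i j = (ω i 0 * ω 0 j) • t i j := by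
    calc (ω i j * ω 0 0) • t i j = ω 0 0 • (ω i j • t i j) := by rw [smul_smul, mul_comm]
      _ = ω 0 0 • ω 0 j • ((K i * O i * (K 0)ᴴ) *ᵥ (D j *ᵥ t 0 0)) := by rw [← h1, ht]
      _ = ω 0 j • (D j *ᵥ (ω 0 0 • ((K i * O i * (K 0)ᴴ) *ᵥ t 0 0))) := by
          rw [Matrix.mulVec_mulVec, hM.comm (hD j) hd, ← Matrix.mulVec_mulVec, Matrix.mulVec_smul,
            smul_comm]
      _ = (ω i 0 * ω 0 j) • t i j := by
          rw [h1, Matrix.mulVec_smul, ht, smul_smul, mul_comm]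
  exact smul_left_injective ℂ (h0 i j) h2

end Frame

end

end HaPPY

namespace HaPPY

noncomputable section

set_option linter.unusedSectionVars false

/-! ### The decoding circuits -/

variable {ι β LA LC R : Type} [Fintype ι] [DecidableEq ι] [Fintype β] [DecidableEq β] [Fintype LA]
  [Fintype LC] [Fintype R] [DecidableEq R]

namespace Frame

variable {V : Matrix (ι → ZMod 2) (β → ZMod 2) ℂ} {A C : Finset ι} {a c : Finset β}
  {P : (LA ⊕ LC) ⊕ (R ⊕ R) ≃ ι} {S T : Matrix (ι → ZMod 2) (ι → ZMod 2) ℂ}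
  {lam : LA ⊕ LC → (β → ZMod 2) → ZMod 2} {ζ ξ : R → (β → ZMod 2) → ZMod 2}

theorem lam_left_add (F : Frame V A C a c P S T lam ζ ξ) (i : ↥a → ZMod 2) (j : ↥c → ZMod 2)
    (d : LA) : lam (.inl d) (ext a i + ext c j) = lam (.inl d) (ext a i) :=
  F.lam_left d _ _ fun l hl => by
    rw [Pi.add_apply, ext_not_mem j fun h => (F.compl_bulk l).2 h hl, add_zero]

theorem lam_right_add (F : Frame V A C a c P S T lam ζ ξ) (i : ↥a → ZMod 2) (j : ↥c → ZMod 2)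
    (d : LC) : lam (.inr d) (ext a i + ext c j) = lam (.inr d) (ext c j) :=
  F.lam_right d _ _ fun l hl => by
    rw [Pi.add_apply, ext_not_mem i ((F.compl_bulk l).2 hl), zero_add]

theorem eig_support (F : Frame V A C a c P S T lam ζ ξ) {b : β → ZMod 2} {x : ι → ZMod 2}
    (hx : ((T * S) *ᵥ col V b) x ≠ 0) (l : LA ⊕ LC) : x (P (.inl l)) = lam l b := by
  have h := congrFun (F.eig b l) x
  rw [pauli_act, Pi.smul_apply, add_zero, single_one_dotProduct, smul_eq_mul] at h
  exact sgn_injective (mul_right_cancel₀ hx h)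

theorem place_not_mem_left (F : Frame V A C a c P S T lam ζ ξ) (x : LA → ZMod 2) (y : R → ZMod 2)
    {k : ι} (hk : k ∉ A) : place P (Sum.elim x 0) y 0 k = 0 := by
  obtain ⟨n, rfl⟩ := P.surjective k
  rcases n with (d | d) | r | r
  · exact absurd (F.loc_left d) hk
  · rw [place_local]; rfl
  · exact absurd (F.link_left r) hk
  · rw [place_right]; rfl

theorem place_not_mem_right (F : Frame V A C a c P S T lam ζ ξ) (x : LC → ZMod 2) (z : R → ZMod 2)
    {k : ι} (hk : k ∉ C) : place P (Sum.elim 0 x) 0 z k = 0 := by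
  obtain ⟨n, rfl⟩ := P.surjective k
  rcases n with (d | d) | r | r
  · rw [place_local]; rfl
  · exact absurd (F.loc_right d) hk
  · rw [place_left]; rfl
  · exact absurd (F.link_right r) hk

/-- Pauli strings controlled by the logical qubits complete the decoding of the two halves. -/
theorem exists_circuits (F : Frame V A C a c P S T lam ζ ξ) (hV : ∀ b, ∑ x, ‖V x b‖ ^ 2 = 1)
    (hA : Recoverable V a A) (hC : Recoverable V c C) :
    ∃ (n n' : ℕ) (wA : ↥a ⊕ Fin n ≃ LA) (wC : ↥c ⊕ Fin n' ≃ LC)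
      (XA : (↥a → ZMod 2) → Matrix (↥A → ZMod 2) (↥A → ZMod 2) ℂ)
      (XC : (↥c → ZMod 2) → Matrix (↥C → ZMod 2) (↥C → ZMod 2) ℂ),
      (∀ i, IsPauli (XA i)) ∧ (∀ j, IsPauli (XC j)) ∧
      (Function.Injective fun (i : ↥a → ZMod 2) v => lam (.inl (wA (.inl v))) (ext a i)) ∧
      (Function.Injective fun (j : ↥c → ZMod 2) v => lam (.inr (wC (.inl v))) (ext c j)) ∧
      ∀ (qA : ↥a → ↥A) (qC : ↥c → ↥C), (∀ v, (qA v : ι) = P (.inl (.inl (wA (.inl v))))) →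
        (∀ v, (qC v : ι) = P (.inl (.inr (wC (.inl v))))) →
        (∑ i, projAt qA i * XA i)ᴴ * (∑ i, projAt qA i * XA i) = 1 ∧
        (∑ j, projAt qC j * XC j)ᴴ * (∑ j, projAt qC j * XC j) = 1 ∧
        ∀ i j, localOp C (∑ j, projAt qC j * XC j) *ᵥ (localOp A (∑ i, projAt qA i * XA i) *ᵥ
          ((T * S) *ᵥ col V (ext a i + ext c j))) = fun x => modelState P (x +
            (place P (Sum.elim (fun d => Sum.elim i 0 (wA.symm d)) 0) 0 0 +
              place P (Sum.elim 0 fun d => Sum.elim j 0 (wC.symm d)) 0 0)) := by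
  obtain ⟨n, wA, hwA⟩ := F.exists_logical hV hA
  obtain ⟨n', wC, hwC⟩ := F.symm.exists_logical hV hC
  -- Erase the parities of the local qubits of `A`, write `i` onto the logical ones, and correct the
  -- links as for right label 0.
  set uA : (↥a → ZMod 2) → ι → ZMod 2 := fun i => place P
    (Sum.elim (fun d => lam (.inl d) (ext a i) + Sum.elim i 0 (wA.symm d)) 0)
    (fun r => ζ r (ext a i)) 0 with huA
  set vA : (↥a → ZMod 2) → ι → ZMod 2 := fun i => place P (Sum.elim 0 0)
    (fun r => ξ r (ext a i)) 0 with hvA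
  -- The link corrections are affine: the value at the joint label is that at `i` plus the change
  -- caused by `j`. The other half supplies this change.
  set uC : (↥c → ZMod 2) → ι → ZMod 2 := fun j => place P
    (Sum.elim 0 (fun d => lam (.inr d) (ext c j) + Sum.elim j 0 (wC.symm d)))
    0 (fun r => ζ r (ext c j) + ζ r 0) with huC
  set vC : (↥c → ZMod 2) → ι → ZMod 2 := fun j => place P (Sum.elim 0 0)
    0 (fun r => ξ r (ext c j) + ξ r 0) with hvC
  set shA : (↥a → ZMod 2) → ι → ZMod 2 := fun i =>
    place P (Sum.elim (fun d => Sum.elim i 0 (wA.symm d)) 0) 0 0 with hshA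
  set shC : (↥c → ZMod 2) → ι → ZMod 2 := fun j =>
    place P (Sum.elim 0 fun d => Sum.elim j 0 (wC.symm d)) 0 0 with hshC
  have euA : ∀ i l, l ∉ A → uA i l = 0 := fun i l hl => F.place_not_mem_left _ _ hl
  have evA : ∀ i l, l ∉ A → vA i l = 0 := fun i l hl => F.place_not_mem_left _ _ hl
  have euC : ∀ i l, l ∉ C → uC i l = 0 := fun i l hl => F.place_not_mem_right _ _ hl
  have evC : ∀ i l, l ∉ C → vC i l = 0 := fun i l hl => F.place_not_mem_right _ _ hl
  have eshC : ∀ i l, l ∉ C → shC i l = 0 := fun i l hl => F.place_not_mem_right _ _ hl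
  have eshC0 : shC 0 = 0 := by
    funext k
    obtain ⟨m, rfl⟩ := P.surjective k
    rcases m with (d | d) | r | r
    · simp only [hshC, place_local]; rfl
    · simp only [hshC, place_local, Sum.elim_inr]
      rcases wC.symm d with v | v <;> rfl
    · simp only [hshC, place_left]; rfl
    · simp only [hshC, place_right]; rfl
  set t : (↥a → ZMod 2) → (↥c → ZMod 2) → (ι → ZMod 2) → ℂ := fun i j =>
    pauli (shA i + shC j) 0 *ᵥ modelState P with ht
  have hkey : ∀ i j, ∃ ω : ℂ, ‖ω‖ = 1 ∧ (pauli (uC j) (vC j) * pauli (uA i) (vA i)) *ᵥ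
      ((T * S) *ᵥ col V (ext a i + ext c j)) = ω • t i j := by
    intro i j
    obtain ⟨k, hk, h⟩ := F.key (ext a i + ext c j) (shA i + shC j + (uC j + uA i)) (vC j + vA i)
      (by
        rintro (d | d)
        · simp only [Pi.add_apply, huA, huC, hshA, hshC, place_local, Sum.elim_inl, Pi.zero_apply,
            add_zero, zero_add]
          rw [F.lam_left_add]
          linear_combination zadd_self (Sum.elim i 0 (wA.symm d))
        · simp only [Pi.add_apply, huA, huC, hshA, hshC, place_local, Sum.elim_inr, Pi.zero_apply,
            add_zero, zero_add]
          rw [F.lam_right_add]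
          linear_combination zadd_self (Sum.elim j 0 (wC.symm d)))
      (by
        intro r
        simp only [Pi.add_apply, huA, huC, hshA, hshC, place_left, place_right, Pi.zero_apply,
          add_zero, zero_add]
        linear_combination -F.aff_ζ r (ext a i) (ext c j) + zadd_self (ζ r 0))
      (by
        intro r
        simp only [Pi.add_apply, hvA, hvC, place_left, place_right, Pi.zero_apply,
          add_zero, zero_add]
        linear_combination -F.aff_ξ r (ext a i) (ext c j) + zadd_self (ξ r 0))
    refine ⟨sgn (vC j ⬝ᵥ uA i) * k, by rw [norm_mul, norm_sgn, hk, one_mul], ?_⟩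
    have h1 := congrArg (pauli (shA i + shC j) 0 *ᵥ ·) h
    simp only [Matrix.mulVec_smul] at h1
    rw [Matrix.mulVec_mulVec, pauli_mul, zero_dotProduct, sgn_zero, one_smul, ← add_assoc,
      fadd_self, zero_add, zero_add] at h1
    rw [pauli_mul, Matrix.smul_mulVec, h1, smul_smul]
  choose ω hω hact using hkey
  have hω0 : ∀ i j, ω i j ≠ 0 := fun i j h => by
    have := hω i j
    rw [h, norm_zero] at this
    exact zero_ne_one this
  -- The phase of the joint correction is not a priori a product. It factors because the bulk label
  -- `i` can be changed from `A` and the label `j` of the decoded state from `C`.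
  have hmul := phase_mul (ω := ω) (K := fun i => pauli (uA i) (vA i) * S)
    (O := fun i => (hA.exists_single 0 i).choose)
    (J := fun j => pauli (uC j) (vC j) * T) (D := fun j => pauli (shC j) 0)
    (s := fun i j => col V (ext a i + ext c j)) (t := t) F.disjoint
    (fun i => (isLocal_pauli (euA i) (evA i)).mul F.isLocal_left)
    (fun i => (hA.exists_single 0 i).choose_spec.1)
    (fun j => (isLocal_pauli (euC j) (evC j)).mul F.isLocal_right)
    (fun j => isLocal_pauli (eshC j) fun _ _ => rfl)
    (fun i => by
      rw [conjTranspose_mul, mul_assoc, ← mul_assoc _ _ S, pauli_conjTranspose_mul, one_mul,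
        F.unitary_left])
    (fun i j => by
      rw [← hact, Matrix.mulVec_mulVec]
      congr 1
      calc pauli (uC j) (vC j) * T * (pauli (uA i) (vA i) * S)
          = pauli (uC j) (vC j) * (T * pauli (uA i) (vA i)) * S := by simp only [mul_assoc]
        _ = _ := by
          rw [F.isLocal_right.comm (isLocal_pauli (euA i) (evA i)) F.disjoint.symm]
          simp only [mul_assoc])
    (fun i j => by
      rw [(hA.exists_single 0 i).choose_spec.2, if_pos]
      · congr 1
        funext l
        by_cases hl : l ∈ a
        · rw [glue_mem _ _ hl, Pi.add_apply, ext_mem _ hl,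
            ext_not_mem _ fun h => (F.compl_bulk l).2 h hl, add_zero]
        · rw [glue_not_mem _ _ hl, Pi.add_apply, Pi.add_apply, ext_not_mem _ hl, ext_not_mem _ hl]
      · funext l
        rw [Pi.add_apply, ext_zero, ext_not_mem _ fun h => (F.compl_bulk l.1).2 h l.2]; rfl)
    (fun i j => by
      simp only [ht]
      rw [Matrix.mulVec_mulVec, pauli_mul, zero_dotProduct, sgn_zero, one_smul, eshC0, add_zero,
        zero_add, add_comm])
    (fun i j h => by
      simp only [ht] at h
      have h1 := congrArg (pauli (shA i + shC j) 0 *ᵥ ·) h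
      simp only [Matrix.mulVec_mulVec, pauli_mul, zero_dotProduct, sgn_zero, one_smul, fadd_self,
        zero_add, pauli_zero, Matrix.one_mulVec, Matrix.mulVec_zero] at h1
      have h2 := modelState_norm (P := P)
      rw [h1] at h2
      simp at h2)
  -- By the factorization `ω i j = ω i 0 * ω 0 j / ω 0 0`. The first factor is removed on `A`, the
  -- rest on `C`.
  refine ⟨n, n', wA, wC, fun i => (ω i 0)⁻¹ • pauli (fun l : ↥A => uA i l) (fun l : ↥A => vA i l),
    fun j => (ω 0 0 * (ω 0 j)⁻¹) • pauli (fun l : ↥C => uC j l) (fun l : ↥C => vC j l),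
    fun i => ⟨_, _, _, by rw [norm_inv, hω, inv_one], rfl⟩,
    fun j => ⟨_, _, _, by rw [norm_mul, norm_inv, hω, hω, inv_one, mul_one], rfl⟩, hwA, hwC,
    fun qA qC hqA hqC => ?_⟩
  have ctrlA : ∀ i v, uA i (qA v) = lam (.inl (wA (.inl v))) (ext a i) + i v := fun i v => by
    rw [hqA]; simp only [huA, place_local, Sum.elim_inl, Equiv.symm_apply_apply]
  have ctrlC : ∀ j v, uC j (qC v) = lam (.inr (wC (.inl v))) (ext c j) + j v := fun j v => by
    rw [hqC]; simp only [huC, place_local, Sum.elim_inr, Sum.elim_inl, Equiv.symm_apply_apply]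
  have hpA : Function.Injective fun i => i + fun l => uA i (qA l) := by
    intro i i' h
    refine hwA (funext fun v => ?_)
    have h1 := congrFun h v
    simp only [Pi.add_apply, ctrlA] at h1
    linear_combination h1 - zadd_self (i v) + zadd_self (i' v)
  have hpC : Function.Injective fun j => j + fun l => uC j (qC l) := by
    intro i i' h
    refine hwC (funext fun v => ?_)
    have h1 := congrFun h v
    simp only [Pi.add_apply, ctrlC] at h1
    simp only [Sum.swap_inl]
    linear_combination h1 - zadd_self (i v) + zadd_self (i' v)
  refine ⟨controlled_unitary qA (fun i => by rw [norm_inv, hω, inv_one]) hpA,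
    controlled_unitary qC (fun j => by rw [norm_mul, norm_inv, hω, hω, inv_one, mul_one]) hpC,
    fun i j => ?_⟩
  rw [controlled_mulVec qA euA evA hpA i, controlled_mulVec qC euC evC hpC j, Matrix.mulVec_smul,
    smul_smul, Matrix.mulVec_mulVec, hact, smul_smul]
  · have h1 : ω 0 0 * (ω 0 j)⁻¹ * (ω i 0)⁻¹ * ω i j = 1 := by
      have := hmul i j
      have h2 := hω0 0 j
      have h3 := hω0 i 0
      field_simp
      linear_combination this
    rw [h1, one_smul]
    funext x
    simp only [ht]
    rw [pauli_act, zero_dotProduct, sgn_zero, one_mul]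
  · intro x hx v
    rw [ctrlC, hqC]
    rw [Pi.smul_apply, pauli_act, smul_eq_mul] at hx
    have h1 := F.eig_support (right_ne_zero_of_mul (right_ne_zero_of_mul hx))
      (.inr (wC (.inl v)))
    rw [Pi.add_apply, F.lam_right_add] at h1
    simp only [huA, place_local, Sum.elim_inr, Pi.zero_apply, add_zero] at h1
    rw [h1]
    linear_combination -zadd_self (j v)
  · intro x hx v
    rw [ctrlA, hqA, F.eig_support hx, F.lam_left_add]
    linear_combination -zadd_self (i v)

end Frame

end

end HaPPY

namespace HaPPY

noncomputable section

set_option linter.unusedSectionVars false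

/-! ### Positions of the qubits of an interval and its complement -/

section Positions

variable {ι X Y R : Type} [Fintype ι] [DecidableEq ι] [Fintype X] [Fintype Y] [Fintype R] {N : ℕ}

/-- The qubits of a subsystem and of its complement, each consisting of local qubits and one qubit
for each link. -/
def joinHalves {A : Finset ι} (P : X ⊕ R ≃ ↥A) (Q : Y ⊕ R ≃ ↥Aᶜ) : (X ⊕ Y) ⊕ (R ⊕ R) ≃ ι :=
  ((Equiv.sumSumSumComm X Y R R).trans (P.sumCongr (Q.trans (Equiv.subtypeEquivRight fun _ =>
    Finset.mem_compl)))).trans (Equiv.sumCompl (· ∈ A))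

theorem card_initialSegment (e : Fin N ≃ ι) {m : ℕ} (hm : m ≤ N) :
    Fintype.card ↥(initialSegment e m) = m := by
  have : Fintype.card ↥(initialSegment e m) = Fintype.card (Fin m) := by
    refine Fintype.card_congr ?_
    exact
      { toFun := fun l => ⟨e.symm l.1, (mem_initialSegment e m l.1).1 l.2⟩
        invFun := fun k => ⟨e ⟨k, k.2.trans_le hm⟩, by
          rw [mem_initialSegment, Equiv.symm_apply_apply]; exact k.2⟩
        left_inv := fun l => Subtype.ext (by simp)
        right_inv := fun k => by simp }
  rw [this, Fintype.card_fin]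

theorem consecutive_initialSegment (e : Fin N ≃ ι) (m : ℕ) :
    Consecutive e (initialSegment e m) := by
  intro l hl k hk k' hk'
  rw [mem_initialSegment] at hl hk hk'
  rw [Fin.lt_def, Fin.lt_def]
  omega

theorem consecutive_compl_initialSegment (e : Fin N ≃ ι) (m : ℕ) :
    Consecutive e (initialSegment e m)ᶜ := by
  intro l hl k hk k' hk'
  rw [Finset.mem_compl, mem_initialSegment] at hl hk hk'
  rw [Fin.lt_def, Fin.lt_def]
  omega

/-- The links between an interval and its complement can be placed around the end of the interval
such that they are nested. -/
theorem exists_nested (e : Fin N ≃ ι) {m : ℕ} (hm : m ≤ N)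
    (hX : Fintype.card X + Fintype.card R = Fintype.card ↥(initialSegment e m))
    (hY : Fintype.card Y + Fintype.card R = Fintype.card ↥(initialSegment e m)ᶜ) :
    ∃ (P : X ⊕ R ≃ ↥(initialSegment e m)) (Q : Y ⊕ R ≃ ↥(initialSegment e m)ᶜ) (t : R → ℕ),
      Nested e (joinHalves P Q) t := by
  have hcA := card_initialSegment e hm
  have hcC : Fintype.card ↥(initialSegment e m)ᶜ = N - m := by
    rw [Fintype.card_coe, Finset.card_compl, ← Fintype.card_coe, hcA, ← Fintype.card_congr e,
      Fintype.card_fin]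
  let T := Fintype.equivFin R
  have hT : ∀ r, (T r : ℕ) < m ∧ (T r : ℕ) < N - m := fun r => by
    have := (T r).2; omega
  -- The link with number `T r` uses the two qubits at distance `T r` from the cut, so a smaller
  -- number means an inner link.
  let p : R → ↥(initialSegment e m) := fun r => ⟨e ⟨m - 1 - T r, by have := hT r; omega⟩, by
    rw [mem_initialSegment, Equiv.symm_apply_apply]
    have := hT r
    change m - 1 - (T r : ℕ) < m
    omega⟩
  let q : R → ↥(initialSegment e m)ᶜ := fun r => ⟨e ⟨m + T r, by have := hT r; omega⟩, by
    rw [Finset.mem_compl, mem_initialSegment, Equiv.symm_apply_apply]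
    change ¬ m + (T r : ℕ) < m
    omega⟩
  have hp : ∀ r, (e.symm (p r).1 : ℕ) = m - 1 - T r := fun r => by
    change (e.symm (e _) : ℕ) = _; rw [Equiv.symm_apply_apply]
  have hq : ∀ r, (e.symm (q r).1 : ℕ) = m + T r := fun r => by
    change (e.symm (e _) : ℕ) = _; rw [Equiv.symm_apply_apply]
  obtain ⟨P, hP⟩ := exists_sum_equiv (q := p) (Z := X) (fun r r' h => T.injective (Fin.ext (by
    have h1 := hp r
    have h2 := hT r
    have h3 := hT r'
    rw [h, hp r'] at h1
    omega))) (by omega)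
  obtain ⟨Q, hQ⟩ := exists_sum_equiv (q := q) (Z := Y) (fun r r' h => T.injective (Fin.ext (by
    have h1 := hq r
    rw [h, hq r'] at h1
    omega))) (by omega)
  refine ⟨(Equiv.sumComm X R).trans P, (Equiv.sumComm Y R).trans Q, fun r => T r, fun r => ?_⟩
  have eP : ∀ r, joinHalves ((Equiv.sumComm X R).trans P) ((Equiv.sumComm Y R).trans Q)
      (.inr (.inl r)) = (p r).1 := fun r => congrArg Subtype.val (hP r)
  have eQ : ∀ r, joinHalves ((Equiv.sumComm X R).trans P) ((Equiv.sumComm Y R).trans Q)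
      (.inr (.inr r)) = (q r).1 := fun r => congrArg Subtype.val (hQ r)
  simp only [eP, eQ, Fin.lt_def, hp, hq]
  have hr := hT r
  refine ⟨by omega, fun l => ⟨fun ⟨h1, h2⟩ => ?_, ?_⟩⟩
  · by_cases hl : (e.symm l : ℕ) < m
    · have hlt : m - 1 - (e.symm l : ℕ) < Fintype.card R := by
        have := (T r).2; omega
      refine ⟨T.symm ⟨_, hlt⟩, ?_, Or.inl (e.symm.injective (Fin.ext ?_))⟩
      · rw [Equiv.apply_symm_apply]; change m - 1 - (e.symm l : ℕ) < _; omega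
      · rw [hp, Equiv.apply_symm_apply]; change _ = m - 1 - (m - 1 - (e.symm l : ℕ)); omega
    · have hlt : (e.symm l : ℕ) - m < Fintype.card R := by
        have := (T r).2; omega
      refine ⟨T.symm ⟨_, hlt⟩, ?_, Or.inr (e.symm.injective (Fin.ext ?_))⟩
      · rw [Equiv.apply_symm_apply]; change (e.symm l : ℕ) - m < _; omega
      · rw [hq, Equiv.apply_symm_apply]; change _ = m + ((e.symm l : ℕ) - m); omega
  · rintro ⟨r', h1, rfl | rfl⟩
    · rw [hp]; omega
    · rw [hq]; omega

theorem val_finRotate_pow (k : Fin N) (m : ℕ) : ((finRotate N ^ m) k : ℕ) = (k + m) % N := by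
  induction m with
  | zero => rw [pow_zero, add_zero, Nat.mod_eq_of_lt k.2]; rfl
  | succ m ih =>
    obtain ⟨n, rfl⟩ : ∃ n, N = n + 1 := ⟨N - 1, by have := k.2; omega⟩
    rw [pow_succ', Equiv.Perm.mul_apply, finRotate_apply, Fin.val_add, ih, Fin.val_one',
      ← Nat.add_mod, add_assoc]

/-- Moving the pivot to the end of an interval does not change the order in its complement. -/
theorem sameOrder_rotate (e : Fin N ≃ ι) {m : ℕ} (hm : m ≤ N) :
    SameOrder e ((finRotate N ^ m).trans e) (initialSegment e m)ᶜ
      (fun l => if l ∈ initialSegment e m then 1 else 0) := by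
  set e' : Fin N ≃ ι := (finRotate N ^ m).trans e
  have hpos : ∀ l, (e.symm l : ℕ) = ((e'.symm l : ℕ) + m) % N := fun l => by
    rw [← val_finRotate_pow]
    congr 1
    rw [Equiv.symm_apply_eq]
    exact (e'.apply_symm_apply l).symm
  have hcase : ∀ l, (m ≤ (e.symm l : ℕ) ∧ (e.symm l : ℕ) = e'.symm l + m) ∨
      ((e.symm l : ℕ) < m ∧ (e.symm l : ℕ) + N = e'.symm l + m) := fun l => by
    have h1 := hpos l
    have h2 := (e'.symm l).2
    by_cases h : (e'.symm l : ℕ) + m < N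
    · rw [Nat.mod_eq_of_lt h] at h1
      omega
    · rw [Nat.mod_eq_sub_mod (by omega), Nat.mod_eq_of_lt (by omega)] at h1
      omega
  refine ⟨fun l hl => if_neg (Finset.mem_compl.1 hl), fun k hk => funext fun l => ?_⟩
  rw [Finset.mem_compl, mem_initialSegment] at hk
  have hk' := hcase k.1
  have hl' := hcase l
  have := (e.symm k.1).2
  have := (e'.symm k.1).2
  rw [Pi.add_apply]
  unfold jw
  simp only [mem_initialSegment, Fin.lt_def]
  -- A qubit of the interval precedes all of the complement for `e` and follows all of it for the
  -- new pivot. Within the complement the order is unchanged.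
  by_cases hl : (e.symm l : ℕ) < m
  · have hne : l ≠ k.1 := fun h => hk (h ▸ hl)
    rw [if_neg, if_pos hl, if_pos (Or.inl (by omega)), zadd_self]
    rintro (h | h)
    · omega
    · exact hne h.1
  · rw [if_neg hl, zero_add]
    refine if_congr (or_congr ?_ Iff.rfl) rfl rfl
    omega

end Positions

/-! ### Nodes and their parities -/

section Parities

variable {ι β : Type} [Fintype ι] [DecidableEq ι] [Fintype β] [DecidableEq β] {N : ℕ}

theorem isAff_affine (c : ZMod 2) (z : β → ZMod 2) : IsAff fun b => c + ∑ w, z w * b w := by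
  intro b b'
  simp only [Pi.add_apply, mul_add, Finset.sum_add_distrib, Pi.zero_apply, mul_zero,
    Finset.sum_const_zero]
  ring

theorem IsAff.add {s t : (β → ZMod 2) → ZMod 2} (hs : IsAff s) (ht : IsAff t) :
    IsAff fun b => s b + t b := fun b b' => by
  linear_combination hs b b' + ht b b'

theorem IsAff.const (c : ZMod 2) : IsAff fun _ : β → ZMod 2 => c := fun _ _ => rfl

theorem IsAff.sum {α : Type} (F : Finset α) {s : α → (β → ZMod 2) → ZMod 2}
    (h : ∀ r, IsAff (s r)) : IsAff fun b => ∑ r ∈ F, s r b := fun b b' => by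
  rw [← Finset.sum_add_distrib, ← Finset.sum_add_distrib]
  exact Finset.sum_congr rfl fun r _ => h r b b'

theorem exists_node_parity {V : Matrix (ι → ZMod 2) (β → ZMod 2) ℂ} {e : Fin N ≃ ι}
    {μ : Equiv.Perm ι}
    (hdim : ∀ p, ∃ (c : ZMod 2) (z : β → ZMod 2), ∀ b,
      HasDimer e (col V b) (p, 0) (μ p, 1) (c + ∑ w, z w * b w)) :
    ∃ s : ι × ZMod 2 → (β → ZMod 2) → ZMod 2, (∀ n, IsAff (s n)) ∧
      ∀ n b, HasDimer e (col V b) n (pairing μ n) (s n b) := by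
  choose c z h using hdim
  refine ⟨fun n b => if n.2 = 0 then c n.1 + ∑ w, z n.1 w * b w else
    (c (μ.symm n.1) + ∑ w, z (μ.symm n.1) w * b w) + 1, ?_, ?_⟩
  · rintro ⟨p, c'⟩
    rcases zmod_two_cases c' with rfl | rfl
    · exact isAff_affine _ _
    · exact (isAff_affine _ _).add (.const 1)
  · rintro ⟨p, c'⟩ b
    rcases zmod_two_cases c' with rfl | rfl
    · exact h p b
    · have := (h (μ.symm p) b).symm
      rw [Equiv.apply_symm_apply] at this
      exact this

theorem nodePerm_inv {A : Finset ι} {S : List ((ι × ZMod 2) × (ι × ZMod 2))}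
    {f : Equiv.Perm (↥A × ZMod 2)}
    (h : ∀ n, nodePerm S (upNode Subtype.val n) = upNode Subtype.val (f n)) (n : ↥A × ZMod 2) :
    (nodePerm S)⁻¹ (upNode Subtype.val n) = upNode Subtype.val (f.symm n) := by
  rw [Equiv.Perm.inv_eq_iff_eq, h, Equiv.apply_symm_apply]

end Parities

end

end HaPPY

namespace HaPPY

noncomputable section

set_option linter.unusedSectionVars false

/-! ### Dimer swaps that separate the two halves -/

section Separate

variable {ι β R : Type} [Fintype ι] [DecidableEq ι] [Fintype β] [DecidableEq β] [Fintype R]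
  [DecidableEq R] {N : ℕ}

theorem sum_norm_mulVec {M : Matrix (ι → ZMod 2) (ι → ZMod 2) ℂ} (hM : Mᴴ * M = 1)
    (ψ : (ι → ZMod 2) → ℂ) : ∑ x, ‖(M *ᵥ ψ) x‖ ^ 2 = ∑ x, ‖ψ x‖ ^ 2 := by
  have h : ∀ φ : (ι → ZMod 2) → ℂ, ((∑ x, ‖φ x‖ ^ 2 : ℝ) : ℂ) = star φ ⬝ᵥ φ := fun φ => by
    rw [Complex.ofReal_sum]
    refine Finset.sum_congr rfl fun x _ => ?_
    rw [Complex.ofReal_pow, Pi.star_apply]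
    exact (Complex.conj_mul' (φ x)).symm
  apply Complex.ofReal_injective
  rw [h, h, Matrix.star_mulVec, ← Matrix.dotProduct_mulVec, Matrix.mulVec_mulVec, hM,
    Matrix.one_mulVec]

/-- A subsystem in which the dimers are paired does not see the bulk qubits that are recoverable
elsewhere. -/
theorem parity_eq_of_recoverable {V : Matrix (ι → ZMod 2) (β → ZMod 2) ℂ}
    (hV : ∀ b, ∑ x, ‖V x b‖ ^ 2 = 1) {A C : Finset ι} {c : Finset β} (h : Recoverable V c C)
    (hd : Disjoint A C) {e : Fin N ≃ ι} (hA : Consecutive e A) {k l : ι × ZMod 2} (hkl : k ≠ l)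
    (hk : k.1 ∈ A) (hl : l.1 ∈ A) {b b' : β → ZMod 2} (hb : ∀ w, w ∉ c → b w = b' w) {p p' : ZMod 2}
    (h1 : HasDimer e (col V b) k l p) (h2 : HasDimer e (col V b') k l p') : p = p' := by
  rw [hasDimer_iff_mul hkl] at h1 h2
  exact sgn_injective (mul_left_cancel₀ I_ne_zero
    (h.eigenvalue_eq hd (isLocal_majorana_mul hA hk hl) hb h1 h2 (col_ne_zero hV b')))

/-- Dimers inside a half go to single qubits, those between the halves to nested links. An even
number of swaps keeps each operation in its half. An inner dimer is a bilinear acting on one half,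
so its parity cannot depend on bulk qubits recoverable from the other. -/
theorem exists_frame {V : Matrix (ι → ZMod 2) (β → ZMod 2) ℂ} (hV : ∀ b, ∑ x, ‖V x b‖ ^ 2 = 1)
    (e : Fin N ≃ ι) {m : ℕ} (hm : m ≤ N) {A : Finset ι}
    (hA : A = initialSegment e m) {a : Finset β}
    (hrec : ComplementaryRecovery V a A) {μ : Equiv.Perm ι}
    (hdim : ∀ p, ∃ (c : ZMod 2) (z : β → ZMod 2), ∀ b,
      HasDimer e (col V b) (p, 0) (μ p, 1) (c + ∑ w, z w * b w))
    {out : R → {p // p ∈ A ∧ μ p ∉ A}}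
    (ho : Function.Bijective out)
    {inn : R → {p // p ∉ A ∧ μ p ∈ A}}
    (hi : Function.Bijective inn)
    (hL : ∃ p, p ∈ A ↔ μ p ∈ A) :
    ∃ (P : InnerPair μ A ⊕ R ≃ ↥A)
      (Q : InnerPair μ Aᶜ ⊕ R ≃ ↥Aᶜ)
      (SA SB : List ((ι × ZMod 2) × (ι × ZMod 2)))
      (lam : InnerPair μ A ⊕ InnerPair μ Aᶜ →
        (β → ZMod 2) → ZMod 2) (ζ ξ : R → (β → ZMod 2) → ZMod 2),
      SwapsIn A SA ∧ Even SA.length ∧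
      SwapsIn Aᶜ SB ∧ Even SB.length ∧
      Frame V A Aᶜ a aᶜ (joinHalves P Q) (swapProd e SA)
        (swapProd e SB) lam ζ ξ ∧
      (∀ k : ↥Aᶜ × ZMod 2,
        ((nodePerm SB)⁻¹ (upNode Subtype.val k)).1 ∈ Aᶜ) ∧
      (∀ d b, HasDimer e (col V b) ((nodePerm SA)⁻¹ (P (.inl d), 0))
        ((nodePerm SA)⁻¹ (P (.inl d), 1)) (lam (.inl d) b)) ∧
      (∀ d b, HasDimer e (col V b) ((nodePerm SB)⁻¹ (Q (.inl d), 0))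
        ((nodePerm SB)⁻¹ (Q (.inl d), 1)) (lam (.inr d) b)) ∧
      (∀ r c b, ∃ p, HasDimer e (col V b) ((nodePerm SA)⁻¹ (P (.inr r), c))
        ((nodePerm SB)⁻¹ (Q (.inr r), c + 1)) p) := by
  have hd : Disjoint A Aᶜ := disjoint_compl_right
  have hcA : Consecutive e A := hA ▸ consecutive_initialSegment e m
  have hcC : Consecutive e Aᶜ := hA ▸ consecutive_compl_initialSegment e m
  have hX : Fintype.card (InnerPair μ A) + Fintype.card R = Fintype.card ↥A := by
    rw [Fintype.card_of_bijective ho, Fintype.card_subtype, Fintype.card_subtype, Fintype.card_coe,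
      ← Finset.card_filter_add_card_filter_not (s := A) fun p => μ p ∈ A]
    congr 2 <;> ext p <;> simp
  have hY : Fintype.card (InnerPair μ Aᶜ) + Fintype.card R = Fintype.card ↥Aᶜ := by
    rw [Fintype.card_of_bijective hi, Fintype.card_subtype, Fintype.card_subtype, Fintype.card_coe,
      ← Finset.card_filter_add_card_filter_not (s := Aᶜ) fun p => μ p ∈ Aᶜ]
    congr 2 <;> ext p <;> simp
  obtain ⟨P, Q, t, hn⟩ : ∃ (P : InnerPair μ A ⊕ R ≃ ↥A) (Q : InnerPair μ Aᶜ ⊕ R ≃ ↥Aᶜ) (t : R → ℕ),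
      Nested e (joinHalves P Q) t := by
    subst hA
    exact exists_nested e hm hX hY
  obtain ⟨f, g, harr⟩ := exists_arranged μ A ho hi P Q
  -- A dimer inside one half, given by `hL`, leaves the freedom to make both permutations even.
  obtain ⟨f, g, harr, hf, hg⟩ := harr.exists_even (pairing_involutive μ) (by
    obtain ⟨p, hp⟩ := hL
    by_cases h : p ∈ A
    · exact ⟨.inl ⟨p, h, hp.1 h⟩⟩
    · exact ⟨.inr ⟨p, Finset.mem_compl.2 h, Finset.mem_compl.2 fun h' => h (hp.2 h')⟩⟩)
  obtain ⟨SA, hSA, heA, hfA, hxA⟩ := exists_even_swaps A hf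
  obtain ⟨SB, hSB, heB, hgB, hxB⟩ := exists_even_swaps Aᶜ hg
  obtain ⟨s, hs, hdimer⟩ := exists_node_parity hdim
  set nA : ↥A × ZMod 2 → ι × ZMod 2 := fun n => upNode Subtype.val (f.symm n) with hnA
  set nB : ↥Aᶜ × ZMod 2 → ι × ZMod 2 := fun n => upNode Subtype.val (g.symm n) with hnB
  have invA : ∀ n, (nodePerm SA)⁻¹ (upNode Subtype.val n) = nA n := nodePerm_inv hfA
  have invB : ∀ n, (nodePerm SB)⁻¹ (upNode Subtype.val n) = nB n := nodePerm_inv hgB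
  have memA : ∀ n, (nA n).1 ∈ A := fun n => (f.symm n).1.2
  have memB : ∀ n, (nB n).1 ∈ Aᶜ := fun n => (g.symm n).1.2
  have moveA : ∀ n, nodePerm SB (nodePerm SA (nA n)) = upNode Subtype.val n := fun n => by
    rw [hnA, hfA, Equiv.apply_symm_apply]
    exact hxB _ fun h => Finset.mem_compl.1 h n.1.2
  have moveB : ∀ n, nodePerm SB (nodePerm SA (nB n)) = upNode Subtype.val n := fun n => by
    rw [hxA _ (Finset.mem_compl.1 (memB n)), hnB, hgB, Equiv.apply_symm_apply]
  have dA : ∀ d b, HasDimer e (col V b) (nA (P (.inl d), 0)) (nA (P (.inl d), 1))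
      (s (nA (P (.inl d), 0)) b) := fun d b => by
    have := hdimer (nA (P (.inl d), 0)) b
    rwa [harr.left] at this
  have dB : ∀ d b, HasDimer e (col V b) (nB (Q (.inl d), 0)) (nB (Q (.inl d), 1))
      (s (nB (Q (.inl d), 0)) b) := fun d b => by
    have := hdimer (nB (Q (.inl d), 0)) b
    rwa [harr.right] at this
  have dR : ∀ r c b, HasDimer e (col V b) (nA (P (.inr r), c)) (nB (Q (.inr r), c + 1))
      (s (nA (P (.inr r), c)) b) := fun r c b => by
    have := hdimer (nA (P (.inr r), c)) b
    rwa [harr.cross] at this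
  have neA : ∀ d, nA (P (.inl d), 0) ≠ nA (P (.inl d), 1) := fun d => by
    rw [hnA]; dsimp only; rw [← harr.left]; exact pairing_ne μ _
  have neB : ∀ d, nB (Q (.inl d), 0) ≠ nB (Q (.inl d), 1) := fun d => by
    rw [hnB]; dsimp only; rw [← harr.right]; exact pairing_ne μ _
  have move : ∀ {b k l p}, HasDimer e (col V b) k l p →
      HasDimer e ((swapProd e SB * swapProd e SA) *ᵥ col V b) (nodePerm SB (nodePerm SA k))
        (nodePerm SB (nodePerm SA l)) p := fun h => by
    rw [← Matrix.mulVec_mulVec]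
    exact (h.swapProd hSA).swapProd hSB
  set lam : InnerPair μ A ⊕ InnerPair μ Aᶜ → (β → ZMod 2) → ZMod 2 :=
    Sum.elim (fun d => s (nA (P (.inl d), 0))) fun d => s (nB (Q (.inl d), 0)) with hlam
  set σ : R → (β → ZMod 2) → ZMod 2 := fun r => s (nA (P (.inr r), 0))
  set τ : R → (β → ZMod 2) → ZMod 2 := fun r => s (nA (P (.inr r), 1))
  have uA := swapProd_unitary e hSA
  have uB := swapProd_unitary e hSB
  have dl : ∀ b l, HasDimer e ((swapProd e SB * swapProd e SA) *ᵥ col V b)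
      (joinHalves P Q (.inl l), 0) (joinHalves P Q (.inl l), 1) (lam l b) := by
    rintro b (d | d)
    · have := move (dA d b)
      rwa [moveA, moveA] at this
    · have := move (dB d b)
      rwa [moveB, moveB] at this
  refine ⟨P, Q, SA, SB, lam, fun r b => σ r b + τ r b,
    -- The XX value of a link is the parity of one of its dimers corrected by the ZZ values of all
    -- inner links, which replace the string between its two qubits.
    fun r b => τ r b + ∑ r' ∈ Finset.univ.filter (fun r' => t r' < t r), (σ r' b + τ r' b),
    hSA, heA, hSB, heB, ?_, fun k => invB k ▸ memB k, fun d b => ?_, fun d b => ?_,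
    fun r c b => ⟨s (nA (P (.inr r), c)) b, ?_⟩⟩
  · exact
    { compl := fun k => Finset.mem_compl.symm
      compl_bulk := fun k => Finset.mem_compl.symm
      loc_left := fun d => (P (.inl d)).2
      loc_right := fun d => (Q (.inl d)).2
      link_left := fun r => (P (.inr r)).2
      link_right := fun r => (Q (.inr r)).2
      isLocal_left := isLocal_swapProd hcA hSA heA
      isLocal_right := isLocal_swapProd hcC hSB heB
      unitary_left := uA
      unitary_right := uB
      lam_left := fun d b b' hb => parity_eq_of_recoverable hV hrec.2 hd hcA (neA d) (memA _)
        (memA _) (fun w hw => hb w (by simpa using hw)) (dA d b) (dA d b')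
      lam_right := fun d b b' hb => parity_eq_of_recoverable hV hrec.1 hd.symm hcC (neB d) (memB _)
        (memB _) (fun w hw => hb w (Finset.mem_compl.2 hw)) (dB d b) (dB d b')
      aff_lam := by rintro (d | d) <;> exact hs _
      aff_ζ := fun r => (hs _).add (hs _)
      aff_ξ := fun r => (hs _).add (.sum _ fun r' => (hs _).add (hs _))
      eig := fun b l => (dl b l).eig_local
      key := fun b u v hu hζ hξ => exists_pauli_mulVec_eq_of_dimers hn (by
          rw [sum_norm_mulVec (by
            rw [conjTranspose_mul, mul_assoc, ← mul_assoc _ᴴ (swapProd e SB), uB, one_mul, uA])]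
          exact hV b) (dl b) (fun r => by
          have := move (dR r 0 b)
          rwa [moveA, moveB] at this) (fun r => by
          have := move (dR r 1 b)
          rwa [moveA, moveB] at this) hu hζ hξ }
  · exact (invA (P (.inl d), 0)).symm ▸ (invA (P (.inl d), 1)).symm ▸ dA d b
  · exact (invB (Q (.inl d), 0)).symm ▸ (invB (Q (.inl d), 1)).symm ▸ dB d b
  · exact (invA (P (.inr r), c)).symm ▸ (invB (Q (.inr r), c + 1)).symm ▸ dR r c b

end Separate

end

end HaPPY

namespace HaPPY

noncomputable section

set_option linter.unusedSectionVars false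

/-! ### Product form of the decoded states, and the assembly of the theorem. -/

section Products

variable {ι : Type} [Fintype ι] [DecidableEq ι]

/-- An operator on `C` leaves the factors on `A` as they are. So undoing one decoding unitary only
changes the factor that becomes `χ`. -/
theorem localOp_mulVec_product {A C : Finset ι} (hd : Disjoint A C)
    (W : Matrix (↥C → ZMod 2) (↥C → ZMod 2) ℂ) (F : (↥A → ZMod 2) → (↥C → ZMod 2) → ℂ) :
    (localOp C W *ᵥ fun x => F (fun l => x l) fun l => x l) =
      fun x => ∑ z, W (fun l => x l) z * F (fun l => x l) z := by
  funext x
  rw [localOp_mulVec]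
  refine Finset.sum_congr rfl fun z _ => ?_
  have h1 : (fun l : ↥A => glue C z (fun l => x l) l) = fun l : ↥A => x l := funext fun l =>
    glue_not_mem _ _ (Finset.disjoint_left.1 hd l.2)
  have h2 : (fun l : ↥C => glue C z (fun l => x l) l) = z := funext fun l => glue_mem _ _ l.2
  rw [h1, h2]

/-- Shifting the local zeros by `i` and `j` writes the labels onto the logical qubits of the two
halves and leaves zeros on the auxiliary ones. -/
theorem modelState_add_place {LA LC R α α' γ γ' : Type} [Fintype LA] [Fintype LC] [Fintype R]
    [Fintype α] [Fintype α'] [Fintype γ] [Fintype γ'] (P : (LA ⊕ LC) ⊕ (R ⊕ R) ≃ ι)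
    (w : α ⊕ γ ≃ LA) (w' : α' ⊕ γ' ≃ LC) (i : α → ZMod 2) (j : α' → ZMod 2) (x : ι → ZMod 2) :
    modelState P (x + (place P (Sum.elim (fun d => Sum.elim i 0 (w.symm d)) 0) 0 0 +
        place P (Sum.elim 0 fun d => Sum.elim j 0 (w'.symm d)) 0 0)) =
      ketAt (fun v => P (.inl (.inl (w (.inl v))))) i x *
        ketAt (fun v => P (.inl (.inr (w' (.inl v))))) j x *
        ketAt (fun u => P (.inl (.inl (w (.inr u))))) 0 x *
        ketAt (fun u => P (.inl (.inr (w' (.inr u))))) 0 x *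
        ∏ r, bell (x (P (.inr (.inl r)))) (x (P (.inr (.inr r)))) := by
  unfold modelState ketAt
  simp only [Pi.add_apply, place_local, place_left, place_right, Pi.zero_apply, add_zero]
  congr 1
  have h : (∀ l : LA ⊕ LC, x (P (.inl l)) + (Sum.elim (fun d => Sum.elim i 0 (w.symm d)) 0 l +
      (Sum.elim 0 fun d => Sum.elim j 0 (w'.symm d) : LA ⊕ LC → ZMod 2) l) = 0) ↔
      (((∀ v, x (P (.inl (.inl (w (.inl v))))) = i v) ∧
        ∀ v, x (P (.inl (.inr (w' (.inl v))))) = j v) ∧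
        ∀ u, x (P (.inl (.inl (w (.inr u))))) = 0) ∧
        ∀ u, x (P (.inl (.inr (w' (.inr u))))) = 0 := by
    rw [Sum.forall, ← w.forall_congr_right, ← w'.forall_congr_right, Sum.forall, Sum.forall]
    simp only [Sum.elim_inl, Sum.elim_inr, Equiv.symm_apply_apply, Pi.zero_apply, add_zero,
      zero_add, CharTwo.add_eq_zero]
    tauto
  rw [if_congr h rfl rfl]
  split_ifs <;> first | tauto | simp

end Products

theorem mem_rtEdges {Λ : Finset Tile} {a : Finset ↥Λ} {A : Finset ↥(openLegs Λ)}
    (p : Tile × Fin 5) : p ∈ rtEdges Λ a A ↔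
      (p ∈ bondLegs Λ ∧ p.1 ∈ a.map (Function.Embedding.subtype _) ∧
        ¬ nbr p.1 p.2 ∈ a.map (Function.Embedding.subtype _)) ∨
      (p ∈ openLegs Λ ∧ ((p.1 ∈ a.map (Function.Embedding.subtype _) ∧
          ¬ p ∈ A.map (Function.Embedding.subtype _)) ∨
        (¬ p.1 ∈ a.map (Function.Embedding.subtype _) ∧
          p ∈ A.map (Function.Embedding.subtype _)))) := by
  rw [rtEdges, Finset.mem_union, Finset.mem_filter, Finset.mem_filter]

end

end HaPPY

theorem lemma1 (Λ : Finset Tile) (hΛ : IsPatch Λ) {N : ℕ} (e : Fin N ≃ ↥(openLegs Λ))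
    (he : ∀ k, (e (finRotate N k)).1 = nextLeg Λ (e k).1) (m : ℕ) (hm : m ≤ N)
    (a : Finset ↥Λ)
    (hrec : ComplementaryRecovery (encoding Λ) a (initialSegment e m)) :
    let A := initialSegment e m
    let e' : Fin N ≃ ↥(openLegs Λ) := (finRotate N ^ m).trans e
    let R := rtEdges Λ a A
    let ket : (↥a → ZMod 2) → (↥aᶜ → ZMod 2) → (↥(openLegs Λ) → ZMod 2) → ℂ :=
      fun i j x => encoding Λ x (glue a i j)
    ∃ (nA nB : ℕ) (posA : (↥a ⊕ Fin nA) ⊕ ↥R ≃ ↥A) (posB : (↥aᶜ ⊕ Fin nB) ⊕ ↥R ≃ ↥Aᶜ),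
      let logA : ↥a → ↥A := fun v => posA (.inl (.inl v))
      let auxA : Fin nA → ↥A := fun u => posA (.inl (.inr u))
      let rtA : ↥R → ↥A := fun r => posA (.inr r)
      let logB : ↥aᶜ → ↥Aᶜ := fun v => posB (.inl (.inl v))
      let auxB : Fin nB → ↥Aᶜ := fun u => posB (.inl (.inr u))
      let rtB : ↥R → ↥Aᶜ := fun r => posB (.inr r)
      ∃ UA ∈ Matrix.unitaryGroup (↥A → ZMod 2) ℂ, ∃ UB ∈ Matrix.unitaryGroup (↥Aᶜ → ZMod 2) ℂ,
      ∃ SA SB : List ((↥(openLegs Λ) × ZMod 2) × (↥(openLegs Λ) × ZMod 2)),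
        IsSwapFlip e A logA SA UA ∧ IsSwapFlip e' Aᶜ logB SB UB ∧
        (∃ χ : (↥aᶜ → ZMod 2) → (↥R → ZMod 2) → (↥Aᶜ → ZMod 2) → ℂ, ∀ i j,
          localOp A UA *ᵥ ket i j = fun x =>
            ketAt logA i (fun l => x l) * ketAt auxA 0 (fun l => x l) *
              χ j (fun r => x (rtA r)) (fun l => x l)) ∧
        (∃ χ : (↥a → ZMod 2) → (↥R → ZMod 2) → (↥A → ZMod 2) → ℂ, ∀ i j,
          localOp Aᶜ UB *ᵥ ket i j = fun x =>
            ketAt logB j (fun l => x l) * ketAt auxB 0 (fun l => x l) *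
              χ i (fun r => x (rtB r)) (fun l => x l)) ∧
        (∀ i j, localOp Aᶜ UB *ᵥ (localOp A UA *ᵥ ket i j) = fun x =>
          ketAt logA i (fun l => x l) * ketAt logB j (fun l => x l) *
            ketAt auxA 0 (fun l => x l) * ketAt auxB 0 (fun l => x l) *
              ∏ r, bell (x (rtA r)) (x (rtB r))) ∧
        (∃ p : (↥a → ZMod 2) → ↥a → ZMod 2, Function.Injective p ∧ ∀ i j v,
          HasDimer e (ket i j) ((nodePerm SA)⁻¹ (logA v, 0)) ((nodePerm SA)⁻¹ (logA v, 1))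
            (p i v)) ∧
        (∃ p : (↥aᶜ → ZMod 2) → ↥aᶜ → ZMod 2, Function.Injective p ∧ ∀ i j v,
          HasDimer e' (ket i j) ((nodePerm SB)⁻¹ (logB v, 0)) ((nodePerm SB)⁻¹ (logB v, 1))
            (p j v)) ∧
        (∃ p : (↥a → ZMod 2) → Fin nA → ZMod 2, ∀ i j u,
          HasDimer e (ket i j) ((nodePerm SA)⁻¹ (auxA u, 0)) ((nodePerm SA)⁻¹ (auxA u, 1))
            (p i u)) ∧
        (∃ p : (↥aᶜ → ZMod 2) → Fin nB → ZMod 2, ∀ i j u,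
          HasDimer e' (ket i j) ((nodePerm SB)⁻¹ (auxB u, 0)) ((nodePerm SB)⁻¹ (auxB u, 1))
            (p j u)) ∧
        (∀ i j r c, ∃ p : ZMod 2,
          HasDimer e (ket i j) ((nodePerm SA)⁻¹ (rtA r, c)) ((nodePerm SB)⁻¹ (rtB r, c + 1)) p) := by
  classical
  intro A e' R ket
  have hcol : Colouring Λ (fun p => p ∈ A.map (Function.Embedding.subtype _)) _ :=
    colouring_of_recovery hΛ e he m a hrec
  have so : SameOrder e e' Aᶜ _ := sameOrder_rotate e hm
  have hA : A = initialSegment e m := rfl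
  replace hrec : ComplementaryRecovery (encoding Λ) a A := hrec
  clear_value A
  have hd : Disjoint A Aᶜ := disjoint_compl_right
  have hcut := hcol.card_cut hΛ R mem_rtEdges
  simp only [mem_map_subtype (Subtype.prop _), Subtype.coe_eta] at hcut
  -- Any bijections with the RT edges serve: only their number matters, and `card_cut` supplies it
  -- in both directions.
  let out : ↥R ≃ {p // p ∈ A ∧ mate hΛ p ∉ A} := Fintype.equivOfCardEq (by
    rw [Fintype.card_coe, Fintype.card_subtype, ← hcut.1])
  let inn : ↥R ≃ {p // p ∉ A ∧ mate hΛ p ∈ A} := Fintype.equivOfCardEq (by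
    rw [Fintype.card_coe, Fintype.card_subtype, ← hcut.2])
  obtain ⟨P, Q, SA, SB, lam, ζ, ξ, hSA, heA, hSB, heB, F, hmem, dA, dB, dR⟩ :=
    exists_frame (encoding_norm hΛ) e hm hA hrec (fun p => exists_hasDimer hΛ e he p) out.bijective
      inn.bijective (by
        -- The central tile has a strip of one colour, hence a dimer inside one half.
        obtain ⟨p, hp⟩ := hcol.exists_mate hΛ hΛ.1
        rw [mem_map_subtype p.2, mem_map_subtype (mate hΛ p).2] at hp
        exact ⟨p, hp⟩)
  obtain ⟨nA, nB, wA, wB, XA, XB, hXA, hXB, hpA, hpB, hcirc⟩ :=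
    F.exists_circuits (encoding_norm hΛ) hrec.1 hrec.2
  refine ⟨nA, nB, (wA.sumCongr (Equiv.refl _)).trans P, (wB.sumCongr (Equiv.refl _)).trans Q, ?_⟩
  intro logA auxA rtA logB auxB rtB
  obtain ⟨uGA, uGB, hact⟩ := hcirc logA logB (fun _ => rfl) fun _ => rfl
  set GA := ∑ i, projAt logA i * XA i
  set GB := ∑ j, projAt logB j * XB j
  obtain ⟨WA, hWA, eWA⟩ := F.isLocal_left.exists_unitary F.unitary_left
  obtain ⟨WB, hWB, eWB⟩ := F.isLocal_right.exists_unitary F.unitary_right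
  have hket : ∀ i j, ket i j = HaPPY.col (encoding Λ) (ext a i + ext aᶜ j) := fun i j => by
    rw [ext_add_ext]; rfl
  have hUA : GA * WA ∈ Matrix.unitaryGroup (↥A → ZMod 2) ℂ :=
    mul_mem (Matrix.mem_unitaryGroup_iff'.2 uGA) hWA
  have hUB : GB * WB ∈ Matrix.unitaryGroup (↥Aᶜ → ZMod 2) ℂ :=
    mul_mem (Matrix.mem_unitaryGroup_iff'.2 uGB) hWB
  set UA := GA * WA with hUAdef
  set UB := GB * WB with hUBdef
  have item3 : ∀ i j, localOp Aᶜ UB *ᵥ (localOp A UA *ᵥ ket i j) = fun x =>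
      ketAt logA i (fun l => x l) * ketAt logB j (fun l => x l) *
        ketAt auxA 0 (fun l => x l) * ketAt auxB 0 (fun l => x l) *
          ∏ r, bell (x (rtA r)) (x (rtB r)) := by
    intro i j
    have h1 : localOp Aᶜ UB * localOp A UA =
        localOp Aᶜ GB * (localOp A GA * (swapProd e SB * swapProd e SA)) := by
      rw [hUAdef, hUBdef, localOp_mul, localOp_mul, ← eWA, ← eWB]
      calc _ = localOp Aᶜ GB * (localOp Aᶜ WB * localOp A GA) * localOp A WA := by
            simp only [mul_assoc]
        _ = _ := by rw [← localOp_comm hd]; simp only [mul_assoc]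
    rw [Matrix.mulVec_mulVec, h1, hket, ← Matrix.mulVec_mulVec, ← Matrix.mulVec_mulVec, hact]
    funext x
    exact modelState_add_place (joinHalves P Q) wA wB i j x
  have invA : localOp A UAᴴ * localOp A UA = 1 := by
    rw [← localOp_mul, ← localOp_one A]
    exact congrArg _ (Matrix.mem_unitaryGroup_iff'.1 hUA)
  have invB : localOp Aᶜ UBᴴ * localOp Aᶜ UB = 1 := by
    rw [← localOp_mul, ← localOp_one Aᶜ]
    exact congrArg _ (Matrix.mem_unitaryGroup_iff'.1 hUB)
  refine ⟨UA, hUA, UB, hUB, SA, SB, ⟨heA, hSA, XA, hXA, by rw [hUAdef, localOp_mul, eWA]⟩,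
    ⟨heB, hSB, XB, hXB, by rw [hUBdef, localOp_mul, eWB, so.swapProd hSB heB]⟩, ?_, ?_, item3,
    ⟨_, hpA, fun i j v => ?_⟩, ⟨_, hpB, fun i j v => ?_⟩,
    ⟨fun i u => lam (.inl (wA (.inr u))) (ext a i), fun i j u => ?_⟩,
    ⟨fun j u => lam (.inr (wB (.inr u))) (ext aᶜ j), fun i j u => ?_⟩, fun i j r c => dR r c _⟩
  -- Apply the inverse of the unitary on the complement to the joint decoding. It mixes only the
  -- factors of the complement, and these do not involve `i`.
  · refine ⟨fun j ρ y => ∑ z, UBᴴ y z * (ketAt logB j z * ketAt auxB 0 z *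
      ∏ r, bell (ρ r) (z (rtB r))), fun i j => ?_⟩
    have h := congrArg (localOp Aᶜ UBᴴ *ᵥ ·) (item3 i j)
    beta_reduce at h
    rw [Matrix.mulVec_mulVec, invB, Matrix.one_mulVec, localOp_mulVec_product hd UBᴴ fun s y =>
      ketAt logA i s * ketAt logB j y * ketAt auxA 0 s * ketAt auxB 0 y *
          ∏ r, bell (s (rtA r)) (y (rtB r))] at h
    rw [h]
    funext x
    rw [Finset.mul_sum]
    exact Finset.sum_congr rfl fun z _ => by ring
  · refine ⟨fun i ρ y => ∑ z, UAᴴ y z * (ketAt logA i z * ketAt auxA 0 z *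
      ∏ r, bell (z (rtA r)) (ρ r)), fun i j => ?_⟩
    have h := congrArg (localOp A UAᴴ *ᵥ ·) (item3 i j)
    beta_reduce at h
    rw [Matrix.mulVec_mulVec _ (localOp Aᶜ UB), ← localOp_comm hd, ← Matrix.mulVec_mulVec,
      Matrix.mulVec_mulVec, invA, Matrix.one_mulVec,
      localOp_mulVec_product hd.symm UAᴴ fun y s =>
      ketAt logA i s * ketAt logB j y * ketAt auxA 0 s * ketAt auxB 0 y *
          ∏ r, bell (s (rtA r)) (y (rtB r))] at h
    rw [h]
    funext x
    rw [Finset.mul_sum]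
    exact Finset.sum_congr rfl fun z _ => by ring
  · rw [hket, ← F.lam_left_add i j]
    exact dA (wA (.inl v)) _
  · rw [hket, ← F.lam_right_add i j]
    -- Both nodes lie in the complement, where moving the pivot multiplies the Majorana operators by
    -- a common string and keeps dimers and parities.
    exact so.hasDimer (hmem (logB v, 0)) (hmem (logB v, 1)) (dB (wB (.inl v)) _)
  · beta_reduce
    rw [hket, ← F.lam_left_add i j]
    exact dA (wA (.inr u)) _
  · beta_reduce
    rw [hket, ← F.lam_right_add i j]
    exact so.hasDimer (hmem (auxB u, 0)) (hmem (auxB u, 1)) (dB (wB (.inr u)) _)
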